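/- Fix $K\ge 1$ and $c>0$. Let $h:\mathbb R\to\mathbb R_+$ be a random measurable function with law $\nu_h$ (node potential) and $J:\mathbb R^K\to\mathbb R_+$ a random measurable function with law $\nu_J$ (edge potential), both jointly measurable in the randomness and the spins (for $J$ this includes the maps obtained by repeating coordinates). Let $\mathbb G(N,c)$ be the random $K$-uniform directed hypergraph on nodes $\{1,\dots,N\}$ with edges $e_1,\dots,e_{\lfloor cN\rfloor}$, where each $e_j=(u^j_1,\dots,u^j_K)$ is chosen independently and uniformly among all $N^K$ ordered $K$-tuples of nodes, repetition allowed. Its nodes carry i.i.d. copies $h_u$ of $h$ and its edges i.i.d. copies $J_j$ of $J$, all independent of each other and of the edges. Put $$Z(\mathbb G(N,c))=\int_{\mathbb R^N}\prod_{u=1}^N h_u(x_u)\prod_{j=1}^{\lfloor cN\rfloor}J_j(x_{u^j_1},\dots,x_{u^j_K})\,dx,\qquad \log 0=-\infty .$$ Assume that there are $\kappa>0$, $\rho_{\max}\ge\rho_{\min}>0$, $0<J_{\max}\le\rho_{\max}$ and $\Omega_h\subset\mathbb R$ such that 1. $[0,\kappa]\subset\Omega_h$ and, $\nu_h$-almost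 surely, $h(x)=0$ for all $x\notin\Omega_h$ and $\rho_{\min}\le\int_{[0,\kappa]}h(x)\,dx\le\int_{\mathbb R}h(x)\,dx\le\rho_{\max}$; 2. $\nu_J$-almost surely, $\sup_{x\in\mathbb R^K}J(x)\le J_{\max}$; 3. for every $i=1,\dots,K$, $\nu_J$-almost surely, $J(x)\ge\rho_{\min}$ for all $x\in\Omega_h^K$ with $x_i\in[0,\kappa)$. Assume further that there is a constant $\alpha\ge J_{\max}$ such that for all $r,n$ and all $x^1,\dots,x^r\in\Omega_h^n$ the expected tensor product $\mathbb E\bigotimes_{l=1}^rA_l$ of the arrays $A_l=(\alpha-J(x^l_{i_1},\dots,x^l_{i_K}))_{1\le i_1,\dots,i_K\le n}$ (with the same random $J$ in all factors) is convex on $\mathbb R_+^{n^r}$; that is, the function $$y\mapsto\sum_{i_1,\dots,i_K\in\{1,\dots,n\}^r}y_{i_1}\cdots y_{i_K}\;\mathbb E\prod_{l=1}^r\bigl(\alpha-J(x^l_{i_{1,l}},\dots,x^l_{i_{K,l}})\bigr)$$ is convex on $\{y\in\mathbb R^{n^r}:y\ge0\}$, where $i_{k,l}$ denotes the $l$-th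 entry of $i_k$. Then $\mathbb G(N,c)$ is right-converging with respect to $\nu_h,\nu_J$: there is a deterministic $z\in\mathbb R$ such that for every $\epsilon>0$ $$\lim_{N\to\infty}\mathbb P\bigl(|N^{-1}\log Z(\mathbb G(N,c))-z|>\epsilon\bigr)=0 .$$ The same conclusion holds for discrete spins: if $h:\{0,\dots,q-1\}\to\mathbb R_+$ and $J:\{0,\dots,q-1\}^K\to\mathbb R_+$ are random functions whose step-function extensions (equal to $h(i)$ on $[i,i+1)$, respectively $J(i_1,\dots,i_K)$ on $\prod_l[i_l,i_l+1)$, and $0$ elsewhere) satisfy the assumptions above, then it holds for $Z(\mathbb G(N,c))=\sum_{\sigma:\{1,\dots,N\}\to\{0,\dots,q-1\}}\prod_u h_u(\sigma(u))\prod_jJ_j(\sigma(u^j_1),\dots,\sigma(u^j_K))$. -/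

import Mathlib

open MeasureTheory Filter Topology
open scoped NNReal ENNReal

namespace SpinModel

noncomputable section

/-! ### Spin models on directed `K`-uniform hypergraphs

A hypergraph with nodes `Fin N` and `M` hyperedges is `e : Fin M → Fin K → Fin N`: the `j`-th edge is
the ordered tuple `(e j 0, …, e j (K-1))`; repeated nodes and repeated edges are allowed. -/

/-- The weight `∏ h_u(σ(u)) ∏ J_e(σ(u^e_1), …, σ(u^e_K))` of a spin assignment `σ : Fin N → X`. -/
def weight {X : Type*} {K N M : ℕ} (e : Fin M → Fin K → Fin N)
    (h : Fin N → X → ℝ≥0) (J : Fin M → (Fin K → X) → ℝ≥0) (σ : Fin N → X) : ℝ≥0 :=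
  (∏ u, h u (σ u)) * ∏ j, J j (fun k => σ (e j k))

/-- Partition function for real spins: the Lebesgue integral of the weight over `ℝ^N`. -/
def partitionFunction {K N M : ℕ} (e : Fin M → Fin K → Fin N)
    (h : Fin N → ℝ → ℝ≥0) (J : Fin M → (Fin K → ℝ) → ℝ≥0) : ℝ≥0∞ :=
  ∫⁻ x : Fin N → ℝ, (weight e h J x : ℝ≥0∞)

/-- Partition function for the discrete spins `0, …, q-1`: the sum of the weights. -/
def discretePartitionFunction {q K N M : ℕ} (e : Fin M → Fin K → Fin N)
    (h : Fin N → Fin q → ℝ≥0) (J : Fin M → (Fin K → Fin q) → ℝ≥0) : ℝ≥0∞ :=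
  ∑ σ : Fin N → Fin q, (weight e h J σ : ℝ≥0∞)

/-! ### Random potentials

A random node potential is a family `h : Sh → ℝ → ℝ≥0` on a probability space `(Sh, νh)`, and a random
edge potential a family `J : SJ → (Fin K → ℝ) → ℝ≥0` on a probability space `(SJ, νJ)`. -/

/-- Joint (Lebesgue) measurability of a random node potential. -/
def IsRandomNodePotential {Sh : Type*} [MeasurableSpace Sh] (νh : Measure Sh)
    (h : Sh → ℝ → ℝ≥0) : Prop :=
  AEMeasurable (fun p : Sh × ℝ => h p.1 p.2) (νh.prod volume)

/-- Joint (Lebesgue) measurability of a random edge potential. Because an edge may repeat a node, it is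
required of `(J, x) ↦ J(x_{v_1}, …, x_{v_K})` for every tuple of nodes `v`, so that all weights are
measurable. Joint Borel measurability of `(J, x) ↦ J(x)` is sufficient. -/
structure IsRandomEdgePotential {SJ : Type*} [MeasurableSpace SJ] (νJ : Measure SJ) {K : ℕ}
    (J : SJ → (Fin K → ℝ) → ℝ≥0) : Prop where
  eval : ∀ x : Fin K → ℝ, AEMeasurable (fun s => J s x) νJ
  joint : ∀ (N : ℕ) (v : Fin K → Fin N),
    AEMeasurable (fun p : SJ × (Fin N → ℝ) => J p.1 (fun k => p.2 (v k))) (νJ.prod volume)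

/-! ### The sparse Erdős–Rényi hypergraph with i.i.d. potentials -/

/-- Realizations of a random hypergraph with `N` nodes and `M` edges together with its potentials:
the edges, the node potentials and the edge potentials. -/
abbrev Realization (K N M : ℕ) (Sh SJ : Type*) : Type _ :=
  (Fin M → Fin K → Fin N) × (Fin N → Sh) × (Fin M → SJ)

/-- The number of edges of `𝔾(N,c)`. -/
def numEdges (c : ℝ) (N : ℕ) : ℕ := ⌊c * N⌋₊

/-- The law of `𝔾(N,c)` with its potentials: `⌊cN⌋` independent edges, each uniform among all `N^K`
ordered `K`-tuples of nodes, i.i.d. node potentials of law `νh` and i.i.d. edge potentials of law `νJ`,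
everything independent. -/
def erdosRenyi (K : ℕ) (c : ℝ) {Sh SJ : Type*} [MeasurableSpace Sh] [MeasurableSpace SJ]
    (νh : Measure Sh) (νJ : Measure SJ) (N : ℕ) :
    Measure (Realization K N (numEdges c N) Sh SJ) :=
  (Measure.pi fun _ => ProbabilityTheory.uniformOn (Set.univ : Set (Fin K → Fin N))).prod
    ((Measure.pi fun _ => νh).prod (Measure.pi fun _ => νJ))

/-- `N⁻¹ log Z_N` converges in probability to a deterministic real number `z`. Here `ENNReal.log`
takes values in the extended reals, with `log 0 = -∞`. -/
def LogPartitionConverges {Ω : ℕ → Type*} [∀ N, MeasurableSpace (Ω N)]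
    (P : ∀ N, Measure (Ω N)) (Z : ∀ N, Ω N → ℝ≥0∞) : Prop :=
  ∃ z : ℝ, ∀ ε : ℝ, 0 < ε →
    Tendsto (fun N : ℕ => P N {ω | ENNReal.ofReal ε <
        ((((N : ℝ)⁻¹ : ℝ) : EReal) * ENNReal.log (Z N ω) - (z : EReal)).abs})
      atTop (𝓝 0)

/-- `𝔾(N,c)` is right-converging with respect to the laws of the random potentials `h` and `J`
(real spins). -/
def RightConverging {K : ℕ} (c : ℝ) {Sh SJ : Type*} [MeasurableSpace Sh] [MeasurableSpace SJ]
    (νh : Measure Sh) (νJ : Measure SJ)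
    (h : Sh → ℝ → ℝ≥0) (J : SJ → (Fin K → ℝ) → ℝ≥0) : Prop :=
  LogPartitionConverges (erdosRenyi K c νh νJ)
    (fun _ G => partitionFunction G.1 (fun u => h (G.2.1 u)) (fun j => J (G.2.2 j)))

/-- `𝔾(N,c)` is right-converging with respect to the laws of the random potentials `h` and `J`
(discrete spins `0, …, q-1`). -/
def DiscreteRightConverging {q K : ℕ} (c : ℝ) {Sh SJ : Type*} [MeasurableSpace Sh]
    [MeasurableSpace SJ] (νh : Measure Sh) (νJ : Measure SJ)
    (h : Sh → Fin q → ℝ≥0) (J : SJ → (Fin K → Fin q) → ℝ≥0) : Prop :=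
  LogPartitionConverges (erdosRenyi K c νh νJ)
    (fun _ G => discretePartitionFunction G.1 (fun u => h (G.2.1 u)) (fun j => J (G.2.2 j)))

/-! ### Discrete models as continuous ones -/

/-- The step function equal to `h i` on `[i, i+1)`, `i = 0, …, q-1`, and to `0` elsewhere. -/
def stepNode {q : ℕ} (h : Fin q → ℝ≥0) (x : ℝ) : ℝ≥0 :=
  ∑ i : Fin q, (Set.Ico (i : ℝ) ((i : ℝ) + 1)).indicator (fun _ => h i) x

/-- The step function equal to `J (i_1, …, i_K)` on `∏ [i_l, i_l + 1)`, and to `0` elsewhere. -/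
def stepEdge {q K : ℕ} (J : (Fin K → Fin q) → ℝ≥0) (x : Fin K → ℝ) : ℝ≥0 :=
  ∑ i : Fin K → Fin q,
    (Set.univ.pi fun l => Set.Ico (i l : ℝ) ((i l : ℝ) + 1)).indicator (fun _ => J i) x

/-! ### Soft states -/

/-- The spin values in `[0,κ)` interact softly with all spin values in `Ωh`, and the potentials
are bounded above and below. -/
structure SoftStates {K : ℕ} {Sh SJ : Type*} [MeasurableSpace Sh] [MeasurableSpace SJ]
    (νh : Measure Sh) (νJ : Measure SJ) (h : Sh → ℝ → ℝ≥0) (J : SJ → (Fin K → ℝ) → ℝ≥0)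
    (κ ρmin ρmax Jmax : ℝ) (Ωh : Set ℝ) : Prop where
  κ_pos : 0 < κ
  ρmin_pos : 0 < ρmin
  ρmin_le : ρmin ≤ ρmax
  Jmax_pos : 0 < Jmax
  Jmax_le : Jmax ≤ ρmax
  core_subset : Set.Icc 0 κ ⊆ Ωh
  support : ∀ᵐ s ∂νh, ∀ x, x ∉ Ωh → h s x = 0
  le_integral : ∀ᵐ s ∂νh, ENNReal.ofReal ρmin ≤ ∫⁻ x in Set.Icc 0 κ, (h s x : ℝ≥0∞)
  integral_le : ∀ᵐ s ∂νh, ∫⁻ x, (h s x : ℝ≥0∞) ≤ ENNReal.ofReal ρmax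
  le_Jmax : ∀ᵐ s ∂νJ, ∀ x, (J s x : ℝ) ≤ Jmax
  soft : ∀ i : Fin K, ∀ᵐ s ∂νJ, ∀ x : Fin K → ℝ,
    x i ∈ Set.Ico 0 κ → (∀ k, x k ∈ Ωh) → ρmin ≤ (J s x : ℝ)

/-! ### Arrays of order `K` and convexity -/

/-- The form `⟨y, A⟩ = ∑ y_{i_1} ⋯ y_{i_K} a_{i_1, …, i_K}` of an array `A` of order `K` indexed
by `ι`. -/
def arrayForm {ι : Type*} [Fintype ι] {K : ℕ} (A : (Fin K → ι) → ℝ) (y : ι → ℝ) : ℝ :=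
  ∑ i : Fin K → ι, (∏ k, y (i k)) * A i

/-- Convexity of an array over a set `S`. -/
def ArrayConvexOn {ι : Type*} [Fintype ι] {K : ℕ} (S : Set (ι → ℝ))
    (A : (Fin K → ι) → ℝ) : Prop :=
  ConvexOn ℝ S (arrayForm A)

/-- The tensor product of `r` arrays of dimension `n` and order `K`, an array of dimension `n^r` and
order `K`. -/
def tensorArray {K n r : ℕ} (A : Fin r → (Fin K → Fin n) → ℝ) :
    (Fin K → (Fin r → Fin n)) → ℝ :=
  fun i => ∏ l, A l (fun k => i k l)

/-- The expected tensor product `𝔼 ⨂_l A_l` of the arrays `A_l = (α - J(x^l_{i_1}, …, x^l_{i_K}))`,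
the same random `J` being used in all factors; the expectation is componentwise. -/
def expectedTensor {SJ : Type*} [MeasurableSpace SJ] (νJ : Measure SJ) {K n r : ℕ}
    (J : SJ → (Fin K → ℝ) → ℝ≥0) (α : ℝ) (x : Fin r → Fin n → ℝ) :
    (Fin K → (Fin r → Fin n)) → ℝ :=
  fun i => ∫ s, tensorArray (fun l v => α - (J s (fun k => x l (v k)) : ℝ)) i ∂νJ

/-- For all `r`, `n` and `x^1, …, x^r ∈ Ωh^n`, the expected tensor product of the arrays `α - J` is
convex over the nonnegative orthant. -/
def TensorConvex {SJ : Type*} [MeasurableSpace SJ] (νJ : Measure SJ) {K : ℕ}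
    (J : SJ → (Fin K → ℝ) → ℝ≥0) (Ωh : Set ℝ) (α : ℝ) : Prop :=
  ∀ (r n : ℕ) (x : Fin r → Fin n → ℝ), (∀ l i, x l i ∈ Ωh) →
    ArrayConvexOn {y : (Fin r → Fin n) → ℝ | ∀ j, 0 ≤ y j} (expectedTensor νJ J α x)

end

end SpinModel

open ProbabilityTheory

namespace SpinModel

noncomputable section

set_option linter.unusedSectionVars false

/-! Two facts give the theorem: the free energy `log Z` concentrates around its mean, and the mean
divided by `N` converges.

Softness makes `log Z` locally stable. If the spin of a node `u` is restricted to the core `[0,κ)`,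
every factor incident to `u` is bounded below, whatever the other spins in `Ω` are. Deleting `u`
together with its factors therefore changes `log Z` by at most a constant times `deg u + 1`.
Resampling a node, or an edge (compare both versions with the model lacking that edge), has an
effect controlled by degrees, whose second moments are bounded in a sparse graph. The Efron–Stein
inequality (`meanSqDiff_pi_le`) then gives variance `O(N)`, and Chebyshev's inequality gives
concentration (`SoftModel.exists_deviation_le`).

The mean is handled by interpolation. Condition on everything but one edge and let `⟨·⟩` be the
Gibbs average without that edge. Adding the edge changes `log Z` by `log ⟨J⟩ = log α - ∑ m ≥ 1, ⟨α -
J⟩ ^ m / (m α ^ m)`. The power `⟨α - J⟩ ^ m` is an average over `m` independent replicas. Hence, if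
the endpoints of the edge are independent with law `c`, its expectation is an average over replicas
of the forms of the expected tensor products, evaluated at a vector on the diagonal with entries
`c`. By hypothesis this is convex in `c`, so the expected gain is concave in `c`. The uniform law on
`n₁ + n₂` nodes is the mixture, with weights proportional to `n₁` and `n₂`, of the uniform laws on
the two blocks. Making an edge global instead of internal to a block thus cannot lower the mean free
energy (`edgeAverage_superadditive`). If all edges are internal, `Z` factorizes.

To have the same number of independent edge slots in all systems, edges are allowed to be absent:
with `⌊cN⌋` slots, a block of `n` nodes receives each edge with probability `n/N`. This model is
exactly superadditive (`SoftModel.meanEnergy_superadditive`). The number of edges present in a block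
is binomial with mean within `1` of `cn`, and the mean free energy is Lipschitz in the number of
edges, so passing to exactly `⌊cn⌋` edges costs `O(√n)` (`SoftModel.abs_meanEnergy_lazy_sub_le`).
Cutting `N` nodes into many blocks of one size `n` and a remainder, a Fekete argument with error
`o(n)` per block yields the limit. -/

/-- Admissible realizations of a node potential. -/
structure SoftNode (κ : ℝ) (r R : ℝ≥0) (Ω : Set ℝ) (g : ℝ → ℝ≥0) : Prop where
  aem : AEMeasurable g
  supp : ∀ x, x ∉ Ω → g x = 0
  le_core : (r : ℝ≥0∞) ≤ ∫⁻ x in Set.Ico 0 κ, (g x : ℝ≥0∞)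
  le_top : ∫⁻ x, (g x : ℝ≥0∞) ≤ R

/-- Admissible realizations of a factor depending on the spins of the nodes in `A`. -/
structure SoftFactor (κ : ℝ) (r R : ℝ≥0) (Ω : Set ℝ) {n : ℕ} (A : Finset (Fin n))
    (φ : (Fin n → ℝ) → ℝ≥0) : Prop where
  aem : AEMeasurable φ
  le_top : ∀ x, φ x ≤ R
  soft : ∀ u ∈ A, ∀ x : Fin n → ℝ, x u ∈ Set.Ico 0 κ → (∀ v, x v ∈ Ω) → r ≤ φ x
  -- When `A` is empty, `soft` says nothing; this field covers the constant factor `1` of an absent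
  -- edge.
  box : ∀ x : Fin n → ℝ, (∀ v, x v ∈ Set.Ico 0 κ) → r ≤ φ x
  dep : ∀ u ∉ A, ∀ x y, φ (Function.update x u y) = φ x

/-- The weight of a spin configuration in a general factor model. -/
def factorWeight {n : ℕ} {I : Type*} [Fintype I] (g : Fin n → ℝ → ℝ≥0)
    (φ : I → (Fin n → ℝ) → ℝ≥0) (x : Fin n → ℝ) : ℝ≥0 :=
  (∏ v, g v (x v)) * ∏ i, φ i x

/-- The partition function of a general factor model. -/
def factorPartition {n : ℕ} {I : Type*} [Fintype I] (g : Fin n → ℝ → ℝ≥0)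
    (φ : I → (Fin n → ℝ) → ℝ≥0) : ℝ≥0∞ :=
  ∫⁻ x, (factorWeight g φ x : ℝ≥0∞)

/-! ### Integrals over spin configurations, one coordinate at a time -/

/-- Tonelli with the coordinate `u` singled out; as `B` ignores that coordinate, any value, here
`0`, may be inserted for it. -/
theorem lintegral_coord_mul {n : ℕ} (u : Fin (n + 1)) (g : ℝ → ℝ≥0)
    (B : (Fin (n + 1) → ℝ) → ℝ≥0∞) (hg : AEMeasurable g)
    (hB : ∀ x y, B (Function.update x u y) = B x)
    (hm : AEMeasurable fun x : Fin (n + 1) → ℝ => (g (x u) : ℝ≥0∞) * B x) :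
    ∫⁻ x : Fin (n + 1) → ℝ, (g (x u) : ℝ≥0∞) * B x
      = (∫⁻ y, (g y : ℝ≥0∞)) * ∫⁻ z : Fin n → ℝ, B (u.insertNth 0 z) := by
  have mp := (volume_preserving_piFinSuccAbove (fun _ : Fin (n + 1) => ℝ) u).symm
  rw [← mp.lintegral_comp_emb (MeasurableEquiv.measurableEmbedding _), Measure.volume_eq_prod,
    lintegral_prod]
  · have h1 : ∀ (y : ℝ) (z : Fin n → ℝ),
        ((MeasurableEquiv.piFinSuccAbove (fun _ : Fin (n + 1) => ℝ) u).symm (y, z))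
          = u.insertNth y z := fun y z => rfl
    simp only [h1, Fin.insertNth_apply_same]
    have h2 : ∀ (y : ℝ) (z : Fin n → ℝ),
        B (u.insertNth (α := fun _ => ℝ) y z) = B (u.insertNth (α := fun _ => ℝ) 0 z) := by
      intro y z
      rw [← hB (u.insertNth (α := fun _ => ℝ) 0 z) y]
      congr 1
      simp
    rw [← lintegral_mul_const'' _ hg.coe_nnreal_ennreal]
    refine lintegral_congr fun y => ?_
    rw [← lintegral_const_mul' _ _ ENNReal.coe_ne_top]
    exact lintegral_congr fun z => by rw [h2 y z]
  · exact hm.comp_quasiMeasurePreserving mp.quasiMeasurePreserving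

theorem aemeasurable_coord {n : ℕ} (u : Fin n) {g : ℝ → ℝ≥0} (hg : AEMeasurable g) :
    AEMeasurable fun x : Fin n → ℝ => g (x u) :=
  hg.comp_quasiMeasurePreserving
    (Measure.quasiMeasurePreserving_eval (fun _ : Fin n => volume) u)

theorem lintegral_prod_coord {n : ℕ} (g : Fin n → ℝ → ℝ≥0) (hg : ∀ v, AEMeasurable (g v)) :
    ∫⁻ x : Fin n → ℝ, ((∏ v, g v (x v) : ℝ≥0) : ℝ≥0∞) = ∏ v, ∫⁻ y, (g v y : ℝ≥0∞) := by
  induction n with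
  | zero => simp [volume_pi]
  | succ n ih =>
    have h1 := lintegral_coord_mul 0 (g 0)
      (fun x => ((∏ v : Fin n, g v.succ (x v.succ) : ℝ≥0) : ℝ≥0∞)) (hg 0)
      (fun x y => by simp)
      ((aemeasurable_coord 0 (hg 0)).coe_nnreal_ennreal.mul
        (Finset.aemeasurable_fun_prod _ fun v _ =>
          aemeasurable_coord v.succ (hg v.succ)).coe_nnreal_ennreal)
    simp only [Fin.prod_univ_succ, ENNReal.coe_mul]
    rw [h1, ← ih _ fun v => hg v.succ]
    simp

theorem aemeasurable_factorWeight {n : ℕ} {I : Type*} [Fintype I] {g : Fin n → ℝ → ℝ≥0}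
    {φ : I → (Fin n → ℝ) → ℝ≥0} (hg : ∀ v, AEMeasurable (g v)) (hφ : ∀ i, AEMeasurable (φ i)) :
    AEMeasurable (factorWeight g φ) :=
  (Finset.aemeasurable_fun_prod _ fun v _ => aemeasurable_coord v (hg v)).mul
    (Finset.aemeasurable_fun_prod _ fun i _ => hφ i)

/-! ### Crude bounds on the partition function -/

section Bounds

variable {κ : ℝ} {r R : ℝ≥0} {Ω : Set ℝ} {n : ℕ} {I : Type*} [Fintype I]
  {A : I → Finset (Fin n)} {g : Fin n → ℝ → ℝ≥0} {φ : I → (Fin n → ℝ) → ℝ≥0}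

theorem factorPartition_le (hg : ∀ v, SoftNode κ r R Ω (g v))
    (hφ : ∀ i, SoftFactor κ r R Ω (A i) (φ i)) :
    factorPartition g φ ≤ (R : ℝ≥0∞) ^ (n + Fintype.card I) := by
  calc factorPartition g φ
      ≤ ∫⁻ x : Fin n → ℝ, ((∏ v, g v (x v) : ℝ≥0) : ℝ≥0∞) * (R : ℝ≥0∞) ^ Fintype.card I := by
        refine lintegral_mono fun x => ?_
        rw [factorWeight, ENNReal.coe_mul]
        gcongr
        rw [← ENNReal.coe_pow, ENNReal.coe_le_coe]
        exact (Finset.prod_le_pow_card _ _ _ fun i _ => (hφ i).le_top x)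
    _ ≤ _ := by
        rw [lintegral_mul_const' _ _ (by simp), lintegral_prod_coord _ fun v => (hg v).aem, pow_add]
        gcongr
        refine (Finset.prod_le_pow_card _ _ _ fun v _ => (hg v).le_top).trans ?_
        simp

theorem le_factorPartition (hg : ∀ v, SoftNode κ r R Ω (g v))
    (hφ : ∀ i, SoftFactor κ r R Ω (A i) (φ i)) :
    (r : ℝ≥0∞) ^ (n + Fintype.card I) ≤ factorPartition g φ := by
  set g' : Fin n → ℝ → ℝ≥0 := fun v => (Set.Ico 0 κ).indicator (g v) with hg'
  calc (r : ℝ≥0∞) ^ (n + Fintype.card I)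
      ≤ ∫⁻ x : Fin n → ℝ, ((∏ v, g' v (x v) : ℝ≥0) : ℝ≥0∞) * (r : ℝ≥0∞) ^ Fintype.card I := by
        rw [lintegral_mul_const' _ _ (by simp), lintegral_prod_coord _ fun v =>
          (hg v).aem.indicator measurableSet_Ico, pow_add]
        gcongr
        have : ∀ v ∈ (Finset.univ : Finset (Fin n)), (r : ℝ≥0∞) ≤ ∫⁻ y, (g' v y : ℝ≥0∞) := by
          intro v _
          refine (hg v).le_core.trans (le_of_eq ?_)
          rw [← lintegral_indicator measurableSet_Ico]
          refine lintegral_congr fun y => ?_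
          by_cases hy : y ∈ Set.Ico 0 κ <;> simp [hg', hy]
        have h := Finset.pow_card_le_prod _ _ _ this
        rwa [Finset.card_univ, Fintype.card_fin] at h
    _ ≤ _ := by
        refine lintegral_mono fun x => ?_
        by_cases hx : ∀ v, x v ∈ Set.Ico 0 κ
        · rw [factorWeight, ENNReal.coe_mul]
          have : ∀ v, g' v (x v) = g v (x v) := fun v => by simp [hg', (hx v).1, (hx v).2]
          simp only [this]
          gcongr
          rw [← ENNReal.coe_pow, ENNReal.coe_le_coe]
          exact (Finset.pow_card_le_prod _ _ _ fun i _ => (hφ i).box x hx)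
        · obtain ⟨v, hv⟩ := not_forall.1 hx
          have : g' v (x v) = 0 := by simp only [hg']; exact Set.indicator_of_notMem hv _
          rw [Finset.prod_eq_zero (Finset.mem_univ v) this]
          simp

end Bounds

/-! ### Deleting a node and its incident factors -/

section Local

variable {κ : ℝ} {r R : ℝ≥0} {Ω : Set ℝ} {n : ℕ} {I : Type*} [Fintype I]
  {A : I → Finset (Fin (n + 1))} {g : Fin (n + 1) → ℝ → ℝ≥0}
  {φ : I → (Fin (n + 1) → ℝ) → ℝ≥0}

/-- The weight without the node `u` and its incident factors. -/
def deletedWeight (A : I → Finset (Fin (n + 1))) (g : Fin (n + 1) → ℝ → ℝ≥0)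
    (φ : I → (Fin (n + 1) → ℝ) → ℝ≥0) (u : Fin (n + 1)) (x : Fin (n + 1) → ℝ) : ℝ≥0 :=
  (∏ v ∈ Finset.univ.erase u, g v (x v)) * ∏ i with u ∉ A i, φ i x

/-- The partition function of the model without the node `u` and its incident factors. -/
def deletedPartition (A : I → Finset (Fin (n + 1))) (g : Fin (n + 1) → ℝ → ℝ≥0)
    (φ : I → (Fin (n + 1) → ℝ) → ℝ≥0) (u : Fin (n + 1)) : ℝ≥0∞ :=
  ∫⁻ z : Fin n → ℝ, (deletedWeight A g φ u (u.insertNth 0 z) : ℝ≥0∞)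

theorem factorWeight_eq (u : Fin (n + 1)) (x : Fin (n + 1) → ℝ) :
    factorWeight g φ x
      = g u (x u) * deletedWeight A g φ u x * ∏ i with u ∈ A i, φ i x := by
  rw [factorWeight, deletedWeight, ← Finset.mul_prod_erase _ _ (Finset.mem_univ u),
    ← Finset.prod_filter_mul_prod_filter_not _ (fun i => u ∈ A i) (fun i => φ i x)]
  ring

theorem lintegral_mul_deletedWeight (hg : ∀ v, SoftNode κ r R Ω (g v))
    (hφ : ∀ i, SoftFactor κ r R Ω (A i) (φ i)) (u : Fin (n + 1)) {f : ℝ → ℝ≥0}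
    (hf : AEMeasurable f) :
    ∫⁻ x : Fin (n + 1) → ℝ, (f (x u) : ℝ≥0∞) * (deletedWeight A g φ u x : ℝ≥0∞)
      = (∫⁻ y, (f y : ℝ≥0∞)) * deletedPartition A g φ u := by
  refine lintegral_coord_mul u f (fun x => (deletedWeight A g φ u x : ℝ≥0∞)) hf ?_ ?_
  · intro x y
    have h1 : ∀ v ∈ Finset.univ.erase u, g v (Function.update x u y v) = g v (x v) := by
      intro v hv
      rw [Function.update_of_ne (Finset.ne_of_mem_erase hv)]
    have h2 : ∀ i ∈ Finset.univ.filter (fun i => u ∉ A i), φ i (Function.update x u y) = φ i x :=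
      fun i hi => (hφ i).dep u (Finset.mem_filter.1 hi).2 x y
    simp only [deletedWeight, Finset.prod_congr rfl h1, Finset.prod_congr rfl h2]
  · exact (aemeasurable_coord u hf).coe_nnreal_ennreal.mul
      ((Finset.aemeasurable_fun_prod _ fun v _ => aemeasurable_coord v (hg v).aem).mul
        (Finset.aemeasurable_fun_prod _ fun i _ => (hφ i).aem)).coe_nnreal_ennreal

theorem factorPartition_le_deleted (hg : ∀ v, SoftNode κ r R Ω (g v))
    (hφ : ∀ i, SoftFactor κ r R Ω (A i) (φ i)) (u : Fin (n + 1)) :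
    factorPartition g φ
      ≤ (R : ℝ≥0∞) ^ ((Finset.univ.filter fun i => u ∈ A i).card + 1)
        * deletedPartition A g φ u := by
  calc factorPartition g φ
      ≤ ∫⁻ x : Fin (n + 1) → ℝ, (R : ℝ≥0∞) ^ (Finset.univ.filter fun i => u ∈ A i).card *
          ((g u (x u) : ℝ≥0∞) * (deletedWeight A g φ u x : ℝ≥0∞)) := by
        refine lintegral_mono fun x => ?_
        rw [factorWeight_eq (A := A) u x, mul_comm, ENNReal.coe_mul, ENNReal.coe_mul]
        gcongr
        rw [← ENNReal.coe_pow, ENNReal.coe_le_coe]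
        exact (Finset.prod_le_pow_card _ _ _ fun i _ => (hφ i).le_top x)
    _ ≤ _ := by
        rw [lintegral_const_mul' _ _ (by simp), lintegral_mul_deletedWeight hg hφ u (hg u).aem,
          pow_succ, mul_assoc]
        gcongr
        exact (hg u).le_top

/-- Restricting the spin of `u` to the core bounds each incident factor below by `r`, provided the
other spins lie in `Ω`; configurations violating this have weight zero because of the node
potentials. -/
theorem deleted_le_factorPartition (hκ : Set.Ico 0 κ ⊆ Ω) (hg : ∀ v, SoftNode κ r R Ω (g v))
    (hφ : ∀ i, SoftFactor κ r R Ω (A i) (φ i)) (u : Fin (n + 1)) :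
    (r : ℝ≥0∞) ^ ((Finset.univ.filter fun i => u ∈ A i).card + 1)
        * deletedPartition A g φ u ≤ factorPartition g φ := by
  set g' : ℝ → ℝ≥0 := (Set.Ico 0 κ).indicator (g u) with hg'
  have h1 : (r : ℝ≥0∞) ≤ ∫⁻ y, (g' y : ℝ≥0∞) := by
    refine (hg u).le_core.trans (le_of_eq ?_)
    rw [← lintegral_indicator measurableSet_Ico]
    refine lintegral_congr fun y => ?_
    by_cases hy : y ∈ Set.Ico 0 κ <;> simp [hg', hy]
  calc _ ≤ ∫⁻ x : Fin (n + 1) → ℝ, (r : ℝ≥0∞) ^ (Finset.univ.filter fun i => u ∈ A i).card *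
          ((g' (x u) : ℝ≥0∞) * (deletedWeight A g φ u x : ℝ≥0∞)) := by
        rw [lintegral_const_mul' _ _ (by simp), lintegral_mul_deletedWeight hg hφ u
          ((hg u).aem.indicator measurableSet_Ico), pow_succ, mul_assoc]
        gcongr
    _ ≤ _ := by
        refine lintegral_mono fun x => ?_
        by_cases hu : x u ∈ Set.Ico 0 κ
        · have hgu : g' (x u) = g u (x u) := Set.indicator_of_mem hu _
          by_cases hx : ∀ v, x v ∈ Ω
          · rw [factorWeight_eq (A := A) u x, mul_comm, ENNReal.coe_mul, ENNReal.coe_mul, hgu]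
            gcongr
            rw [← ENNReal.coe_pow, ENNReal.coe_le_coe]
            exact (Finset.pow_card_le_prod _ _ _ fun i hi =>
              (hφ i).soft u (Finset.mem_filter.1 hi).2 x hu hx)
          · obtain ⟨v, hv⟩ := not_forall.1 hx
            have hvu : v ≠ u := fun h => hv (h ▸ hκ hu)
            have : deletedWeight A g φ u x = 0 := by
              rw [deletedWeight, Finset.prod_eq_zero
                (Finset.mem_erase.2 ⟨hvu, Finset.mem_univ v⟩) ((hg v).supp _ hv), zero_mul]
            simp [this]
        · have : g' (x u) = 0 := Set.indicator_of_notMem hu _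
          simp [this]

end Local

/-- The free energy `log Z` of a factor model. -/
def logPartition {n : ℕ} {I : Type*} [Fintype I] (g : Fin n → ℝ → ℝ≥0)
    (φ : I → (Fin n → ℝ) → ℝ≥0) : ℝ :=
  Real.log (factorPartition g φ).toReal

/-- The logarithmic ratio of the upper and the lower bound on the potentials. -/
def logRatio (r R : ℝ≥0) : ℝ := Real.log R - Real.log r

/-! ### Stability of the free energy under local changes -/

section Log

variable {κ : ℝ} {r R : ℝ≥0} {Ω : Set ℝ}

theorem logRatio_nonneg (hr1 : r ≤ 1) (hR : 1 ≤ R) : 0 ≤ logRatio r R :=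
  sub_nonneg.2 ((Real.log_nonpos r.2 (by exact_mod_cast hr1)).trans
    (Real.log_nonneg (by exact_mod_cast hR)))

/-- Thanks to `r ≤ 1 ≤ R`, both `log R` and `-log r` are at most `logRatio r R`, so a single
constant serves both directions. -/
theorem abs_log_sub_le (hr : 0 < r) (hr1 : r ≤ 1) (hR : 1 ≤ R) {a b : ℝ} {k : ℕ} (hb : 0 < b)
    (h1 : (r : ℝ) ^ k * b ≤ a) (h2 : a ≤ (R : ℝ) ^ k * b) :
    |Real.log a - Real.log b| ≤ logRatio r R * k := by
  have hr' : (0 : ℝ) < r := by exact_mod_cast hr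
  have hR' : (0 : ℝ) < R := lt_of_lt_of_le one_pos (by exact_mod_cast hR)
  have ha : 0 < a := lt_of_lt_of_le (by positivity) h1
  have e1 := Real.log_le_log (by positivity) h1
  have e2 := Real.log_le_log ha h2
  rw [Real.log_mul (by positivity) (by positivity), Real.log_pow] at e1 e2
  have h3 : Real.log r ≤ 0 := Real.log_nonpos r.2 (by exact_mod_cast hr1)
  have h4 : 0 ≤ Real.log R := Real.log_nonneg (by exact_mod_cast hR)
  have hk : (0 : ℝ) ≤ k := k.cast_nonneg
  rw [abs_le, logRatio]
  constructor <;> nlinarith [mul_nonneg hk h4, mul_nonneg hk (neg_nonneg.2 h3)]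

variable {I : Type*} [Fintype I]

section

variable {n : ℕ} {A : I → Finset (Fin n)} {g : Fin n → ℝ → ℝ≥0} {φ : I → (Fin n → ℝ) → ℝ≥0}

theorem factorPartition_pos (hr : 0 < r) (hg : ∀ v, SoftNode κ r R Ω (g v))
    (hφ : ∀ i, SoftFactor κ r R Ω (A i) (φ i)) : factorPartition g φ ≠ 0 := by
  have := le_factorPartition hg hφ
  intro h
  rw [h, nonpos_iff_eq_zero] at this
  exact pow_ne_zero _ (by simpa using hr.ne') this

theorem factorPartition_ne_top (hg : ∀ v, SoftNode κ r R Ω (g v))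
    (hφ : ∀ i, SoftFactor κ r R Ω (A i) (φ i)) : factorPartition g φ ≠ ∞ :=
  ne_top_of_le_ne_top (by simp) (factorPartition_le hg hφ)

theorem abs_logPartition_le (hr : 0 < r) (hr1 : r ≤ 1) (hR : 1 ≤ R)
    (hg : ∀ v, SoftNode κ r R Ω (g v)) (hφ : ∀ i, SoftFactor κ r R Ω (A i) (φ i)) :
    |logPartition g φ| ≤ logRatio r R * (n + Fintype.card I) := by
  have h1 := ENNReal.toReal_mono (factorPartition_ne_top hg hφ) (le_factorPartition hg hφ)
  have h2 := ENNReal.toReal_mono (by simp) (factorPartition_le hg hφ)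
  have := abs_log_sub_le hr hr1 hR (b := 1) (k := n + Fintype.card I) one_pos
    (by simpa using h1) (by simpa using h2)
  simpa [logPartition] using this

end

section

variable {n : ℕ} {A A' : I → Finset (Fin (n + 1))} {g g' : Fin (n + 1) → ℝ → ℝ≥0}
  {φ φ' : I → (Fin (n + 1) → ℝ) → ℝ≥0}

theorem abs_logPartition_sub_deleted (hκ : Set.Ico 0 κ ⊆ Ω) (hr : 0 < r) (hr1 : r ≤ 1)
    (hR : 1 ≤ R) (hg : ∀ v, SoftNode κ r R Ω (g v))
    (hφ : ∀ i, SoftFactor κ r R Ω (A i) (φ i)) (u : Fin (n + 1)) :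
    |logPartition g φ - Real.log (deletedPartition A g φ u).toReal|
      ≤ logRatio r R * ((Finset.univ.filter fun i => u ∈ A i).card + 1) := by
  have h1 := deleted_le_factorPartition hκ hg hφ u
  have h2 := factorPartition_le_deleted hg hφ u
  have hZ := factorPartition_pos hr hg hφ
  have hZ' := factorPartition_ne_top hg hφ
  have hD : deletedPartition A g φ u ≠ 0 := by
    intro h
    rw [h, mul_zero, nonpos_iff_eq_zero] at h2
    exact hZ h2
  have hD' : deletedPartition A g φ u ≠ ∞ := by
    intro h
    rw [h, ENNReal.mul_top (by simp [hr.ne']), top_le_iff] at h1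
    exact hZ' h1
  have h3 := ENNReal.toReal_mono hZ' h1
  have h4 := ENNReal.toReal_mono (ENNReal.mul_ne_top (by simp) hD') h2
  have := abs_log_sub_le hr hr1 hR (ENNReal.toReal_pos hD hD') (by simpa using h3)
    (by simpa using h4)
  simpa [logPartition] using this

/-- Both models become the same once `u` is deleted; the factor `2` is the triangle inequality
through that common model. -/
theorem abs_logPartition_sub_node (hκ : Set.Ico 0 κ ⊆ Ω) (hr : 0 < r) (hr1 : r ≤ 1)
    (hR : 1 ≤ R) (hg : ∀ v, SoftNode κ r R Ω (g v)) (hg' : ∀ v, SoftNode κ r R Ω (g' v))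
    (hφ : ∀ i, SoftFactor κ r R Ω (A i) (φ i)) (u : Fin (n + 1)) (h : ∀ v, v ≠ u → g' v = g v) :
    |logPartition g φ - logPartition g' φ|
      ≤ 2 * logRatio r R * ((Finset.univ.filter fun i => u ∈ A i).card + 1) := by
  have h1 := abs_logPartition_sub_deleted hκ hr hr1 hR hg hφ u
  have h2 := abs_logPartition_sub_deleted hκ hr hr1 hR hg' hφ u
  have h3 : deletedPartition A g' φ u = deletedPartition A g φ u := by
    refine lintegral_congr fun z => ?_
    rw [deletedWeight, deletedWeight, Finset.prod_congr rfl fun v hv => by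
      rw [h v (Finset.ne_of_mem_erase hv)]]
  rw [h3] at h2
  have := abs_sub_le (logPartition g φ) (Real.log (deletedPartition A g φ u).toReal)
    (logPartition g' φ)
  rw [abs_sub_comm (Real.log _)] at this
  linarith

/-- Deleting `u` also deletes the factor `i`, so both models have the same deleted model. The degree
is counted in the model without `i`: in the random setting this makes it independent of the edge
`i`. With `d` this degree, the two comparisons cost `d + 2` and `d + 1`. -/
theorem abs_logPartition_sub_erase (hκ : Set.Ico 0 κ ⊆ Ω) (hr : 0 < r) (hr1 : r ≤ 1)
    (hR : 1 ≤ R) (hg : ∀ v, SoftNode κ r R Ω (g v))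
    (hφ : ∀ i, SoftFactor κ r R Ω (A i) (φ i)) (hφ' : ∀ i, SoftFactor κ r R Ω (A' i) (φ' i))
    (i : I) (u : Fin (n + 1)) (hu : u ∈ A i) (hA : A' i = ∅) (h1 : ∀ x, φ' i x = 1)
    (h : ∀ j, j ≠ i → φ' j = φ j ∧ A' j = A j) :
    |logPartition g φ - logPartition g φ'|
      ≤ 2 * logRatio r R * ((Finset.univ.filter fun j => u ∈ A' j).card + 2) := by
  classical
  have e1 := abs_logPartition_sub_deleted hκ hr hr1 hR hg hφ u
  have e2 := abs_logPartition_sub_deleted hκ hr hr1 hR hg hφ' u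
  have h3 : deletedPartition A' g φ' u = deletedPartition A g φ u := by
    refine lintegral_congr fun z => ?_
    rw [deletedWeight, deletedWeight, Finset.prod_filter, Finset.prod_filter]
    congr 2
    refine Finset.prod_congr rfl fun j _ => ?_
    by_cases hj : j = i
    · subst hj; simp [h1, hu]
    · rw [(h j hj).1, (h j hj).2]
  have h4 : Finset.univ.filter (fun j => u ∈ A j)
      = insert i (Finset.univ.filter fun j => u ∈ A' j) := by
    ext j
    by_cases hj : j = i
    · subst hj; simp [hu]
    · simp [hj, (h j hj).2]
  rw [h4, Finset.card_insert_of_notMem (by simp [hA])] at e1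
  push_cast at e1
  rw [h3] at e2
  have := abs_sub_le (logPartition g φ) (Real.log (deletedPartition A g φ u).toReal)
    (logPartition g φ')
  rw [abs_sub_comm (Real.log _)] at this
  have h5 := logRatio_nonneg hr1 hR
  linarith

end

end Log

/-! ### Product measures -/

/-- Serves both purposes of resampling: with the same law in Efron–Stein, with a different law when
the interpolation switches one edge. -/
theorem measurePreserving_update {ι : Type*} [Fintype ι] [DecidableEq ι] {S : Type*}
    [MeasurableSpace S] (μ : ι → Measure S) [∀ i, IsProbabilityMeasure (μ i)] (i : ι)
    (ν : Measure S) [IsProbabilityMeasure ν] :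
    MeasurePreserving (fun p : (ι → S) × S => Function.update p.1 i p.2)
      ((Measure.pi μ).prod ν) (Measure.pi (Function.update μ i ν)) := by
  have hm : Measurable (fun p : (ι → S) × S => Function.update p.1 i p.2) := by
    refine measurable_pi_lambda _ fun j => ?_
    by_cases hj : j = i
    · subst hj; simpa using measurable_snd
    · simp only [Function.update_of_ne hj]
      exact (measurable_pi_apply j).comp measurable_fst
  have : ∀ j, IsProbabilityMeasure (Function.update μ i ν j) := by
    intro j
    by_cases hj : j = i
    · subst hj; simpa
    · simp [hj]; infer_instance
  refine ⟨hm, (Measure.pi_eq fun s hs => ?_).symm⟩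
  rw [Measure.map_apply hm (MeasurableSet.univ_pi hs)]
  have : (fun p : (ι → S) × S => Function.update p.1 i p.2) ⁻¹' (Set.univ.pi s)
      = (Set.univ.pi (Function.update s i Set.univ)) ×ˢ s i := by
    ext ⟨x, y⟩
    simp only [Set.mem_preimage, Set.mem_pi, Set.mem_univ, true_implies, Set.mem_prod]
    constructor
    · intro h
      refine ⟨fun j => ?_, by simpa using h i⟩
      by_cases hj : j = i
      · subst hj; simp
      · simpa [hj] using h j
    · rintro ⟨h1, h2⟩ j
      by_cases hj : j = i
      · subst hj; simpa
      · simpa [hj] using h1 j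
  rw [this, Measure.prod_prod, Measure.pi_pi, ← Finset.mul_prod_erase _ _ (Finset.mem_univ i),
    ← Finset.mul_prod_erase _ _ (Finset.mem_univ i)]
  simp only [Function.update_self, measure_univ, one_mul]
  rw [mul_comm]
  congr 1
  refine Finset.prod_congr rfl fun j hj => ?_
  simp [Finset.ne_of_mem_erase hj]

theorem measurePreserving_update_self {ι : Type*} [Fintype ι] [DecidableEq ι] {S : Type*}
    [MeasurableSpace S] (μ : Measure S) [IsProbabilityMeasure μ] (i : ι) :
    MeasurePreserving (fun p : (ι → S) × S => Function.update p.1 i p.2)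
      ((Measure.pi fun _ => μ).prod μ) (Measure.pi fun _ => μ) := by
  have := measurePreserving_update (fun _ : ι => μ) i μ
  rwa [Function.update_eq_self_iff.2 rfl] at this

theorem measurePreserving_comp_injective {ι κ : Type*} [Fintype ι] [Fintype κ] {S : Type*}
    [MeasurableSpace S] (μ : Measure S) [IsProbabilityMeasure μ] {f : κ → ι}
    (hf : Function.Injective f) :
    MeasurePreserving (fun x : ι → S => x ∘ f) (Measure.pi fun _ => μ)
      (Measure.pi fun _ => μ) := by
  classical
  have hm : Measurable (fun x : ι → S => x ∘ f) :=
    measurable_pi_lambda _ fun j => measurable_pi_apply (f j)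
  refine ⟨hm, (Measure.pi_eq fun s hs => ?_).symm⟩
  rw [Measure.map_apply hm (MeasurableSet.univ_pi hs)]
  have : (fun x : ι → S => x ∘ f) ⁻¹' (Set.univ.pi s)
      -- The preimage of a box is a box that leaves the coordinates outside the range of `f` free.
      = Set.univ.pi (fun i => if h : ∃ k, f k = i then s h.choose else Set.univ) := by
    ext x
    simp only [Set.mem_preimage, Set.mem_pi, Set.mem_univ, true_implies, Function.comp]
    constructor
    · intro h i
      split_ifs with hi
      · have := h hi.choose; rwa [hi.choose_spec] at this
      · trivial
    · intro h k
      have h1 : ∃ k', f k' = f k := ⟨k, rfl⟩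
      have h2 : h1.choose = k := hf h1.choose_spec
      have := h (f k)
      rwa [dif_pos h1, h2] at this
  rw [this, Measure.pi_pi, ← Finset.prod_subset (Finset.subset_univ (Finset.univ.image f)),
    Finset.prod_image (fun a _ b _ h => hf h)]
  · refine Finset.prod_congr rfl fun k _ => ?_
    have h1 : ∃ k', f k' = f k := ⟨k, rfl⟩
    have h2 : h1.choose = k := hf h1.choose_spec
    rw [dif_pos h1, h2]
  · intro i _ hi
    rw [dif_neg, measure_univ]
    rintro ⟨k, rfl⟩
    exact hi (Finset.mem_image_of_mem _ (Finset.mem_univ k))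

theorem measurePreserving_castAdd_natAdd {m n : ℕ} {S : Type*} [MeasurableSpace S]
    (μ : Measure S) [SigmaFinite μ] :
    MeasurePreserving
      (fun x : Fin (m + n) → S => ((fun i => x (Fin.castAdd n i)), (fun i => x (Fin.natAdd m i))))
      (Measure.pi fun _ => μ) ((Measure.pi fun _ => μ).prod (Measure.pi fun _ => μ)) := by
  have h1 := (measurePreserving_piCongrLeft (fun _ : Fin (m + n) => μ)
    (finSumFinEquiv (m := m) (n := n))).symm
  have h2 := measurePreserving_sumPiEquivProdPi (X := fun _ : Fin m ⊕ Fin n => S) (fun _ => μ)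
  exact h2.comp h1

/-- Joint measurability of the edge potential is available only for each fixed tuple of nodes. Since
there are finitely many tuples, the exceptional null sets can be united. -/
theorem aemeasurable_of_discrete {O T X Y : Type*} [Finite O] [MeasurableSpace O]
    [DiscreteMeasurableSpace O] [MeasurableSpace T] [MeasurableSpace X] [MeasurableSpace Y]
    (μ : Measure O) [SFinite μ] (ν : Measure T) [SFinite ν] (ρ : Measure X) [SFinite ρ]
    {f : (O × T) × X → Y}
    (hf : ∀ o, AEMeasurable (fun p : T × X => f ((o, p.1), p.2)) (ν.prod ρ)) :
    AEMeasurable f ((μ.prod ν).prod ρ) := by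
  have hq : Measure.QuasiMeasurePreserving (fun p : (O × T) × X => (p.1.2, p.2))
      ((μ.prod ν).prod ρ) (ν.prod ρ) :=
    MeasureTheory.QuasiMeasurePreserving.prodMap Measure.quasiMeasurePreserving_snd
      (Measure.QuasiMeasurePreserving.id ρ)
  refine ⟨fun p => (hf p.1.1).mk _ (p.1.2, p.2), ?_, ?_⟩
  · have h : Measurable fun q : O × (T × X) => (hf q.1).mk _ q.2 :=
      measurable_from_prod_countable_right fun o => (hf o).measurable_mk
    exact h.comp (f := fun p : (O × T) × X => (p.1.1, (p.1.2, p.2))) (by fun_prop)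
  · have := hq.ae (ae_all_iff.2 fun o => (hf o).ae_eq_mk)
    filter_upwards [this] with p hp
    exact hp p.1.1

/-! ### The Efron–Stein inequality -/

/-- The mean square difference of `f` at two independent points; twice the variance of `f`. -/
def meanSqDiff {α : Type*} [MeasurableSpace α] (μ : Measure α) (f : α → ℝ) : ℝ≥0∞ :=
  ∫⁻ x, ∫⁻ y, ENNReal.ofReal ((f x - f y) ^ 2) ∂μ ∂μ

theorem meanSqDiff_eq_prod {α : Type*} [MeasurableSpace α] (μ : Measure α) [SFinite μ]
    {f : α → ℝ} (hf : Measurable f) :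
    meanSqDiff μ f = ∫⁻ p, ENNReal.ofReal ((f p.1 - f p.2) ^ 2) ∂(μ.prod μ) := by
  rw [lintegral_prod _ (by fun_prop)]; rfl

/-- Take independent pairs `a, a'` and `b, b'` and view the four values of `f` as the vertices of a
quadrilateral. The squares of its two diagonals sum to at most the squares of its four sides, the
difference being a square. By symmetry the diagonals have the same mean square, as do opposite
sides. -/
theorem meanSqDiff_prod_le {α β : Type*} [MeasurableSpace α] [MeasurableSpace β]
    (μ : Measure α) [IsProbabilityMeasure μ] (ν : Measure β) [IsProbabilityMeasure ν]
    {f : α × β → ℝ} (hf : Measurable f) :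
    meanSqDiff (μ.prod ν) f ≤ ∫⁻ a, meanSqDiff ν (fun b => f (a, b)) ∂μ
      + ∫⁻ b, meanSqDiff μ (fun a => f (a, b)) ∂ν := by
  set Q : Measure ((α × α) × (β × β)) := (μ.prod μ).prod (ν.prod ν) with hQ
  set D : ((α × α) × (β × β) → ℝ) → ℝ≥0∞ := fun F => ∫⁻ q, ENNReal.ofReal (F q ^ 2) ∂Q with hD
  have s1 : MeasurePreserving (fun q : (α × α) × (β × β) => ((q.1.2, q.1.1), q.2)) Q Q :=
    Measure.measurePreserving_swap.prod (MeasurePreserving.id _)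
  have s2 : MeasurePreserving (fun q : (α × α) × (β × β) => (q.1, (q.2.2, q.2.1))) Q Q :=
    (MeasurePreserving.id _).prod Measure.measurePreserving_swap
  have e1 : meanSqDiff (μ.prod ν) f
      = D fun q => f (q.1.1, q.2.1) - f (q.1.2, q.2.2) := by
    simp only [meanSqDiff, hD, hQ]
    rw [lintegral_prod _ (by fun_prop), lintegral_prod _ (by fun_prop),
      lintegral_prod _ (by fun_prop)]
    refine lintegral_congr fun a => ?_
    have h1 : ∀ b, ∫⁻ y, ENNReal.ofReal ((f (a, b) - f y) ^ 2) ∂(μ.prod ν)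
        = ∫⁻ a', ∫⁻ b', ENNReal.ofReal ((f (a, b) - f (a', b')) ^ 2) ∂ν ∂μ :=
      fun b => lintegral_prod _ (by fun_prop)
    simp only [h1]
    rw [lintegral_lintegral_swap (by fun_prop)]
    refine lintegral_congr fun a' => ?_
    rw [lintegral_prod _ (by fun_prop)]
  have e1' : meanSqDiff (μ.prod ν) f
      = D fun q => f (q.1.2, q.2.1) - f (q.1.1, q.2.2) := by
    rw [e1]; exact (s1.lintegral_comp (by fun_prop)).symm
  have e2 : ∫⁻ a, meanSqDiff ν (fun b => f (a, b)) ∂μ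
      = D fun q => f (q.1.1, q.2.1) - f (q.1.1, q.2.2) := by
    simp only [hD, hQ]
    rw [lintegral_prod _ (by fun_prop), lintegral_prod _ (by fun_prop)]
    refine lintegral_congr fun a => ?_
    dsimp only
    rw [lintegral_const, measure_univ, mul_one, meanSqDiff_eq_prod _ (by fun_prop)]
  have e2' : ∫⁻ a, meanSqDiff ν (fun b => f (a, b)) ∂μ
      = D fun q => f (q.1.2, q.2.1) - f (q.1.2, q.2.2) := by
    rw [e2]; exact (s1.lintegral_comp (by fun_prop)).symm
  have e3 : ∫⁻ b, meanSqDiff μ (fun a => f (a, b)) ∂ν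
      = D fun q => f (q.1.1, q.2.1) - f (q.1.2, q.2.1) := by
    simp only [hD, hQ]
    rw [lintegral_prod_symm _ (by fun_prop), lintegral_prod _ (by fun_prop)]
    refine lintegral_congr fun b => ?_
    dsimp only
    rw [lintegral_const, measure_univ, mul_one, meanSqDiff_eq_prod _ (by fun_prop)]
  have e3' : ∫⁻ b, meanSqDiff μ (fun a => f (a, b)) ∂ν
      = D fun q => f (q.1.1, q.2.2) - f (q.1.2, q.2.2) := by
    rw [e3]; exact (s2.lintegral_comp (by fun_prop)).symm
  have key : meanSqDiff (μ.prod ν) f + meanSqDiff (μ.prod ν) f ≤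
      (∫⁻ a, meanSqDiff ν (fun b => f (a, b)) ∂μ + ∫⁻ a, meanSqDiff ν (fun b => f (a, b)) ∂μ)
      + (∫⁻ b, meanSqDiff μ (fun a => f (a, b)) ∂ν
        + ∫⁻ b, meanSqDiff μ (fun a => f (a, b)) ∂ν) := by
    conv_lhs => rw [e1]; arg 2; rw [← e1, e1']
    conv_rhs => arg 1; rw [e2]; arg 2; rw [← e2, e2']
    conv_rhs => arg 2; rw [e3]; arg 2; rw [← e3, e3']
    simp only [hD]
    rw [← lintegral_add_left (by fun_prop), ← lintegral_add_left (by fun_prop),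
      ← lintegral_add_left (by fun_prop), ← lintegral_add_left (by fun_prop)]
    refine lintegral_mono fun q => ?_
    rw [← ENNReal.ofReal_add (by positivity) (by positivity),
      ← ENNReal.ofReal_add (by positivity) (by positivity),
      ← ENNReal.ofReal_add (by positivity) (by positivity),
      ← ENNReal.ofReal_add (by positivity) (by positivity)]
    refine ENNReal.ofReal_le_ofReal ?_
    nlinarith [sq_nonneg (f (q.1.1, q.2.1) + f (q.1.2, q.2.2) - f (q.1.2, q.2.1)
      - f (q.1.1, q.2.2))]
  have h2 : (2 : ℝ≥0∞) * meanSqDiff (μ.prod ν) f ≤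
      2 * (∫⁻ a, meanSqDiff ν (fun b => f (a, b)) ∂μ
        + ∫⁻ b, meanSqDiff μ (fun a => f (a, b)) ∂ν) := by
    rw [two_mul, two_mul]; refine key.trans (le_of_eq ?_); abel
  exact (ENNReal.mul_le_mul_iff_right (by simp) (by simp)).1 h2

/-- The mean square effect of resampling the coordinate `i`. -/
def resampleSq {ι S : Type*} [Fintype ι] [DecidableEq ι] [MeasurableSpace S] (μ : Measure S)
    (f : (ι → S) → ℝ) (i : ι) : ℝ≥0∞ :=
  ∫⁻ p, ENNReal.ofReal ((f p.1 - f (Function.update p.1 i p.2)) ^ 2)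
    ∂((Measure.pi fun _ => μ).prod μ)

/-- Efron–Stein by induction, peeling off coordinate `0` with the two-factor case. With values in
`ℝ≥0∞` no integrability is required. -/
theorem meanSqDiff_pi_le {S : Type*} [MeasurableSpace S] (μ : Measure S) [IsProbabilityMeasure μ]
    {n : ℕ} {f : (Fin n → S) → ℝ} (hf : Measurable f) :
    meanSqDiff (Measure.pi fun _ => μ) f ≤ ∑ i, resampleSq μ f i := by
  induction n with
  | zero =>
    have : ∀ x y, f x = f y := fun x y => congrArg f (Subsingleton.elim x y)
    simp [meanSqDiff, fun x y => sub_eq_zero.2 (this x y)]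
  | succ n ih =>
    have mp := measurePreserving_piFinSuccAbove (fun _ : Fin (n + 1) => μ) 0
    have mp' : MeasurePreserving (fun p : S × (Fin n → S) => (Fin.cons p.1 p.2 : Fin (n + 1) → S))
        (μ.prod (Measure.pi fun _ => μ)) (Measure.pi fun _ => μ) := by
      convert mp.symm using 1
      funext p
      exact (Fin.insertNth_zero (α := fun _ => S) p.1 p.2).symm
    have hc := mp'.measurable
    set f' : S × (Fin n → S) → ℝ := fun p => f (Fin.cons p.1 p.2) with hf'
    have hf'm : Measurable f' := hf.comp hc
    have e1 : meanSqDiff (Measure.pi fun _ => μ) f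
        = meanSqDiff (μ.prod (Measure.pi fun _ : Fin n => μ)) f' := by
      rw [meanSqDiff_eq_prod _ hf, meanSqDiff_eq_prod _ hf'm]
      exact ((mp'.prod mp').lintegral_comp (by fun_prop)).symm
    have hu : ∀ {m : ℕ} (i : Fin m), Measurable fun p : (Fin m → S) × S =>
        Function.update p.1 i p.2 := fun i => (measurePreserving_update_self μ i).measurable
    have e2 : ∫⁻ b, meanSqDiff μ (fun a => f' (a, b)) ∂(Measure.pi fun _ : Fin n => μ)
        = resampleSq μ f 0 := by
      have h := (mp'.prod (MeasurePreserving.id μ)).lintegral_comp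
        (f := fun p : (Fin (n + 1) → S) × S =>
          ENNReal.ofReal ((f p.1 - f (Function.update p.1 0 p.2)) ^ 2))
        (by have := hf.comp (hu (0 : Fin (n + 1))); fun_prop)
      have hm : Measurable fun p : (S × (Fin n → S)) × S =>
          ENNReal.ofReal ((f' p.1 - f' (p.2, p.1.2)) ^ 2) := by fun_prop
      rw [resampleSq, ← h]
      simp only [Prod.map, id, Fin.update_cons_zero]
      change _ = ∫⁻ p : (S × (Fin n → S)) × S, ENNReal.ofReal ((f' p.1 - f' (p.2, p.1.2)) ^ 2) ∂_
      rw [lintegral_prod _ hm.aemeasurable, lintegral_prod_symm _ (by fun_prop)]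
      rfl
    have e3 : ∫⁻ a, meanSqDiff (Measure.pi fun _ : Fin n => μ) (fun b => f' (a, b)) ∂μ
        ≤ ∑ i : Fin n, resampleSq μ f i.succ := by
      have hmi : ∀ i : Fin n, Measurable fun p : (S × (Fin n → S)) × S =>
          ENNReal.ofReal ((f' p.1 - f' (p.1.1, Function.update p.1.2 i p.2)) ^ 2) := by
        intro i
        have h1 : Measurable fun p : (S × (Fin n → S)) × S => Function.update p.1.2 i p.2 :=
          (hu i).comp (f := fun p : (S × (Fin n → S)) × S => (p.1.2, p.2)) (by fun_prop)
        fun_prop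
      calc _ ≤ ∫⁻ a, ∑ i : Fin n, resampleSq μ (fun b => f' (a, b)) i ∂μ :=
            lintegral_mono fun a => ih (by fun_prop)
        _ = ∑ i : Fin n, ∫⁻ a, resampleSq μ (fun b => f' (a, b)) i ∂μ := by
            refine lintegral_finsetSum _ fun i _ => ?_
            have := (hmi i).comp (f := fun q : S × ((Fin n → S) × S) => ((q.1, q.2.1), q.2.2))
              (by fun_prop)
            exact this.lintegral_prod_right'
        _ = _ := by
            refine Finset.sum_congr rfl fun i _ => ?_
            have h := (mp'.prod (MeasurePreserving.id μ)).lintegral_comp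
              (f := fun p : (Fin (n + 1) → S) × S =>
                ENNReal.ofReal ((f p.1 - f (Function.update p.1 i.succ p.2)) ^ 2))
              (by have := hf.comp (hu i.succ); fun_prop)
            rw [resampleSq, ← h]
            simp only [Prod.map, id, ← Fin.cons_update]
            change _ = ∫⁻ p : (S × (Fin n → S)) × S,
              ENNReal.ofReal ((f' p.1 - f' (p.1.1, Function.update p.1.2 i p.2)) ^ 2) ∂_
            rw [lintegral_prod _ (hmi i).aemeasurable, lintegral_prod _
              (hmi i).lintegral_prod_right'.aemeasurable]
            refine lintegral_congr fun a => ?_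
            exact lintegral_prod (fun q : (Fin n → S) × S => ENNReal.ofReal
              ((f' (a, q.1) - f' (a, Function.update q.1 i q.2)) ^ 2))
              ((hmi i).comp (f := fun q : (Fin n → S) × S => ((a, q.1), q.2))
                (by fun_prop)).aemeasurable
    rw [e1, Fin.sum_univ_succ, add_comm]
    exact (meanSqDiff_prod_le μ _ hf'm).trans (add_le_add e3 e2.le)

/-- Variance plus squared bias, with the variance of one summand bounded by its second moment.
Applied to binomial edge counts and to degrees. -/
theorem integral_sum_sub_sq_le {ι S : Type*} [Fintype ι] [MeasurableSpace S] (μ : Measure S)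
    [IsProbabilityMeasure μ] {f : S → ℝ} (hf : MemLp f 2 μ) (a : ℝ) :
    ∫ x : ι → S, (∑ i, f (x i) - a) ^ 2 ∂(Measure.pi fun _ => μ)
      ≤ Fintype.card ι * ∫ y, f y ^ 2 ∂μ + (Fintype.card ι * ∫ y, f y ∂μ - a) ^ 2 := by
  set P : Measure (ι → S) := Measure.pi fun _ => μ
  have hi : ∀ i : ι, MemLp (fun x : ι → S => f (x i)) 2 P := fun i =>
    hf.comp_measurePreserving (measurePreserving_eval (fun _ : ι => μ) i)
  have hY : MemLp (fun x : ι → S => ∑ i, f (x i)) 2 P := memLp_finsetSum _ fun i _ => hi i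
  have hE : ∫ x, ∑ i, f (x i) ∂P = Fintype.card ι * ∫ y, f y ∂μ := by
    rw [integral_finsetSum _ fun i _ => (hi i).integrable one_le_two]
    have : ∀ i, ∫ x : ι → S, f (x i) ∂P = ∫ y, f y ∂μ := by
      intro i
      have mp := measurePreserving_eval (fun _ : ι => μ) i
      conv_rhs => rw [← mp.map_eq]
      rw [integral_map mp.aemeasurable (by rw [mp.map_eq]; exact hf.1)]
    simp [this]
  have hV : Var[fun x => ∑ i, f (x i); P] = Fintype.card ι * Var[f; μ] := by
    have := variance_sum_pi (μ := fun _ : ι => μ) (X := fun _ => f) fun _ => hf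
    simpa [Finset.sum_fn] using this
  have h1 := variance_eq_sub (hY.sub (memLp_const a))
  have h2 : Var[(fun x => ∑ i, f (x i)) - fun _ => a; P] = Var[fun x => ∑ i, f (x i); P] :=
    variance_sub_const hY.1 a
  rw [h2, hV] at h1
  have h3 : ∫ x : ι → S, ((fun x : ι → S => ∑ i, f (x i)) - fun _ => a : (ι → S) → ℝ) x ∂P
      = Fintype.card ι * ∫ y, f y ∂μ - a := by
    simp only [Pi.sub_apply]
    rw [integral_sub (hY.integrable one_le_two) (integrable_const a), hE]
    simp
  rw [h3] at h1
  have h4 : Var[f; μ] ≤ ∫ y, f y ^ 2 ∂μ := by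
    simpa using variance_le_expectation_sq hf.1
  have h5 : (Fintype.card ι : ℝ) * Var[f; μ] ≤ Fintype.card ι * ∫ y, f y ^ 2 ∂μ := by gcongr
  have h6 : ∫ x : ι → S, (∑ i, f (x i) - a) ^ 2 ∂P
    = ∫ x, (((fun x : ι → S => ∑ i, f (x i)) - fun _ => a : (ι → S) → ℝ) ^ 2) x ∂P := rfl
  rw [h6]
  linarith

/-! ### Marked edges -/

/-- The possibly absent edges form a finite type; with the discrete σ-algebra every function of them
is measurable. -/
instance optionMeasurableSpace {α : Type*} : MeasurableSpace (Option α) := ⊤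

instance {α : Type*} : DiscreteMeasurableSpace (Option α) := ⟨fun _ => trivial⟩

/-- A possibly absent edge together with the randomness of its potential. -/
abbrev Mark (K n : ℕ) (SJ : Type*) : Type _ := Option (Fin K → Fin n) × SJ

section

variable {K : ℕ} {Sh SJ : Type*}

/-- The factor contributed by a marked edge; absent edges contribute `1`. -/
def markFactor {n : ℕ} (J : SJ → (Fin K → ℝ) → ℝ≥0) (m : Mark K n SJ) (x : Fin n → ℝ) : ℝ≥0 :=
  m.1.elim 1 fun a => J m.2 fun k => x (a k)

/-- The nodes of a possibly absent edge. -/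
def edgeNodes {n : ℕ} (o : Option (Fin K → Fin n)) : Finset (Fin n) :=
  o.elim ∅ fun a => Finset.univ.image a

/-- The free energy of a realization. -/
def freeEnergy {n : ℕ} {I : Type*} [Fintype I] (h : Sh → ℝ → ℝ≥0) (J : SJ → (Fin K → ℝ) → ℝ≥0)
    (p : (Fin n → Sh) × (I → Mark K n SJ)) : ℝ :=
  logPartition (fun v => h (p.1 v)) (fun i => markFactor J (p.2 i))

variable [MeasurableSpace Sh] [MeasurableSpace SJ]

/-- The soft state assumptions with normalized constants, for almost every realization. -/
structure SoftModel (νh : Measure Sh) (νJ : Measure SJ) (h : Sh → ℝ → ℝ≥0)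
    (J : SJ → (Fin K → ℝ) → ℝ≥0) (κ : ℝ) (r R : ℝ≥0) (Ω : Set ℝ) : Prop where
  node_meas : IsRandomNodePotential νh h
  edge_meas : IsRandomEdgePotential νJ J
  r_pos : 0 < r
  r_le : r ≤ 1
  le_R : 1 ≤ R
  core : Set.Ico 0 κ ⊆ Ω
  node : ∀ᵐ s ∂νh, SoftNode κ r R Ω (h s)
  edge : ∀ n : ℕ, ∀ᵐ t ∂νJ, ∀ o : Option (Fin K → Fin n),
    SoftFactor κ r R Ω (edgeNodes o) (markFactor J (o, t))

/-- The law of independent node potentials and independent marked edges, where the edge `i` has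
law `μ i`. -/
def law {n : ℕ} {I : Type*} [Fintype I] (νh : Measure Sh) (νJ : Measure SJ)
    (μ : I → Measure (Option (Fin K → Fin n))) : Measure ((Fin n → Sh) × (I → Mark K n SJ)) :=
  (Measure.pi fun _ => νh).prod (Measure.pi fun i => (μ i).prod νJ)

/-- Realizations all of whose potentials are admissible. -/
def IsSoft {n : ℕ} {I : Type*} (h : Sh → ℝ → ℝ≥0) (J : SJ → (Fin K → ℝ) → ℝ≥0)
    (κ : ℝ) (r R : ℝ≥0) (Ω : Set ℝ) (p : (Fin n → Sh) × (I → Mark K n SJ)) : Prop :=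
  (∀ v, SoftNode κ r R Ω (h (p.1 v))) ∧
    ∀ i, SoftFactor κ r R Ω (edgeNodes (p.2 i).1) (markFactor J (p.2 i))

variable {νh : Measure Sh} [IsProbabilityMeasure νh] {νJ : Measure SJ} [IsProbabilityMeasure νJ]
  {h : Sh → ℝ → ℝ≥0} {J : SJ → (Fin K → ℝ) → ℝ≥0} {κ : ℝ} {r R : ℝ≥0} {Ω : Set ℝ}
  {n : ℕ} {I : Type*} [Fintype I] (μ : I → Measure (Option (Fin K → Fin n)))
  [∀ i, IsProbabilityMeasure (μ i)]

instance : IsProbabilityMeasure (law νh νJ μ) := by unfold law; infer_instance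

theorem SoftModel.ae_node (S : SoftModel νh νJ h J κ r R Ω) (n : ℕ) :
    ∀ᵐ s ∂(Measure.pi fun _ : Fin n => νh), ∀ v, SoftNode κ r R Ω (h (s v)) :=
  ae_all_iff.2 fun v => (Measure.quasiMeasurePreserving_eval (fun _ : Fin n => νh) v).ae S.node

theorem SoftModel.ae_mark (S : SoftModel νh νJ h J κ r R Ω)
    (μ : Measure (Option (Fin K → Fin n))) [IsProbabilityMeasure μ] :
    ∀ᵐ m ∂(μ.prod νJ), SoftFactor κ r R Ω (edgeNodes m.1) (markFactor J m) := by
  filter_upwards [Measure.quasiMeasurePreserving_snd.ae (S.edge n)] with m hm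
  exact hm m.1

theorem SoftModel.ae_marks (S : SoftModel νh νJ h J κ r R Ω) :
    ∀ᵐ e ∂(Measure.pi fun i => (μ i).prod νJ),
      ∀ i, SoftFactor κ r R Ω (edgeNodes (e i).1) (markFactor J (e i)) :=
  ae_all_iff.2 fun i =>
    (Measure.quasiMeasurePreserving_eval (fun i => (μ i).prod νJ) i).ae (S.ae_mark (μ i))

theorem SoftModel.ae_isSoft (S : SoftModel νh νJ h J κ r R Ω) :
    ∀ᵐ p ∂(law νh νJ μ), IsSoft h J κ r R Ω p := by
  filter_upwards [Measure.quasiMeasurePreserving_fst.ae (S.ae_node n),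
    Measure.quasiMeasurePreserving_snd.ae (S.ae_marks μ)] with p h1 h2
  exact ⟨h1, h2⟩

theorem SoftModel.aemeasurable_markFactor (S : SoftModel νh νJ h J κ r R Ω)
    (μ : Measure (Option (Fin K → Fin n))) [IsProbabilityMeasure μ] :
    AEMeasurable (fun p : Mark K n SJ × (Fin n → ℝ) => markFactor J p.1 p.2)
      ((μ.prod νJ).prod volume) := by
  refine aemeasurable_of_discrete μ νJ volume fun o => ?_
  cases o with
  | none => exact aemeasurable_const
  | some a => exact S.edge_meas.joint n a

theorem SoftModel.aemeasurable_freeEnergy (S : SoftModel νh νJ h J κ r R Ω) :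
    AEMeasurable (freeEnergy h J) (law νh νJ μ) := by
  have hw : AEMeasurable (fun q : ((Fin n → Sh) × (I → Mark K n SJ)) × (Fin n → ℝ) =>
      factorWeight (fun v => h (q.1.1 v)) (fun i => markFactor J (q.1.2 i)) q.2)
      ((law νh νJ μ).prod volume) := by
    refine (Finset.aemeasurable_fun_prod _ fun v _ => ?_).mul
      (Finset.aemeasurable_fun_prod _ fun i _ => ?_)
    · have hq := MeasureTheory.QuasiMeasurePreserving.prodMap
        ((Measure.quasiMeasurePreserving_eval (fun _ : Fin n => νh) v).comp
          (Measure.quasiMeasurePreserving_fst (ν := Measure.pi fun i => (μ i).prod νJ)))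
        (Measure.quasiMeasurePreserving_eval (fun _ : Fin n => (volume : Measure ℝ)) v)
      exact AEMeasurable.comp_quasiMeasurePreserving S.node_meas hq
    · have hq := MeasureTheory.QuasiMeasurePreserving.prodMap
        ((Measure.quasiMeasurePreserving_eval (fun i => (μ i).prod νJ) i).comp
          (Measure.quasiMeasurePreserving_snd (μ := Measure.pi fun _ : Fin n => νh)))
        (Measure.QuasiMeasurePreserving.id (volume : Measure (Fin n → ℝ)))
      exact (S.aemeasurable_markFactor (μ i)).comp_quasiMeasurePreserving hq
  exact Real.measurable_log.comp_aemeasurable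
    hw.coe_nnreal_ennreal.lintegral_prod_right'.ennreal_toReal

theorem IsSoft.abs_freeEnergy_le (S : SoftModel νh νJ h J κ r R Ω)
    {p : (Fin n → Sh) × (I → Mark K n SJ)} (hp : IsSoft h J κ r R Ω p) :
    |freeEnergy h J p| ≤ logRatio r R * (n + Fintype.card I) :=
  abs_logPartition_le S.r_pos S.r_le S.le_R hp.1 hp.2

theorem SoftModel.integrable_freeEnergy (S : SoftModel νh νJ h J κ r R Ω) :
    Integrable (freeEnergy h J) (law νh νJ μ) :=
  Integrable.of_bound (S.aemeasurable_freeEnergy μ).aestronglyMeasurable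
    (logRatio r R * (n + Fintype.card I))
    ((S.ae_isSoft μ).mono fun _ hp => hp.abs_freeEnergy_le S)

/-- The expected free energy. -/
def meanEnergy (νh : Measure Sh) (νJ : Measure SJ) (h : Sh → ℝ → ℝ≥0)
    (J : SJ → (Fin K → ℝ) → ℝ≥0) (μ : I → Measure (Option (Fin K → Fin n))) : ℝ :=
  ∫ p, freeEnergy h J p ∂(law νh νJ μ)

end

/-! ### Concavity of the expected free energy change in the law of an added edge -/

/-- All `r` replicas see the same edge, so only vectors supported on constant multi-indices matter.
For `r = 0` all constants coincide and their entries must add up, hence the sum over `j`. -/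
theorem arrayForm_diagonal {K n r : ℕ} (A : (Fin K → (Fin r → Fin n)) → ℝ) (c : Fin n → ℝ) :
    arrayForm A (fun p => ∑ j, if p = fun _ => j then c j else 0)
      = ∑ a : Fin K → Fin n, (∏ k, c (a k)) * A fun k _ => a k := by
  classical
  simp only [arrayForm, Finset.prod_univ_sum, Finset.sum_mul, Fintype.piFinset_univ]
  rw [Finset.sum_comm]
  refine Finset.sum_congr rfl fun a _ => ?_
  rw [Finset.sum_eq_single_of_mem (fun k _ => a k) (Finset.mem_univ _)]
  · simp
  · intro i _ hi
    obtain ⟨k, hk⟩ : ∃ k, i k ≠ fun _ => a k := by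
      by_contra! h
      exact hi (funext h)
    rw [Finset.prod_eq_zero (Finset.mem_univ k) (by simp [hk]), zero_mul]

theorem ConvexOn.of_tendsto {E : Type*} [AddCommMonoid E] [Module ℝ E] {s : Set E}
    {F : ℕ → E → ℝ} {f : E → ℝ} (hF : ∀ m, ConvexOn ℝ s (F m))
    (h : ∀ x, Tendsto (fun m => F m x) atTop (𝓝 (f x))) : ConvexOn ℝ s f := by
  refine ⟨(hF 0).1, fun x hx y hy a b ha hb hab => ?_⟩
  exact le_of_tendsto_of_tendsto' (h _) (((h x).const_smul a).add ((h y).const_smul b))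
    fun m => (hF m).2 hx hy ha hb hab

/-- A finite nonzero weight supported on admissible configurations. -/
structure BaseWeight (Ω : Set ℝ) {n : ℕ} (W : (Fin n → ℝ) → ℝ≥0) : Prop where
  aem : AEMeasurable W
  supp : ∀ x, W x ≠ 0 → ∀ v, x v ∈ Ω
  ne_zero : ∫⁻ x, (W x : ℝ≥0∞) ≠ 0
  ne_top : ∫⁻ x, (W x : ℝ≥0∞) ≠ ∞

/-- The Gibbs measure of a weight. -/
def gibbs {n : ℕ} (W : (Fin n → ℝ) → ℝ≥0) : Measure (Fin n → ℝ) :=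
  (∫⁻ x, (W x : ℝ≥0∞))⁻¹ • volume.withDensity fun x => (W x : ℝ≥0∞)

section Gibbs

variable {Ω : Set ℝ} {n : ℕ} {W : (Fin n → ℝ) → ℝ≥0}

theorem BaseWeight.isProbabilityMeasure (hW : BaseWeight Ω W) :
    IsProbabilityMeasure (gibbs W) := by
  refine ⟨?_⟩
  rw [gibbs, Measure.smul_apply, withDensity_apply _ MeasurableSet.univ, Measure.restrict_univ,
    smul_eq_mul, ENNReal.inv_mul_cancel hW.ne_zero hW.ne_top]

theorem gibbs_ac : gibbs W ≪ volume :=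
  (Measure.smul_absolutelyContinuous).trans (withDensity_absolutelyContinuous _ _)

theorem BaseWeight.ae_mem (hW : BaseWeight Ω W) : ∀ᵐ x ∂(gibbs W), ∀ v, x v ∈ Ω := by
  have h : ∀ᵐ x ∂(volume.withDensity fun x => (W x : ℝ≥0∞)), ∀ v, x v ∈ Ω := by
    rw [ae_withDensity_iff' hW.aem.coe_nnreal_ennreal]
    exact Eventually.of_forall fun x hx => hW.supp x (by simpa using hx)
  exact Measure.smul_absolutelyContinuous.ae_le h

theorem BaseWeight.lintegral_mul (hW : BaseWeight Ω W) {f : (Fin n → ℝ) → ℝ≥0}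
    (hf : AEMeasurable f) :
    ∫⁻ x, ((W x * f x : ℝ≥0) : ℝ≥0∞)
      = (∫⁻ x, (W x : ℝ≥0∞)) * ∫⁻ x, (f x : ℝ≥0∞) ∂(gibbs W) := by
  rw [gibbs, lintegral_smul_measure, lintegral_withDensity_eq_lintegral_mul₀
    hW.aem.coe_nnreal_ennreal hf.coe_nnreal_ennreal, smul_eq_mul, ← mul_assoc,
    ENNReal.mul_inv_cancel hW.ne_zero hW.ne_top, one_mul]
  simp

end Gibbs

section Concave

variable {K : ℕ} {SJ : Type*} [MeasurableSpace SJ] {νJ : Measure SJ} [IsProbabilityMeasure νJ]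
  {J : SJ → (Fin K → ℝ) → ℝ≥0} {Ω : Set ℝ} {α : ℝ} {n : ℕ} {W : (Fin n → ℝ) → ℝ≥0}

/-- The Gibbs average of `α - J` along the edge `a`. -/
def deficit (J : SJ → (Fin K → ℝ) → ℝ≥0) (α : ℝ) (W : (Fin n → ℝ) → ℝ≥0)
    (a : Fin K → Fin n) (t : SJ) : ℝ :=
  ∫ x, (α - (J t fun k => x (a k) : ℝ)) ∂(gibbs W)

theorem aemeasurable_gibbs (hJ : IsRandomEdgePotential νJ J) (hW : BaseWeight Ω W)
    (a : Fin K → Fin n) :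
    AEMeasurable (fun p : SJ × (Fin n → ℝ) => J p.1 fun k => p.2 (a k)) (νJ.prod (gibbs W)) := by
  have := hW.isProbabilityMeasure
  exact (hJ.joint n a).mono_ac (Measure.AbsolutelyContinuous.rfl.prod gibbs_ac)

theorem aestronglyMeasurable_deficit (hJ : IsRandomEdgePotential νJ J) (hW : BaseWeight Ω W)
    (a : Fin K → Fin n) : AEStronglyMeasurable (deficit J α W a) νJ := by
  have := hW.isProbabilityMeasure
  have h : AEStronglyMeasurable (fun p : SJ × (Fin n → ℝ) => α - (J p.1 fun k => p.2 (a k) : ℝ))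
      (νJ.prod (gibbs W)) :=
    (aemeasurable_const.sub (aemeasurable_gibbs hJ hW a).coe_nnreal_real).aestronglyMeasurable
  exact h.integral_prod_right'

theorem abs_prod_deficit_le {t : SJ} (ht : ∀ x, (J t x : ℝ) ≤ α) {r : ℕ}
    (X : Fin r → Fin K → ℝ) : ‖∏ l, (α - (J t (X l) : ℝ))‖ ≤ α ^ r := by
  rw [Real.norm_of_nonneg (Finset.prod_nonneg fun l _ => sub_nonneg.2 (ht _))]
  exact (Finset.prod_le_prod (fun l _ => sub_nonneg.2 (ht _)) fun l _ =>
    sub_le_self _ (J t (X l)).2).trans (by simp)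

theorem integrable_prod_deficit (hJ : IsRandomEdgePotential νJ J) (hW : BaseWeight Ω W)
    (hα : ∀ᵐ t ∂νJ, ∀ x, (J t x : ℝ) ≤ α) (a : Fin K → Fin n) (r : ℕ) :
    Integrable (fun p : SJ × (Fin r → Fin n → ℝ) => ∏ l, (α - (J p.1 fun k => p.2 l (a k) : ℝ)))
      (νJ.prod (Measure.pi fun _ => gibbs W)) := by
  have := hW.isProbabilityMeasure
  refine Integrable.of_bound (C := α ^ r) ?_ ?_
  · refine (Finset.aemeasurable_fun_prod _ fun l _ =>
      aemeasurable_const.sub ?_).aestronglyMeasurable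
    have hq := MeasureTheory.QuasiMeasurePreserving.prodMap (Measure.QuasiMeasurePreserving.id νJ)
      (Measure.quasiMeasurePreserving_eval (fun _ : Fin r => gibbs W) l)
    exact ((aemeasurable_gibbs hJ hW a).comp_quasiMeasurePreserving hq).coe_nnreal_real
  · filter_upwards [Measure.quasiMeasurePreserving_fst.ae hα] with p hp
    exact abs_prod_deficit_le hp _

/-- Replicas: a power of a Gibbs average is an average over independent Gibbs samples. Fubini then
moves the expectation over `J` inside, where the entries of `expectedTensor` appear. -/
theorem integral_deficit_pow (hJ : IsRandomEdgePotential νJ J) (hW : BaseWeight Ω W)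
    (hα : ∀ᵐ t ∂νJ, ∀ x, (J t x : ℝ) ≤ α) (a : Fin K → Fin n) (r : ℕ) :
    ∫ t, deficit J α W a t ^ r ∂νJ
      = ∫ X : Fin r → Fin n → ℝ, (∫ t, ∏ l, (α - (J t fun k => X l (a k) : ℝ)) ∂νJ)
          ∂(Measure.pi fun _ => gibbs W) := by
  have := hW.isProbabilityMeasure
  rw [← integral_integral_swap (f := fun (t : SJ) (X : Fin r → Fin n → ℝ) =>
    ∏ l, (α - (J t fun k => X l (a k) : ℝ))) (integrable_prod_deficit hJ hW hα a r)]
  refine integral_congr_ae (Eventually.of_forall fun t => ?_)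
  have := integral_fintype_prod_eq_prod (μ := fun _ : Fin r => gibbs W)
    (fun (_ : Fin r) (x : Fin n → ℝ) => α - (J t fun k => x (a k) : ℝ))
  simp only [deficit]
  rw [this]
  simp

/-- Here `c` plays the law of each endpoint of the edge. For almost every choice of replicas all
spins lie in `Ω`, the tensor hypothesis applies, and averaging over replicas preserves convexity. -/
theorem convexOn_integral_deficit_pow (hJ : IsRandomEdgePotential νJ J) (hW : BaseWeight Ω W)
    (hα : ∀ᵐ t ∂νJ, ∀ x, (J t x : ℝ) ≤ α) (hT : TensorConvex νJ J Ω α) (r : ℕ) :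
    ConvexOn ℝ {c : Fin n → ℝ | ∀ j, 0 ≤ c j}
      fun c => ∑ a : Fin K → Fin n, (∏ k, c (a k)) * ∫ t, deficit J α W a t ^ r ∂νJ := by
  have := hW.isProbabilityMeasure
  set q : (Fin r → Fin n → ℝ) → (Fin n → ℝ) → ℝ := fun X c =>
    ∑ a : Fin K → Fin n, (∏ k, c (a k)) * ∫ t, ∏ l, (α - (J t fun k => X l (a k) : ℝ)) ∂νJ with hq
  have hint : ∀ a : Fin K → Fin n, Integrable (fun X : Fin r → Fin n → ℝ =>
      ∫ t, ∏ l, (α - (J t fun k => X l (a k) : ℝ)) ∂νJ) (Measure.pi fun _ => gibbs W) :=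
    fun a => (integrable_prod_deficit hJ hW hα a r).integral_prod_right
  have hqi : ∀ c, Integrable (fun X => q X c) (Measure.pi fun _ => gibbs W) := fun c =>
    integrable_finsetSum _ fun a _ => (hint a).const_mul _
  have hQ : ∀ c : Fin n → ℝ,
      ∑ a : Fin K → Fin n, (∏ k, c (a k)) * ∫ t, deficit J α W a t ^ r ∂νJ
        = ∫ X, q X c ∂(Measure.pi fun _ => gibbs W) := by
    intro c
    rw [integral_finsetSum _ fun a _ => (hint a).const_mul _]
    refine Finset.sum_congr rfl fun a _ => ?_
    rw [integral_const_mul, integral_deficit_pow hJ hW hα]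
  simp only [hQ]
  have hconv : ∀ᵐ X ∂(Measure.pi fun _ : Fin r => gibbs W),
      ConvexOn ℝ {c : Fin n → ℝ | ∀ j, 0 ≤ c j} (q X) := by
    have hX : ∀ᵐ X ∂(Measure.pi fun _ : Fin r => gibbs W), ∀ l v, X l v ∈ Ω :=
      ae_all_iff.2 fun l =>
        (Measure.quasiMeasurePreserving_eval (fun _ : Fin r => gibbs W) l).ae hW.ae_mem
    filter_upwards [hX] with X hX
    -- The diagonal embedding is linear and preserves nonnegativity, so convexity pulls back along
    -- it.
    let emb : (Fin n → ℝ) →ₗ[ℝ] ((Fin r → Fin n) → ℝ) :=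
      { toFun := fun c p => ∑ j, if p = fun _ => j then c j else 0
        map_add' := by
          intro x y; funext p
          simp only [Pi.add_apply, ← Finset.sum_add_distrib]
          exact Finset.sum_congr rfl fun j _ => by split_ifs <;> simp
        map_smul' := by
          intro m x; funext p
          simp only [Pi.smul_apply, smul_eq_mul, Finset.mul_sum, RingHom.id_apply]
          exact Finset.sum_congr rfl fun j _ => by split_ifs <;> simp }
    have h1 := (hT r n X hX).comp_linearMap emb
    have h2 : ∀ c, arrayForm (expectedTensor νJ J α X) (emb c) = q X c := fun c =>
      arrayForm_diagonal _ c
    refine ConvexOn.congr (h1.subset ?_ ?_) fun c _ => h2 c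
    · intro c hc p
      change 0 ≤ ∑ j, if p = fun _ => j then c j else 0
      exact Finset.sum_nonneg fun j _ => by split_ifs; exacts [hc j, le_rfl]
    · intro x hx y hy a b ha hb _ j
      exact add_nonneg (mul_nonneg ha (hx j)) (mul_nonneg hb (hy j))
  refine ⟨?_, fun x hx y hy a b ha hb hab => ?_⟩
  · intro x hx y hy a b ha hb _ j
    exact add_nonneg (mul_nonneg ha (hx j)) (mul_nonneg hb (hy j))
  · rw [smul_eq_mul, smul_eq_mul, ← integral_const_mul, ← integral_const_mul,
      ← integral_add ((hqi x).const_mul a) ((hqi y).const_mul b)]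
    refine integral_mono_ae (hqi _) (((hqi x).const_mul a).add ((hqi y).const_mul b)) ?_
    filter_upwards [hconv] with X hX
    exact hX.2 hx hy ha hb hab

theorem deficit_nonneg {t : SJ} (ht : ∀ x, (J t x : ℝ) ≤ α) (a : Fin K → Fin n) :
    0 ≤ deficit J α W a t :=
  integral_nonneg fun _ => sub_nonneg.2 (ht _)

theorem toReal_lintegral_mul_eq_deficit (hJ : IsRandomEdgePotential νJ J) (hW : BaseWeight Ω W)
    (hα : ∀ᵐ t ∂νJ, ∀ x, (J t x : ℝ) ≤ α) (a : Fin K → Fin n) :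
    ∀ᵐ t ∂νJ, (∫⁻ x, ((W x * J t (fun k => x (a k)) : ℝ≥0) : ℝ≥0∞)).toReal
      = (∫⁻ x, (W x : ℝ≥0∞)).toReal * (α - deficit J α W a t) := by
  have := hW.isProbabilityMeasure
  filter_upwards [hα, (hJ.joint n a).aestronglyMeasurable.prodMk_left] with t ht hm
  have hm := hm.aemeasurable
  rw [hW.lintegral_mul hm, ENNReal.toReal_mul]
  congr 1
  have hm' : AEMeasurable (fun x : Fin n → ℝ => (J t fun k => x (a k) : ℝ)) (gibbs W) :=
    (hm.mono_ac gibbs_ac).coe_nnreal_real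
  have hi : Integrable (fun x : Fin n → ℝ => (J t fun k => x (a k) : ℝ)) (gibbs W) :=
    Integrable.of_bound hm'.aestronglyMeasurable α (Eventually.of_forall fun x => by
      rw [Real.norm_of_nonneg (NNReal.coe_nonneg _)]; exact ht _)
  have h1 : ∫ x, (J t fun k => x (a k) : ℝ) ∂(gibbs W)
      = (∫⁻ x, (J t fun k => x (a k) : ℝ≥0∞) ∂(gibbs W)).toReal := by
    rw [integral_eq_lintegral_of_nonneg_ae (Eventually.of_forall fun x => NNReal.coe_nonneg _)
      hm'.aestronglyMeasurable]
    simp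
  rw [deficit, integral_sub (integrable_const _) hi, h1]
  simp

/-- The power series of `-log (1 - x)` has nonnegative coefficients, so its integrated partial sums
are convex in `c`. The uniform bound `b < 1` supplies the dominating constant `-log (1 - b)` for the
limit. -/
theorem convexOn_integral_neg_log (hJ : IsRandomEdgePotential νJ J) (hW : BaseWeight Ω W)
    (hα0 : 0 < α) (hα : ∀ᵐ t ∂νJ, ∀ x, (J t x : ℝ) ≤ α) (hT : TensorConvex νJ J Ω α)
    {b : ℝ} (hb1 : b < 1) (hb : ∀ a, ∀ᵐ t ∂νJ, deficit J α W a t / α ≤ b) :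
    ConvexOn ℝ {c : Fin n → ℝ | ∀ j, 0 ≤ c j}
      fun c => ∑ a : Fin K → Fin n, (∏ k, c (a k)) *
        ∫ t, -Real.log (1 - deficit J α W a t / α) ∂νJ := by
  set S : (Fin n → ℝ) → Prop := fun c => ∀ j, 0 ≤ c j
  have hpart : ∀ (m : ℕ) (a : Fin K → Fin n),
      ∫ t, ∑ i ∈ Finset.range m, (deficit J α W a t / α) ^ (i + 1) / (i + 1 : ℝ) ∂νJ
      = ∑ i ∈ Finset.range m, (α ^ (i + 1))⁻¹ * (i + 1 : ℝ)⁻¹ *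
          ∫ t, deficit J α W a t ^ (i + 1) ∂νJ := by
    intro m a
    rw [integral_finsetSum]
    · refine Finset.sum_congr rfl fun i _ => ?_
      rw [← integral_const_mul]
      refine integral_congr_ae (Eventually.of_forall fun t => ?_)
      simp only [div_eq_mul_inv]
      ring
    · intro i _
      refine Integrable.of_bound (C := b ^ (i + 1) / (i + 1))
        ((((aestronglyMeasurable_deficit hJ hW a).aemeasurable.div_const α).pow_const
          (i + 1)).div_const _).aestronglyMeasurable ?_
      filter_upwards [hα, hb a] with t ht htb
      have h0 := div_nonneg (deficit_nonneg (W := W) ht a) hα0.le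
      rw [Real.norm_of_nonneg (by positivity)]
      gcongr
  refine ConvexOn.of_tendsto (F := fun m c => ∑ i ∈ Finset.range m,
    ((α ^ (i + 1))⁻¹ * (i + 1 : ℝ)⁻¹) • ∑ a : Fin K → Fin n, (∏ k, c (a k)) *
      ∫ t, deficit J α W a t ^ (i + 1) ∂νJ) ?_ ?_
  · intro m
    induction m with
    | zero =>
      simpa using convexOn_const (0 : ℝ) (convexOn_integral_deficit_pow hJ hW hα hT 0).1
    | succ m ih =>
      simp only [Finset.sum_range_succ]
      exact ih.add ((convexOn_integral_deficit_pow hJ hW hα hT (m + 1)).smul (by positivity))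
  · intro c
    have hlim : ∀ a : Fin K → Fin n, Tendsto (fun m => ∫ t, ∑ i ∈ Finset.range m,
        (deficit J α W a t / α) ^ (i + 1) / (i + 1 : ℝ) ∂νJ) atTop
        (𝓝 (∫ t, -Real.log (1 - deficit J α W a t / α) ∂νJ)) := by
      intro a
      refine tendsto_integral_of_dominated_convergence (fun _ => -Real.log (1 - b)) ?_
        (integrable_const _) ?_ ?_
      · intro m
        exact (Finset.aemeasurable_fun_sum _ fun i _ =>
          (((aestronglyMeasurable_deficit hJ hW a).aemeasurable.div_const α).pow_const
            (i + 1)).div_const _).aestronglyMeasurable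
      · intro m
        filter_upwards [hα, hb a] with t ht htb
        have h0 := div_nonneg (deficit_nonneg (W := W) ht a) hα0.le
        rw [Real.norm_of_nonneg (Finset.sum_nonneg fun i _ => by positivity)]
        have hs := Real.hasSum_pow_div_log_of_abs_lt_one (x := deficit J α W a t / α)
          (by rw [abs_of_nonneg h0]; linarith)
        refine (sum_le_hasSum _ (fun i _ => by positivity) hs).trans ?_
        exact neg_le_neg (Real.log_le_log (by linarith) (by linarith))
      · filter_upwards [hα, hb a] with t ht htb
        have h0 := div_nonneg (deficit_nonneg (W := W) ht a) hα0.le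
        exact (Real.hasSum_pow_div_log_of_abs_lt_one (x := deficit J α W a t / α)
          (by rw [abs_of_nonneg h0]; linarith)).tendsto_sum_nat
    have := tendsto_finsetSum (Finset.univ : Finset (Fin K → Fin n)) fun a _ =>
      (hlim a).const_mul (∏ k, c (a k))
    refine this.congr fun m => ?_
    simp only [hpart, smul_eq_mul, Finset.mul_sum]
    rw [Finset.sum_comm]
    exact Finset.sum_congr rfl fun i _ => Finset.sum_congr rfl fun a _ => by ring

/-- The average over all directed edges. -/
def edgeAverage (f : (Fin K → Fin n) → ℝ) : ℝ := (∑ a, f a) / (n : ℝ) ^ K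

/-- The heart of the interpolation: convexity is applied at the uniform laws `c₁`, `c₂` of the two
blocks, whose mixture with weights `n₁ / (n₁ + n₂)` and `n₂ / (n₁ + n₂)` is uniform on all nodes. -/
theorem edgeAverage_superadditive (hJ : IsRandomEdgePotential νJ J) {n₁ n₂ : ℕ}
    (hn₁ : 0 < n₁) (hn₂ : 0 < n₂)
    {W : (Fin (n₁ + n₂) → ℝ) → ℝ≥0} (hW : BaseWeight Ω W)
    (hα0 : 0 < α) (hα : ∀ᵐ t ∂νJ, ∀ x, (J t x : ℝ) ≤ α) (hT : TensorConvex νJ J Ω α)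
    {δ : ℝ} (hδ : 0 < δ)
    (hb : ∀ a : Fin K → Fin (n₁ + n₂), ∀ᵐ t ∂νJ,
      δ ≤ (∫⁻ x, ((W x * J t (fun k => x (a k)) : ℝ≥0) : ℝ≥0∞)).toReal)
    (ψ : (Fin K → Fin (n₁ + n₂)) → ℝ)
    (hψ : ∀ a, ψ a =
      ∫ t, Real.log (∫⁻ x, ((W x * J t (fun k => x (a k)) : ℝ≥0) : ℝ≥0∞)).toReal ∂νJ) :
    n₁ * edgeAverage (fun a : Fin K → Fin n₁ => ψ fun k => Fin.castAdd n₂ (a k))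
      + n₂ * edgeAverage (fun a : Fin K → Fin n₂ => ψ fun k => Fin.natAdd n₁ (a k))
      ≤ (n₁ + n₂) * edgeAverage ψ := by
  set w := (∫⁻ x, (W x : ℝ≥0∞)).toReal with hw
  have hw0 : 0 < w := ENNReal.toReal_pos hW.ne_zero hW.ne_top
  -- The lower bound `δ` on the partition function with the added edge keeps the argument of the
  -- logarithm away from zero.
  have hb1 : ∀ a, ∀ᵐ t ∂νJ, deficit J α W a t / α ≤ 1 - δ / (w * α) := by
    intro a
    filter_upwards [hb a, toReal_lintegral_mul_eq_deficit hJ hW hα a] with t h1 h2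
    rw [h2] at h1
    have : δ / (w * α) ≤ (α - deficit J α W a t) / α := by
      rw [div_le_div_iff₀ (by positivity) hα0]
      nlinarith
    rw [sub_div, div_self hα0.ne'] at this
    linarith
  have hb0 : 1 - δ / (w * α) < 1 := sub_lt_self _ (by positivity)
  set ℓ : (Fin K → Fin (n₁ + n₂)) → ℝ := fun a =>
    ∫ t, -Real.log (1 - deficit J α W a t / α) ∂νJ with hℓ
  -- The sign change turns convexity of `ℓ` into superadditivity of `ψ`; the constant `log (w * α)`
  -- cancels because the weights add up.
  have hψℓ : ∀ a, ψ a = Real.log (w * α) - ℓ a := by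
    intro a
    have hi : Integrable (fun t => -Real.log (1 - deficit J α W a t / α)) νJ := by
      refine Integrable.of_bound (C := -Real.log (δ / (w * α)))
        (Real.measurable_log.comp_aemeasurable (aemeasurable_const.sub
          ((aestronglyMeasurable_deficit hJ hW a).aemeasurable.div_const
            α))).neg.aestronglyMeasurable ?_
      filter_upwards [hα, hb1 a] with t ht htb
      have h0 := div_nonneg (deficit_nonneg (W := W) ht a) hα0.le
      have h3 : 0 < δ / (w * α) := by positivity
      rw [Real.norm_of_nonneg (neg_nonneg.2 (Real.log_nonpos (by linarith) (by linarith)))]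
      exact neg_le_neg (Real.log_le_log h3 (by linarith))
    have h1 : ∀ᵐ t ∂νJ,
        Real.log (∫⁻ x, ((W x * J t (fun k => x (a k)) : ℝ≥0) : ℝ≥0∞)).toReal
          = Real.log (w * α) - -Real.log (1 - deficit J α W a t / α) := by
      filter_upwards [hα, hb1 a, toReal_lintegral_mul_eq_deficit hJ hW hα a] with t ht htb h2
      have h3 : 0 < δ / (w * α) := by positivity
      rw [h2, ← hw, sub_neg_eq_add, ← Real.log_mul (by positivity) (by linarith)]
      congr 1
      field_simp
    rw [hψ, integral_congr_ae h1, integral_sub (integrable_const _) hi]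
    simp [hℓ]
  have hconv := convexOn_integral_neg_log hJ hW hα0 hα hT hb0 hb1
  have hN₁ : (0 : ℝ) < n₁ := by exact_mod_cast hn₁
  have hN₂ : (0 : ℝ) < n₂ := by exact_mod_cast hn₂
  set c₁ : Fin (n₁ + n₂) → ℝ := Fin.append (fun _ : Fin n₁ => (n₁ : ℝ)⁻¹) fun _ : Fin n₂ => 0
  set c₂ : Fin (n₁ + n₂) → ℝ := Fin.append (fun _ : Fin n₁ => 0) fun _ : Fin n₂ => (n₂ : ℝ)⁻¹
  have hc₁ : ∀ j, 0 ≤ c₁ j := by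
    intro j; refine Fin.addCases (fun i => ?_) (fun i => ?_) j <;> simp [c₁]
  have hc₂ : ∀ j, 0 ≤ c₂ j := by
    intro j; refine Fin.addCases (fun i => ?_) (fun i => ?_) j <;> simp [c₂]
  have hmain := hconv.2 hc₁ hc₂ (show (0 : ℝ) ≤ n₁ / (n₁ + n₂) by positivity)
    (show (0 : ℝ) ≤ n₂ / (n₁ + n₂) by positivity) (by field_simp)
  have hc : ∀ j, ((n₁ / (n₁ + n₂) : ℝ) • c₁ + (n₂ / (n₁ + n₂) : ℝ) • c₂) j
      = ((n₁ + n₂ : ℕ) : ℝ)⁻¹ := by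
    intro j
    refine Fin.addCases (fun i => ?_) (fun i => ?_) j <;> simp [c₁, c₂] <;> field_simp
  have hs₁ : ∑ a : Fin K → Fin (n₁ + n₂), (∏ k, c₁ (a k)) * ℓ a
      = edgeAverage fun a : Fin K → Fin n₁ => ℓ fun k => Fin.castAdd n₂ (a k) := by
    rw [edgeAverage, Finset.sum_div]
    refine (Fintype.sum_of_injective (fun a : Fin K → Fin n₁ => fun k => Fin.castAdd n₂ (a k))
      (fun a b hab => funext fun k => Fin.castAdd_injective _ _ (congrFun hab k)) _ _ ?_ ?_).symm
    -- A tuple that leaves the block has an endpoint of zero mass, so only tuples inside the block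
    -- contribute.
    · intro a ha
      obtain ⟨k, i, hk⟩ : ∃ k, ∃ i, a k = Fin.natAdd n₁ i := by
        by_contra! hcon
        have : ∀ k, ∃ i, Fin.castAdd n₂ i = a k := fun k => by
          obtain ⟨i, hi⟩ | ⟨i, hi⟩ : (∃ i, a k = Fin.castAdd n₂ i) ∨ ∃ i, a k = Fin.natAdd n₁ i :=
            Fin.addCases (fun i => Or.inl ⟨i, rfl⟩) (fun i => Or.inr ⟨i, rfl⟩) (a k)
          · exact ⟨i, hi.symm⟩
          · exact absurd hi (hcon k i)
        choose b hbb using this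
        exact ha ⟨b, funext hbb⟩
      rw [Finset.prod_eq_zero (Finset.mem_univ k) (by simp [hk, c₁]), zero_mul]
    · intro a
      simp [c₁, div_eq_inv_mul]
  have hs₂ : ∑ a : Fin K → Fin (n₁ + n₂), (∏ k, c₂ (a k)) * ℓ a
      = edgeAverage fun a : Fin K → Fin n₂ => ℓ fun k => Fin.natAdd n₁ (a k) := by
    rw [edgeAverage, Finset.sum_div]
    refine (Fintype.sum_of_injective (fun a : Fin K → Fin n₂ => fun k => Fin.natAdd n₁ (a k))
      (fun a b hab => funext fun k => Fin.natAdd_injective _ _ (congrFun hab k)) _ _ ?_ ?_).symm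
    · intro a ha
      obtain ⟨k, i, hk⟩ : ∃ k, ∃ i, a k = Fin.castAdd n₂ i := by
        by_contra! hcon
        have : ∀ k, ∃ i, Fin.natAdd n₁ i = a k := fun k => by
          obtain ⟨i, hi⟩ | ⟨i, hi⟩ : (∃ i, a k = Fin.castAdd n₂ i) ∨ ∃ i, a k = Fin.natAdd n₁ i :=
            Fin.addCases (fun i => Or.inl ⟨i, rfl⟩) (fun i => Or.inr ⟨i, rfl⟩) (a k)
          · exact absurd hi (hcon k i)
          · exact ⟨i, hi.symm⟩
        choose b hbb using this
        exact ha ⟨b, funext hbb⟩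
      rw [Finset.prod_eq_zero (Finset.mem_univ k) (by simp [hk, c₂]), zero_mul]
    · intro a
      simp [c₂, div_eq_inv_mul]
  have hs : ∑ a : Fin K → Fin (n₁ + n₂),
      (∏ k, ((n₁ / (n₁ + n₂) : ℝ) • c₁ + (n₂ / (n₁ + n₂) : ℝ) • c₂) (a k)) * ℓ a
        = edgeAverage ℓ := by
    rw [edgeAverage, Finset.sum_div]
    refine Finset.sum_congr rfl fun a _ => ?_
    rw [Finset.prod_congr rfl fun k _ => hc (a k)]
    simp [div_eq_inv_mul]
  have hsub : ∀ {m : ℕ}, 0 < m → ∀ f : (Fin K → Fin m) → Fin K → Fin (n₁ + n₂),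
      edgeAverage (fun a => ψ (f a)) = Real.log (w * α) - edgeAverage fun a => ℓ (f a) := by
    intro m hm f
    have : (0 : ℝ) < (m : ℝ) ^ K := by positivity
    simp only [edgeAverage, hψℓ, Finset.sum_sub_distrib, Finset.sum_const, Finset.card_univ,
      Fintype.card_fun, Fintype.card_fin, nsmul_eq_mul, Nat.cast_pow]
    field_simp
  have hsub' := hsub (Nat.add_pos_left hn₁ n₂) id
  simp only [id] at hsub'
  simp only [smul_eq_mul] at hmain
  rw [hs, hs₁, hs₂, div_mul_eq_mul_div, div_mul_eq_mul_div, ← add_div, le_div_iff₀ (by positivity)]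
    at hmain
  rw [hsub hn₁, hsub hn₂, hsub']
  nlinarith

end Concave

/-! ### Laws of a random edge -/

/-- The edge is absent with probability `1 - p`, and otherwise uniform. -/
def lazyEdge (K n : ℕ) (p : ℝ) : Measure (Option (Fin K → Fin n)) :=
  ENNReal.ofReal (1 - p) • Measure.dirac none
    + ∑ a : Fin K → Fin n, ENNReal.ofReal (p / (n : ℝ) ^ K) • Measure.dirac (some a)

theorem isProbabilityMeasure_lazyEdge {K n : ℕ} (hn : 0 < n) {p : ℝ} (hp : 0 ≤ p) (hp1 : p ≤ 1) :
    IsProbabilityMeasure (lazyEdge K n p) := by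
  refine ⟨?_⟩
  have h : (0 : ℝ) < (n : ℝ) ^ K := by positivity
  simp only [lazyEdge, Measure.add_apply, Measure.smul_apply, measure_univ, smul_eq_mul, mul_one,
    Measure.coe_finsetSum, Finset.sum_apply, Finset.sum_const, Finset.card_univ, Fintype.card_fun,
    Fintype.card_fin, nsmul_eq_mul]
  rw [← ENNReal.ofReal_natCast, ← ENNReal.ofReal_mul (by positivity),
    ← ENNReal.ofReal_add (by linarith) (by positivity)]
  rw [← ENNReal.ofReal_one]
  congr 1
  push_cast
  field_simp
  ring

theorem integral_lazyEdge {K n : ℕ} {p : ℝ} (hp : 0 ≤ p) (hp1 : p ≤ 1)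
    (f : Option (Fin K → Fin n) → ℝ) :
    ∫ o, f o ∂(lazyEdge K n p) = (1 - p) * f none + p * edgeAverage fun a => f (some a) := by
  have hi : ∀ (c : ℝ) (o : Option (Fin K → Fin n)),
      Integrable f (ENNReal.ofReal c • Measure.dirac o) := fun c o =>
    (integrable_dirac (by simp)).smul_measure ENNReal.ofReal_ne_top
  rw [lazyEdge, integral_add_measure (hi _ _) (integrable_finsetSum_measure.2 fun a _ => hi _ _),
    integral_finsetSum_measure fun a _ => hi _ _]
  simp only [integral_smul_measure, integral_dirac, smul_eq_mul]
  rw [ENNReal.toReal_ofReal (by linarith), ENNReal.toReal_ofReal (by positivity), edgeAverage,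
    ← Finset.mul_sum]
  ring

/-- The edge is absent or inside one of two blocks of nodes, with probabilities proportional to
their sizes. -/
def blockEdge (K n₁ n₂ : ℕ) (l : ℝ) : Measure (Option (Fin K → Fin (n₁ + n₂))) :=
  ENNReal.ofReal (1 - l * (n₁ + n₂)) • Measure.dirac none
    + (∑ a : Fin K → Fin n₁, ENNReal.ofReal (l * n₁ / (n₁ : ℝ) ^ K) •
        Measure.dirac (some fun k => Fin.castAdd n₂ (a k))
      + ∑ a : Fin K → Fin n₂, ENNReal.ofReal (l * n₂ / (n₂ : ℝ) ^ K) •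
        Measure.dirac (some fun k => Fin.natAdd n₁ (a k)))

section Block

variable {K n₁ n₂ : ℕ} {l : ℝ}

theorem isProbabilityMeasure_blockEdge (hn₁ : 0 < n₁) (hn₂ : 0 < n₂) (hl : 0 ≤ l)
    (hl1 : l * (n₁ + n₂) ≤ 1) : IsProbabilityMeasure (blockEdge K n₁ n₂ l) := by
  refine ⟨?_⟩
  have h1 : (0 : ℝ) < (n₁ : ℝ) ^ K := by positivity
  have h2 : (0 : ℝ) < (n₂ : ℝ) ^ K := by positivity
  simp only [blockEdge, Measure.add_apply, Measure.smul_apply, measure_univ, smul_eq_mul, mul_one,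
    Measure.coe_finsetSum, Finset.sum_apply, Finset.sum_const, Finset.card_univ, Fintype.card_fun,
    Fintype.card_fin, nsmul_eq_mul]
  rw [← ENNReal.ofReal_natCast, ← ENNReal.ofReal_natCast, ← ENNReal.ofReal_mul (by positivity),
    ← ENNReal.ofReal_mul (by positivity), ← ENNReal.ofReal_add (by positivity) (by positivity),
    ← ENNReal.ofReal_add (by linarith) (by positivity)]
  rw [← ENNReal.ofReal_one]
  congr 1
  push_cast
  field_simp
  ring

theorem integral_blockEdge (hl : 0 ≤ l) (hl1 : l * (n₁ + n₂) ≤ 1)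
    (f : Option (Fin K → Fin (n₁ + n₂)) → ℝ) :
    ∫ o, f o ∂(blockEdge K n₁ n₂ l) = (1 - l * (n₁ + n₂)) * f none
      + (l * n₁ * edgeAverage (fun a : Fin K → Fin n₁ => f (some fun k => Fin.castAdd n₂ (a k)))
      + l * n₂ * edgeAverage fun a : Fin K → Fin n₂ => f (some fun k => Fin.natAdd n₁ (a k))) := by
  have hi : ∀ (c : ℝ) (o : Option (Fin K → Fin (n₁ + n₂))),
      Integrable f (ENNReal.ofReal c • Measure.dirac o) := fun c o =>
    (integrable_dirac (by simp)).smul_measure ENNReal.ofReal_ne_top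
  have hi₁ := integrable_finsetSum_measure.2 fun (a : Fin K → Fin n₁)
    (_ : a ∈ (Finset.univ : Finset (Fin K → Fin n₁))) => hi (l * n₁ / (n₁ : ℝ) ^ K)
      (some fun k => Fin.castAdd n₂ (a k))
  have hi₂ := integrable_finsetSum_measure.2 fun (a : Fin K → Fin n₂)
    (_ : a ∈ (Finset.univ : Finset (Fin K → Fin n₂))) => hi (l * n₂ / (n₂ : ℝ) ^ K)
      (some fun k => Fin.natAdd n₁ (a k))
  rw [blockEdge, integral_add_measure (hi _ _) (hi₁.add_measure hi₂),
    integral_add_measure hi₁ hi₂, integral_finsetSum_measure fun a _ => hi _ _,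
    integral_finsetSum_measure fun a _ => hi _ _]
  simp only [integral_smul_measure, integral_dirac, smul_eq_mul]
  rw [ENNReal.toReal_ofReal (by linarith), ENNReal.toReal_ofReal (by positivity),
    ENNReal.toReal_ofReal (by positivity), edgeAverage, edgeAverage,
    ← Finset.mul_sum, ← Finset.mul_sum]
  ring

/-- The restriction of an edge to the range of an embedding of the nodes. -/
def pullEdge {m n : ℕ} (f : Fin m → Fin n) (o : Option (Fin K → Fin n)) :
    Option (Fin K → Fin m) :=
  o.bind (Function.partialInv fun (a : Fin K → Fin m) k => f (a k))

theorem pullEdge_none {m n : ℕ} (f : Fin m → Fin n) :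
    pullEdge (K := K) f none = none := rfl

theorem pullEdge_comp {m n : ℕ} {f : Fin m → Fin n} (hf : Function.Injective f)
    (a : Fin K → Fin m) : pullEdge f (some fun k => f (a k)) = some a :=
  (Function.Injective.isPartialInv (f := fun (a : Fin K → Fin m) k => f (a k))
    (fun _ _ hab => funext fun k => hf (congrFun hab k)) a _).2 rfl

/-- Here `K ≥ 1` matters: the empty tuple would belong to both blocks. -/
theorem pullEdge_disjoint (hK : 1 ≤ K) {m m' n : ℕ} {f : Fin m → Fin n} {g : Fin m' → Fin n}
    (h : ∀ i j, f i ≠ g j) (a : Fin K → Fin m') :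
    pullEdge f (some fun k => g (a k)) = none := by
  change Function.partialInv _ _ = none
  rw [Function.partialInv, dif_neg]
  rintro ⟨b, hb⟩
  exact h _ _ (congrFun hb ⟨0, hK⟩)

theorem castAdd_ne_natAdd (i : Fin n₁) (j : Fin n₂) : Fin.castAdd n₂ i ≠ Fin.natAdd n₁ j := by
  intro h
  have := congrArg Fin.val h
  simp at this
  omega

/-- Seen from the first block, edges of the second are absent: their mass `l * n₂` joins the mass of
`none`, giving `1 - l * n₁`. -/
theorem measurePreserving_pull_left (hK : 1 ≤ K) (hn₂ : 0 < n₂) (hl : 0 ≤ l)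
    (hl1 : l * (n₁ + n₂) ≤ 1) :
    MeasurePreserving (pullEdge (Fin.castAdd n₂)) (blockEdge K n₁ n₂ l)
      (lazyEdge K n₁ (l * n₁)) := by
  have h2 : (0 : ℝ) < (n₂ : ℝ) ^ K := by positivity
  refine ⟨measurable_from_top, ?_⟩
  have hm : Measurable (pullEdge (K := K) (Fin.castAdd n₂ : Fin n₁ → _)) := measurable_from_top
  rw [blockEdge, Measure.map_add _ _ hm, Measure.map_add _ _ hm, Measure.map_smul,
    Measure.map_finset_sum hm.aemeasurable, Measure.map_finset_sum hm.aemeasurable]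
  simp only [Measure.map_smul, Measure.map_dirac' hm, pullEdge_none,
    pullEdge_comp (Fin.castAdd_injective n₁ n₂),
    pullEdge_disjoint hK (fun i j => castAdd_ne_natAdd (n₁ := n₁) (n₂ := n₂) i j)]
  rw [← Finset.sum_smul, lazyEdge, add_comm (∑ _, _ : Measure _), ← add_assoc, ← add_smul]
  congr 2
  rw [Finset.sum_const, Finset.card_univ, Fintype.card_fun, Fintype.card_fin, Fintype.card_fin,
    nsmul_eq_mul, ← ENNReal.ofReal_natCast, ← ENNReal.ofReal_mul (by positivity),
    ← ENNReal.ofReal_add (by linarith) (by positivity)]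
  congr 1
  push_cast
  field_simp
  ring

theorem measurePreserving_pull_right (hK : 1 ≤ K) (hn₁ : 0 < n₁) (hl : 0 ≤ l)
    (hl1 : l * (n₁ + n₂) ≤ 1) :
    MeasurePreserving (pullEdge (Fin.natAdd n₁)) (blockEdge K n₁ n₂ l)
      (lazyEdge K n₂ (l * n₂)) := by
  have h1 : (0 : ℝ) < (n₁ : ℝ) ^ K := by positivity
  refine ⟨measurable_from_top, ?_⟩
  have hm : Measurable (pullEdge (K := K) (Fin.natAdd n₁ : Fin n₂ → _)) := measurable_from_top
  rw [blockEdge, Measure.map_add _ _ hm, Measure.map_add _ _ hm, Measure.map_smul,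
    Measure.map_finset_sum hm.aemeasurable, Measure.map_finset_sum hm.aemeasurable]
  simp only [Measure.map_smul, Measure.map_dirac' hm, pullEdge_none,
    pullEdge_comp (Fin.natAdd_injective n₂ n₁),
    pullEdge_disjoint hK (fun i j => (castAdd_ne_natAdd (n₁ := n₁) (n₂ := n₂) j i).symm)]
  rw [← Finset.sum_smul, lazyEdge, ← add_assoc, ← add_smul]
  congr 2
  rw [Finset.sum_const, Finset.card_univ, Fintype.card_fun, Fintype.card_fin, Fintype.card_fin,
    nsmul_eq_mul, ← ENNReal.ofReal_natCast, ← ENNReal.ofReal_mul (by positivity),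
    ← ENNReal.ofReal_add (by linarith) (by positivity)]
  congr 1
  push_cast
  field_simp
  ring

theorem ae_blockEdge : ∀ᵐ o ∂(blockEdge K n₁ n₂ l),
    o = none ∨ (∃ a : Fin K → Fin n₁, o = some fun k => Fin.castAdd n₂ (a k)) ∨
      ∃ a : Fin K → Fin n₂, o = some fun k => Fin.natAdd n₁ (a k) := by
  rw [blockEdge, ae_add_measure_iff, ae_add_measure_iff, ae_finsetSum_measure_iff,
    ae_finsetSum_measure_iff]
  refine ⟨Measure.ae_smul_measure ?_ _, fun a _ => Measure.ae_smul_measure ?_ _,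
    fun a _ => Measure.ae_smul_measure ?_ _⟩ <;> rw [ae_dirac_eq, eventually_pure]
  exacts [Or.inl rfl, Or.inr (Or.inl ⟨a, rfl⟩), Or.inr (Or.inr ⟨a, rfl⟩)]

end Block

/-! ### Interpolation: changing the law of one edge at a time -/

section Replace

variable {K : ℕ} {Sh SJ : Type*} [MeasurableSpace Sh] [MeasurableSpace SJ]
  {νh : Measure Sh} [IsProbabilityMeasure νh] {νJ : Measure SJ} [IsProbabilityMeasure νJ]
  {h : Sh → ℝ → ℝ≥0} {J : SJ → (Fin K → ℝ) → ℝ≥0} {κ : ℝ} {r R : ℝ≥0} {Ω : Set ℝ}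
  {n : ℕ} {I : Type*} [Fintype I] [DecidableEq I]

theorem measurePreserving_law_update (μ : I → Measure (Option (Fin K → Fin n)))
    [∀ i, IsProbabilityMeasure (μ i)] (i : I) (μ' : Measure (Option (Fin K → Fin n)))
    [IsProbabilityMeasure μ'] :
    MeasurePreserving (fun q : ((Fin n → Sh) × (I → Mark K n SJ)) × Mark K n SJ =>
      (q.1.1, Function.update q.1.2 i q.2)) ((law νh νJ μ).prod (μ'.prod νJ))
      (law νh νJ (Function.update μ i μ')) := by
  have h1 := measurePreserving_update (fun j => (μ j).prod νJ) i (μ'.prod νJ)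
  have h2 : Function.update (fun j => (μ j).prod νJ) i (μ'.prod νJ)
      = fun j => (Function.update μ i μ' j).prod νJ := by
    funext j
    by_cases hj : j = i
    · subst hj; simp
    · simp [hj]
  rw [h2] at h1
  exact ((MeasurePreserving.id (Measure.pi fun _ : Fin n => νh)).prod h1).comp
    (measurePreserving_prodAssoc _ _ _)

instance isProbabilityMeasure_update (μ : I → Measure (Option (Fin K → Fin n)))
    [∀ i, IsProbabilityMeasure (μ i)] (i : I) (μ' : Measure (Option (Fin K → Fin n)))
    [IsProbabilityMeasure μ'] (j : I) : IsProbabilityMeasure (Function.update μ i μ' j) := by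
  by_cases hj : j = i
  · subst hj; simpa
  · simp only [Function.update_of_ne hj]; infer_instance

/-- The expected free energy after resampling the edge `i` of a realization. -/
def resampledEnergy (νJ : Measure SJ) (h : Sh → ℝ → ℝ≥0) (J : SJ → (Fin K → ℝ) → ℝ≥0)
    (p : (Fin n → Sh) × (I → Mark K n SJ)) (i : I) (μ : Measure (Option (Fin K → Fin n))) : ℝ :=
  ∫ m, freeEnergy h J (p.1, Function.update p.2 i m) ∂(μ.prod νJ)

theorem SoftModel.integrable_update (S : SoftModel νh νJ h J κ r R Ω)
    (μ : I → Measure (Option (Fin K → Fin n)))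
    [∀ i, IsProbabilityMeasure (μ i)] (i : I) (μ' : Measure (Option (Fin K → Fin n)))
    [IsProbabilityMeasure μ'] :
    Integrable (fun q : ((Fin n → Sh) × (I → Mark K n SJ)) × Mark K n SJ =>
      freeEnergy h J (q.1.1, Function.update q.1.2 i q.2)) ((law νh νJ μ).prod (μ'.prod νJ)) :=
  (measurePreserving_law_update μ i μ').integrable_comp_of_integrable
    (S.integrable_freeEnergy _)

theorem SoftModel.meanEnergy_update (S : SoftModel νh νJ h J κ r R Ω)
    (μ : I → Measure (Option (Fin K → Fin n)))
    [∀ i, IsProbabilityMeasure (μ i)] (i : I) (μ' : Measure (Option (Fin K → Fin n)))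
    [IsProbabilityMeasure μ'] :
    meanEnergy νh νJ h J (Function.update μ i μ')
      = ∫ p, resampledEnergy νJ h J p i μ' ∂(law νh νJ μ) := by
  have mp := measurePreserving_law_update (νh := νh) (νJ := νJ) μ i μ'
  unfold resampledEnergy
  rw [meanEnergy, ← mp.map_eq, integral_map mp.aemeasurable
    (by rw [mp.map_eq]; exact (S.integrable_freeEnergy _).1),
    integral_prod _ (S.integrable_update μ i μ')]

/-- Edge slots are switched from `μ` to `μ'` one by one; `F s` is the intermediate state with the
slots in `s` switched. The hypothesis compares the two laws of one slot conditionally on all the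
rest. -/
theorem SoftModel.meanEnergy_mono (S : SoftModel νh νJ h J κ r R Ω)
    (μ μ' : Measure (Option (Fin K → Fin n))) [IsProbabilityMeasure μ] [IsProbabilityMeasure μ']
    (H : ∀ (p : (Fin n → Sh) × (I → Mark K n SJ)) (i : I), IsSoft h J κ r R Ω p →
      resampledEnergy νJ h J p i μ ≤ resampledEnergy νJ h J p i μ') :
    meanEnergy νh νJ h J (fun _ : I => μ) ≤ meanEnergy νh νJ h J (fun _ : I => μ') := by
  set F : Finset I → I → Measure (Option (Fin K → Fin n)) := fun s i => if i ∈ s then μ' else μ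
  have hF : ∀ s i, IsProbabilityMeasure (F s i) := by
    intro s i; simp only [F]; split_ifs <;> infer_instance
  have key : ∀ s : Finset I,
      meanEnergy νh νJ h J (fun _ : I => μ) ≤ meanEnergy νh νJ h J (F s) := by
    intro s
    induction s using Finset.induction_on with
    | empty => simp [F]
    | insert j s hj ih =>
      have e1 : F (insert j s) = Function.update (F s) j μ' := by
        funext i
        by_cases hi : i = j
        · subst hi; simp [F]
        · simp [F, hi]
      -- Since `j ∉ s`, the state before the switch is itself an update at `j`, so both states are
      -- averages over the same law of the remaining data.
      have e2 : F s = Function.update (F s) j μ := by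
        funext i
        by_cases hi : i = j
        · subst hi; simp [F, hj]
        · simp [hi]
      refine ih.trans ?_
      have h1 := S.meanEnergy_update (F s) j μ
      have h2 := S.meanEnergy_update (F s) j μ'
      rw [← e2] at h1
      rw [← e1] at h2
      rw [h1, h2]
      refine integral_mono_ae (S.integrable_update (F s) j μ).integral_prod_left
        (S.integrable_update (F s) j μ').integral_prod_left ?_
      filter_upwards [S.ae_isSoft (F s)] with p hp
      exact H p j hp
  have := key Finset.univ
  simpa [F] using this

/-- The weight of a realization without the factor `i`. -/
def cavityWeight (h : Sh → ℝ → ℝ≥0) (J : SJ → (Fin K → ℝ) → ℝ≥0)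
    (p : (Fin n → Sh) × (I → Mark K n SJ)) (i : I) (x : Fin n → ℝ) : ℝ≥0 :=
  (∏ v, h (p.1 v) (x v)) * ∏ j ∈ Finset.univ.erase i, markFactor J (p.2 j) x

theorem factorWeight_update (p : (Fin n → Sh) × (I → Mark K n SJ)) (i : I) (m : Mark K n SJ)
    (x : Fin n → ℝ) :
    factorWeight (fun v => h (p.1 v)) (fun j => markFactor J (Function.update p.2 i m j)) x
      = cavityWeight h J p i x * markFactor J m x := by
  rw [factorWeight, cavityWeight, ← Finset.mul_prod_erase _ _ (Finset.mem_univ i),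
    Function.update_self, mul_assoc, mul_comm (markFactor J m x)]
  congr 2
  exact Finset.prod_congr rfl fun j hj => by
    rw [Function.update_of_ne (Finset.ne_of_mem_erase hj)]

theorem freeEnergy_update (p : (Fin n → Sh) × (I → Mark K n SJ)) (i : I) (m : Mark K n SJ) :
    freeEnergy h J (p.1, Function.update p.2 i m)
      = Real.log (∫⁻ x, ((cavityWeight h J p i x * markFactor J m x : ℝ≥0) : ℝ≥0∞)).toReal := by
  simp only [freeEnergy, logPartition, factorPartition, factorWeight_update]

theorem IsSoft.update {p : (Fin n → Sh) × (I → Mark K n SJ)} (hp : IsSoft h J κ r R Ω p) (i : I)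
    {m : Mark K n SJ} (hm : SoftFactor κ r R Ω (edgeNodes m.1) (markFactor J m)) :
    IsSoft h J κ r R Ω (p.1, Function.update p.2 i m) := by
  refine ⟨hp.1, fun j => ?_⟩
  by_cases hj : j = i
  · subst hj; simpa using hm
  · simpa only [Function.update_of_ne hj] using hp.2 j

theorem softFactor_none (hr1 : r ≤ 1) (hR : 1 ≤ R) (t : SJ) :
    SoftFactor κ r R Ω (edgeNodes (none : Option (Fin K → Fin n))) (markFactor J (none, t)) where
  aem := aemeasurable_const
  le_top _ := hR
  soft u hu := by simp [edgeNodes] at hu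
  box _ _ := hr1
  dep _ _ _ _ := rfl

/-- Making the slot `i` absent turns the cavity weight into the weight of an admissible model, to
which the general bounds apply. -/
theorem IsSoft.baseWeight (S : SoftModel νh νJ h J κ r R Ω)
    {p : (Fin n → Sh) × (I → Mark K n SJ)} (hp : IsSoft h J κ r R Ω p) (i : I) :
    BaseWeight Ω (cavityWeight h J p i) := by
  have hp' := hp.update i (m := (none, (p.2 i).2)) (softFactor_none S.r_le S.le_R _)
  have hZ : factorPartition (fun v => h (p.1 v))
      (fun j => markFactor J (Function.update p.2 i (none, (p.2 i).2) j))
      = ∫⁻ x, (cavityWeight h J p i x : ℝ≥0∞) := by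
    simp only [factorPartition, factorWeight_update]
    simp [markFactor]
  refine ⟨?_, ?_, ?_, ?_⟩
  · exact (Finset.aemeasurable_fun_prod _ fun v _ => aemeasurable_coord v (hp.1 v).aem).mul
      (Finset.aemeasurable_fun_prod _ fun j _ => (hp.2 j).aem)
  · intro x hx v
    by_contra hv
    exact hx (by rw [cavityWeight, Finset.prod_eq_zero (Finset.mem_univ v) ((hp.1 v).supp _ hv),
      zero_mul])
  · rw [← hZ]; exact factorPartition_pos S.r_pos hp'.1 hp'.2
  · rw [← hZ]; exact factorPartition_ne_top hp'.1 hp'.2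

theorem IsSoft.resampledEnergy_eq (S : SoftModel νh νJ h J κ r R Ω)
    {p : (Fin n → Sh) × (I → Mark K n SJ)} (hp : IsSoft h J κ r R Ω p) (i : I)
    (μ : Measure (Option (Fin K → Fin n))) [IsProbabilityMeasure μ] :
    resampledEnergy νJ h J p i μ = ∫ o, (∫ t,
      Real.log (∫⁻ x, ((cavityWeight h J p i x * markFactor J (o, t) x : ℝ≥0) : ℝ≥0∞)).toReal
        ∂νJ) ∂μ := by
  have hint : Integrable (fun m => freeEnergy h J (p.1, Function.update p.2 i m)) (μ.prod νJ) := by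
    refine Integrable.of_bound (C := logRatio r R * (n + Fintype.card I)) ?_ ?_
    · simp only [freeEnergy_update]
      have hw : AEMeasurable (fun q : Mark K n SJ × (Fin n → ℝ) =>
          cavityWeight h J p i q.2 * markFactor J q.1 q.2) ((μ.prod νJ).prod volume) :=
        ((hp.baseWeight S i).aem.comp_quasiMeasurePreserving
          Measure.quasiMeasurePreserving_snd).mul (S.aemeasurable_markFactor μ)
      exact (Real.measurable_log.comp_aemeasurable
        hw.coe_nnreal_ennreal.lintegral_prod_right'.ennreal_toReal).aestronglyMeasurable
    · filter_upwards [S.ae_mark μ] with m hm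
      exact (hp.update i hm).abs_freeEnergy_le S
  rw [resampledEnergy, integral_prod _ hint]
  simp only [freeEnergy_update]

/-- The edge is absent with the same probability under both laws, so these terms cancel and `l`
times `edgeAverage_superadditive` remains. -/
theorem IsSoft.resampledEnergy_block_le (S : SoftModel νh νJ h J κ r R Ω) {α : ℝ} (hα0 : 0 < α)
    (hα : ∀ᵐ t ∂νJ, ∀ x, (J t x : ℝ) ≤ α) (hT : TensorConvex νJ J Ω α) {n₁ n₂ : ℕ}
    (hn₁ : 0 < n₁) (hn₂ : 0 < n₂) {l : ℝ} (hl : 0 ≤ l) (hl1 : l * (n₁ + n₂) ≤ 1)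
    {p : (Fin (n₁ + n₂) → Sh) × (I → Mark K (n₁ + n₂) SJ)} (hp : IsSoft h J κ r R Ω p) (i : I) :
    resampledEnergy νJ h J p i (blockEdge K n₁ n₂ l)
      ≤ resampledEnergy νJ h J p i (lazyEdge K (n₁ + n₂) (l * (n₁ + n₂))) := by
  have := isProbabilityMeasure_blockEdge (K := K) hn₁ hn₂ hl hl1
  have := isProbabilityMeasure_lazyEdge (K := K) (n := n₁ + n₂) (by omega)
    (p := l * (n₁ + n₂)) (by positivity) hl1
  rw [hp.resampledEnergy_eq S, hp.resampledEnergy_eq S, integral_blockEdge hl hl1,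
    integral_lazyEdge (by positivity) hl1]
  have hr : (0 : ℝ) < r := by exact_mod_cast S.r_pos
  have hb : ∀ a : Fin K → Fin (n₁ + n₂), ∀ᵐ t ∂νJ, (r : ℝ) ^ (n₁ + n₂ + Fintype.card I) ≤
      (∫⁻ x, ((cavityWeight h J p i x * J t (fun k => x (a k)) : ℝ≥0) : ℝ≥0∞)).toReal := by
    intro a
    filter_upwards [S.edge (n₁ + n₂)] with t ht
    have hp' := hp.update i (m := (some a, t)) (ht (some a))
    have h1 := ENNReal.toReal_mono (factorPartition_ne_top hp'.1 hp'.2)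
      (le_factorPartition hp'.1 hp'.2)
    simp only [factorPartition, factorWeight_update] at h1
    rw [ENNReal.toReal_pow, ENNReal.coe_toReal] at h1
    exact h1
  have key := edgeAverage_superadditive S.edge_meas hn₁ hn₂ (hp.baseWeight S i) hα0 hα hT
    (pow_pos hr _) hb (fun a => ∫ t,
      Real.log (∫⁻ x, ((cavityWeight h J p i x * J t (fun k => x (a k)) : ℝ≥0) : ℝ≥0∞)).toReal
        ∂νJ) fun a => rfl
  have key' := mul_le_mul_of_nonneg_left key hl
  simp only [markFactor, Option.elim]
  linarith

end Replace

/-! ### Decoupling of the two blocks -/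

section Split

variable {K : ℕ} {Sh SJ : Type*} [MeasurableSpace Sh] [MeasurableSpace SJ]
  {νh : Measure Sh} [IsProbabilityMeasure νh] {νJ : Measure SJ} [IsProbabilityMeasure νJ]
  {h : Sh → ℝ → ℝ≥0} {J : SJ → (Fin K → ℝ) → ℝ≥0} {κ : ℝ} {r R : ℝ≥0} {Ω : Set ℝ}
  {n m : ℕ} {I : Type*} [Fintype I]

/-- The restriction of a realization along an embedding of the nodes. -/
def pullRealization (f : Fin m → Fin n) (p : (Fin n → Sh) × (I → Mark K n SJ)) :
    (Fin m → Sh) × (I → Mark K m SJ) :=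
  (p.1 ∘ f, fun i => (pullEdge f (p.2 i).1, (p.2 i).2))

theorem measurePreserving_pullRealization {f : Fin m → Fin n} (hf : Function.Injective f)
    (μ : Measure (Option (Fin K → Fin n))) [IsProbabilityMeasure μ]
    (μ' : Measure (Option (Fin K → Fin m))) [IsProbabilityMeasure μ']
    (hμ : MeasurePreserving (pullEdge f) μ μ') :
    MeasurePreserving (pullRealization f) (law νh νJ fun _ : I => μ)
      (law νh νJ fun _ : I => μ') :=
  (measurePreserving_comp_injective νh hf).prod
    (measurePreserving_pi _ _ fun _ => hμ.prod (MeasurePreserving.id νJ))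

theorem markFactor_block (hK : 1 ≤ K) {n₁ n₂ : ℕ} {o : Option (Fin K → Fin (n₁ + n₂))}
    (ho : o = none ∨ (∃ a : Fin K → Fin n₁, o = some fun k => Fin.castAdd n₂ (a k)) ∨
      ∃ a : Fin K → Fin n₂, o = some fun k => Fin.natAdd n₁ (a k)) (t : SJ)
    (x : Fin (n₁ + n₂) → ℝ) :
    markFactor J (o, t) x = markFactor J (pullEdge (Fin.castAdd n₂) o, t)
        (fun i => x (Fin.castAdd n₂ i))
      * markFactor J (pullEdge (Fin.natAdd n₁) o, t) (fun i => x (Fin.natAdd n₁ i)) := by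
  rcases ho with rfl | ⟨a, rfl⟩ | ⟨a, rfl⟩
  · simp [pullEdge_none, markFactor]
  · rw [pullEdge_comp (Fin.castAdd_injective n₁ n₂),
      pullEdge_disjoint hK (fun i j => (castAdd_ne_natAdd (n₁ := n₁) (n₂ := n₂) j i).symm)]
    simp [markFactor]
  · rw [pullEdge_comp (Fin.natAdd_injective n₂ n₁),
      pullEdge_disjoint hK (fun i j => castAdd_ne_natAdd (n₁ := n₁) (n₂ := n₂) i j)]
    simp [markFactor]

/-- Each edge lies in at most one block, so the weight is a product of functions of disjoint sets of
spins. -/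
theorem freeEnergy_block (hK : 1 ≤ K) (S : SoftModel νh νJ h J κ r R Ω) {n₁ n₂ : ℕ}
    {p : (Fin (n₁ + n₂) → Sh) × (I → Mark K (n₁ + n₂) SJ)}
    (hp : ∀ i, (p.2 i).1 = none ∨
      (∃ a : Fin K → Fin n₁, (p.2 i).1 = some fun k => Fin.castAdd n₂ (a k)) ∨
      ∃ a : Fin K → Fin n₂, (p.2 i).1 = some fun k => Fin.natAdd n₁ (a k))
    (h₁ : IsSoft h J κ r R Ω (pullRealization (Fin.castAdd n₂) p))
    (h₂ : IsSoft h J κ r R Ω (pullRealization (Fin.natAdd n₁) p)) :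
    freeEnergy h J p = freeEnergy h J (pullRealization (Fin.castAdd n₂) p)
      + freeEnergy h J (pullRealization (Fin.natAdd n₁) p) := by
  have hm₁ := aemeasurable_factorWeight (fun v => (h₁.1 v).aem) (fun i => (h₁.2 i).aem)
  have hm₂ := aemeasurable_factorWeight (fun v => (h₂.1 v).aem) (fun i => (h₂.2 i).aem)
  have hw : ∀ x, factorWeight (fun v => h (p.1 v)) (fun i => markFactor J (p.2 i)) x
      = factorWeight (fun v => h ((pullRealization (Fin.castAdd n₂) p).1 v))
          (fun i => markFactor J ((pullRealization (Fin.castAdd n₂) p).2 i))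
            (fun i => x (Fin.castAdd n₂ i))
        * factorWeight (fun v => h ((pullRealization (Fin.natAdd n₁) p).1 v))
          (fun i => markFactor J ((pullRealization (Fin.natAdd n₁) p).2 i))
            (fun i => x (Fin.natAdd n₁ i)) := by
    intro x
    simp only [factorWeight]
    rw [Fin.prod_univ_add, Finset.prod_congr rfl fun i _ => markFactor_block hK (hp i) (p.2 i).2 x,
      Finset.prod_mul_distrib]
    simp only [pullRealization, Function.comp]
    ring
  have hZ : factorPartition (fun v => h (p.1 v)) (fun i => markFactor J (p.2 i))
      = factorPartition (fun v => h ((pullRealization (Fin.castAdd n₂) p).1 v))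
          (fun i => markFactor J ((pullRealization (Fin.castAdd n₂) p).2 i))
        * factorPartition (fun v => h ((pullRealization (Fin.natAdd n₁) p).1 v))
          (fun i => markFactor J ((pullRealization (Fin.natAdd n₁) p).2 i)) := by
    have mp := measurePreserving_castAdd_natAdd (m := n₁) (n := n₂) (volume : Measure ℝ)
    simp only [factorPartition]
    rw [← lintegral_prod_mul hm₁.coe_nnreal_ennreal hm₂.coe_nnreal_ennreal]
    have hmm := hm₁.coe_nnreal_ennreal.comp_fst (ν := (volume : Measure (Fin n₂ → ℝ))) |>.mul
      (hm₂.coe_nnreal_ennreal.comp_snd (μ := (volume : Measure (Fin n₁ → ℝ))))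
    simp only [hw, ENNReal.coe_mul]
    simp only [volume_pi] at hmm ⊢
    rw [← mp.map_eq, lintegral_map' (by rw [mp.map_eq]; exact hmm) mp.aemeasurable]
  rw [freeEnergy, logPartition, hZ, ENNReal.toReal_mul, Real.log_mul]
  · rfl
  · exact (ENNReal.toReal_pos (factorPartition_pos S.r_pos h₁.1 h₁.2)
      (factorPartition_ne_top h₁.1 h₁.2)).ne'
  · exact (ENNReal.toReal_pos (factorPartition_pos S.r_pos h₂.1 h₂.2)
      (factorPartition_ne_top h₂.1 h₂.2)).ne'

/-- The left side is exactly the mean energy under `blockEdge`, which interpolation compares with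
the global law. The slots `I` and the rate `l` are shared by all three systems; only the probability
of presence scales with size. -/
theorem SoftModel.meanEnergy_superadditive (hK : 1 ≤ K) (S : SoftModel νh νJ h J κ r R Ω) {α : ℝ}
    (hα0 : 0 < α) (hα : ∀ᵐ t ∂νJ, ∀ x, (J t x : ℝ) ≤ α) (hT : TensorConvex νJ J Ω α)
    {n₁ n₂ : ℕ} (hn₁ : 0 < n₁) (hn₂ : 0 < n₂) {l : ℝ} (hl : 0 ≤ l) (hl1 : l * (n₁ + n₂) ≤ 1) :
    meanEnergy νh νJ h J (fun _ : I => lazyEdge K n₁ (l * n₁))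
      + meanEnergy νh νJ h J (fun _ : I => lazyEdge K n₂ (l * n₂))
      ≤ meanEnergy νh νJ h J (fun _ : I => lazyEdge K (n₁ + n₂) (l * (n₁ + n₂))) := by
  classical
  have hN₁ : (0 : ℝ) < n₁ := by exact_mod_cast hn₁
  have hN₂ : (0 : ℝ) < n₂ := by exact_mod_cast hn₂
  have := isProbabilityMeasure_blockEdge (K := K) hn₁ hn₂ hl hl1
  have := isProbabilityMeasure_lazyEdge (K := K) (n := n₁ + n₂) (by omega)
    (p := l * (n₁ + n₂)) (by positivity) hl1
  have := isProbabilityMeasure_lazyEdge (K := K) hn₁ (p := l * n₁) (by positivity) (by nlinarith)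
  have := isProbabilityMeasure_lazyEdge (K := K) hn₂ (p := l * n₂) (by positivity) (by nlinarith)
  refine le_trans (le_of_eq ?_) (S.meanEnergy_mono (blockEdge K n₁ n₂ l) _ fun p i hp =>
    hp.resampledEnergy_block_le S hα0 hα hT hn₁ hn₂ hl hl1 i)
  have mp₁ := measurePreserving_pullRealization (νh := νh) (νJ := νJ) (I := I)
    (Fin.castAdd_injective n₁ n₂) _ _ (measurePreserving_pull_left (K := K) hK hn₂ hl hl1)
  have mp₂ := measurePreserving_pullRealization (νh := νh) (νJ := νJ) (I := I)
    (Fin.natAdd_injective n₂ n₁) _ _ (measurePreserving_pull_right (K := K) hK hn₁ hl hl1)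
  have i₁ := S.integrable_freeEnergy (I := I) fun _ => lazyEdge K n₁ (l * n₁)
  have i₂ := S.integrable_freeEnergy (I := I) fun _ => lazyEdge K n₂ (l * n₂)
  have hmarks : ∀ᵐ p ∂(law νh νJ fun _ : I => blockEdge K n₁ n₂ l), ∀ i, (p.2 i).1 = none ∨
      (∃ a : Fin K → Fin n₁, (p.2 i).1 = some fun k => Fin.castAdd n₂ (a k)) ∨
      ∃ a : Fin K → Fin n₂, (p.2 i).1 = some fun k => Fin.natAdd n₁ (a k) :=
    Measure.quasiMeasurePreserving_snd.ae (ae_all_iff.2 fun i =>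
      (Measure.quasiMeasurePreserving_eval
        (fun _ : I => (blockEdge K n₁ n₂ l).prod νJ) i).ae
        (Measure.quasiMeasurePreserving_fst.ae ae_blockEdge))
  have hsplit : ∀ᵐ p ∂(law νh νJ fun _ : I => blockEdge K n₁ n₂ l),
      freeEnergy h J p = freeEnergy h J (pullRealization (Fin.castAdd n₂) p)
      + freeEnergy h J (pullRealization (Fin.natAdd n₁) p) := by
    filter_upwards [hmarks, mp₁.quasiMeasurePreserving.ae (S.ae_isSoft _),
      mp₂.quasiMeasurePreserving.ae (S.ae_isSoft _)] with p h1 h2 h3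
    exact freeEnergy_block hK S h1 h2 h3
  have j₁ : Integrable (fun p => freeEnergy h J (pullRealization (Fin.castAdd n₂) p))
      (law νh νJ fun _ : I => blockEdge K n₁ n₂ l) := mp₁.integrable_comp_of_integrable i₁
  have j₂ : Integrable (fun p => freeEnergy h J (pullRealization (Fin.natAdd n₁) p))
      (law νh νJ fun _ : I => blockEdge K n₁ n₂ l) := mp₂.integrable_comp_of_integrable i₂
  rw [meanEnergy, meanEnergy, meanEnergy, integral_congr_ae hsplit, integral_add j₁ j₂,
    ← mp₁.map_eq, ← mp₂.map_eq, integral_map mp₁.aemeasurable (by rw [mp₁.map_eq]; exact i₁.1),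
    integral_map mp₂.aemeasurable (by rw [mp₂.map_eq]; exact i₂.1)]

end Split

/-! ### Degrees -/

section Degree

variable {K n : ℕ}

/-- The number of edges containing `u`. -/
def degree {I : Type*} [Fintype I] (o : I → Option (Fin K → Fin n)) (u : Fin n) : ℕ :=
  (Finset.univ.filter fun i => u ∈ edgeNodes (o i)).card

theorem card_edgeNodes_le (o : Option (Fin K → Fin n)) : (edgeNodes o).card ≤ K := by
  cases o with
  | none => simp [edgeNodes]
  | some a => simpa [edgeNodes] using Finset.card_image_le (s := Finset.univ) (f := a)

theorem sum_degree_le {I : Type*} [Fintype I] (o : I → Option (Fin K → Fin n)) :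
    ∑ u, degree o u ≤ K * Fintype.card I := by
  simp only [degree, Finset.card_filter]
  rw [Finset.sum_comm]
  calc _ ≤ ∑ _i : I, K := by
        refine Finset.sum_le_sum fun i _ => ?_
        rw [← Finset.card_filter]
        refine le_trans (Finset.card_le_card fun u hu => ?_) (card_edgeNodes_le (o i))
        exact (Finset.mem_filter.1 hu).2
    _ = _ := by simp [mul_comm]

theorem edgeAverage_coord (hn : 0 < n) (g : Fin n → ℝ) (k : Fin K) :
    edgeAverage (fun a : Fin K → Fin n => g (a k)) = (∑ u, g u) / n := by
  have h1 : ∑ a : Fin K → Fin n, g (a k) = (∑ u, g u) * (n : ℝ) ^ (K - 1) := by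
    -- Expand a product over positions whose factor is `∑ u, g u` at `k` and `n` elsewhere.
    have h2 := Finset.prod_univ_sum (fun _ : Fin K => (Finset.univ : Finset (Fin n)))
      (fun j u => if j = k then g u else 1)
    rw [Fintype.piFinset_univ] at h2
    have h3 : ∀ a : Fin K → Fin n, ∏ j, (if j = k then g (a j) else 1) = g (a k) := fun a => by
      simp
    simp only [h3] at h2
    rw [← h2, ← Finset.mul_prod_erase _ _ (Finset.mem_univ k)]
    simp only [if_true]
    congr 1
    rw [Finset.prod_congr rfl fun j hj => by
      rw [Finset.sum_congr rfl fun u _ => if_neg (Finset.ne_of_mem_erase hj)]]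
    simp [Finset.card_erase_of_mem]
  have hK : K - 1 + 1 = K := by have := k.2; omega
  have hn' : (n : ℝ) ≠ 0 := by positivity
  rw [edgeAverage, h1]
  conv_lhs => rw [← hK]
  rw [Nat.add_sub_cancel, pow_succ]
  field_simp

end Degree

/-! ### Lazy edges as uniform edges with a binomial count -/

section Mask

variable {K : ℕ} {Sh SJ : Type*} [MeasurableSpace Sh] [MeasurableSpace SJ]
  {νh : Measure Sh} [IsProbabilityMeasure νh] {νJ : Measure SJ} [IsProbabilityMeasure νJ]
  {h : Sh → ℝ → ℝ≥0} {J : SJ → (Fin K → ℝ) → ℝ≥0} {κ : ℝ} {r R : ℝ≥0} {Ω : Set ℝ}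
  {n m : ℕ} {I I' : Type*} [Fintype I] [Fintype I']

theorem freeEnergy_comp_injective {f : I' → I} (hf : Function.Injective f)
    (p : (Fin n → Sh) × (I → Mark K n SJ)) (hp : ∀ i, i ∉ Set.range f → (p.2 i).1 = none) :
    freeEnergy h J p = freeEnergy h J (p.1, p.2 ∘ f) := by
  have : ∀ x, ∏ i, markFactor J (p.2 i) x = ∏ i, markFactor J (p.2 (f i)) x := fun x =>
    (Fintype.prod_of_injective f hf _ _ (fun i hi => by simp [markFactor, hp i hi])
      fun i => rfl).symm
  simp only [freeEnergy, logPartition, factorPartition, factorWeight, this, Function.comp]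

theorem measurePreserving_law_comp {f : I' → I} (hf : Function.Injective f)
    (μ : Measure (Option (Fin K → Fin n))) [IsProbabilityMeasure μ] :
    MeasurePreserving (fun p : (Fin n → Sh) × (I → Mark K n SJ) => (p.1, p.2 ∘ f))
      (law νh νJ fun _ => μ) (law νh νJ fun _ => μ) :=
  (MeasurePreserving.id _).prod (measurePreserving_comp_injective (μ.prod νJ) hf)

/-- The law of a bit which is `true` with probability `p`. -/
def bit (p : ℝ) : Measure Bool :=
  ENNReal.ofReal (1 - p) • Measure.dirac false + ENNReal.ofReal p • Measure.dirac true

theorem isProbabilityMeasure_bit {p : ℝ} (hp : 0 ≤ p) (hp1 : p ≤ 1) :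
    IsProbabilityMeasure (bit p) := by
  refine ⟨?_⟩
  simp only [bit, Measure.add_apply, Measure.smul_apply, measure_univ, smul_eq_mul, mul_one]
  rw [← ENNReal.ofReal_add (by linarith) hp]
  simp

theorem integral_bit {p : ℝ} (hp : 0 ≤ p) (hp1 : p ≤ 1) (f : Bool → ℝ) :
    ∫ b, f b ∂(bit p) = (1 - p) * f false + p * f true := by
  have hi : ∀ (c : ℝ) (b : Bool), Integrable f (ENNReal.ofReal c • Measure.dirac b) := fun c o =>
    (integrable_dirac (by simp)).smul_measure ENNReal.ofReal_ne_top
  rw [bit, integral_add_measure (hi _ _) (hi _ _)]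
  simp only [integral_smul_measure, integral_dirac, smul_eq_mul]
  rw [ENNReal.toReal_ofReal (by linarith), ENNReal.toReal_ofReal hp]

/-- Remove the edge if the bit is `false`. -/
def maskEdge (q : Bool × Option (Fin K → Fin n)) : Option (Fin K → Fin n) :=
  if q.1 then q.2 else none

theorem measurePreserving_maskEdge (hn : 0 < n) {p : ℝ} (hp : 0 ≤ p) :
    MeasurePreserving maskEdge ((bit p).prod (lazyEdge K n 1)) (lazyEdge K n p) := by
  have := isProbabilityMeasure_lazyEdge (K := K) hn zero_le_one le_rfl
  have hm : Measurable (maskEdge : Bool × Option (Fin K → Fin n) → _) := Measurable.of_discrete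
  refine ⟨hm, ?_⟩
  rw [bit, Measure.add_prod, Measure.prod_smul_left, Measure.prod_smul_left, Measure.dirac_prod,
    Measure.dirac_prod, Measure.map_add _ _ hm, Measure.map_smul, Measure.map_smul,
    Measure.map_map hm Measurable.of_discrete, Measure.map_map hm Measurable.of_discrete]
  have h1 : (maskEdge ∘ Prod.mk false : Option (Fin K → Fin n) → _) = fun _ => none := by
    funext o; simp [maskEdge]
  have h2 : (maskEdge ∘ Prod.mk true : Option (Fin K → Fin n) → _) = id := by
    funext o; simp [maskEdge]
  rw [h1, h2, Measure.map_const, Measure.map_id, measure_univ, one_smul, lazyEdge, lazyEdge]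
  congr 1
  rw [sub_self, ENNReal.ofReal_zero, zero_smul, zero_add, Finset.smul_sum]
  refine Finset.sum_congr rfl fun a _ => ?_
  rw [smul_smul, ← ENNReal.ofReal_mul hp, mul_one_div]

/-- Remove the edges whose bit is `false`. -/
def maskRealization (q : (I → Bool) × ((Fin n → Sh) × (I → Mark K n SJ))) :
    (Fin n → Sh) × (I → Mark K n SJ) :=
  (q.2.1, fun i => (maskEdge (q.1 i, (q.2.2 i).1), (q.2.2 i).2))

theorem measurePreserving_maskRealization (hn : 0 < n) {p : ℝ} (hp : 0 ≤ p) (hp1 : p ≤ 1) :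
    MeasurePreserving maskRealization
      ((Measure.pi fun _ : I => bit p).prod (law νh νJ fun _ : I => lazyEdge K n 1))
      (law νh νJ fun _ : I => lazyEdge K n p) := by
  have := isProbabilityMeasure_lazyEdge (K := K) hn zero_le_one le_rfl
  have := isProbabilityMeasure_lazyEdge (K := K) hn hp hp1
  have := isProbabilityMeasure_bit hp hp1
  -- Masking is done slot by slot; the remaining steps only regroup and commute product factors.
  have a1 : MeasurePreserving (fun q : Bool × Mark K n SJ => (maskEdge (q.1, q.2.1), q.2.2))
      ((bit p).prod ((lazyEdge K n 1).prod νJ)) ((lazyEdge K n p).prod νJ) :=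
    ((measurePreserving_maskEdge hn hp).prod (MeasurePreserving.id νJ)).comp
      (measurePreserving_prodAssoc (bit p) (lazyEdge K n 1) νJ).symm
  have a2 := measurePreserving_pi (fun _ : I => (bit p).prod ((lazyEdge K n 1).prod νJ)) _
    fun _ => a1
  have a3 := (measurePreserving_arrowProdEquivProdArrow Bool (Mark K n SJ) I (fun _ => bit p)
    (fun _ => (lazyEdge K n 1).prod νJ)).symm
  have a4 := (MeasurePreserving.id (Measure.pi fun _ : Fin n => νh)).prod (a2.comp a3)
  have a5 := measurePreserving_prodAssoc (Measure.pi fun _ : I => bit p)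
    (Measure.pi fun _ : Fin n => νh) (Measure.pi fun _ : I => (lazyEdge K n 1).prod νJ)
  have a6 := measurePreserving_prodAssoc (Measure.pi fun _ : Fin n => νh)
    (Measure.pi fun _ : I => bit p) (Measure.pi fun _ : I => (lazyEdge K n 1).prod νJ)
  have a7 : MeasurePreserving Prod.swap ((Measure.pi fun _ : I => bit p).prod
    (Measure.pi fun _ : Fin n => νh)) _ := Measure.measurePreserving_swap
  exact a4.comp (a6.comp ((a7.prod (MeasurePreserving.id _)).comp a5.symm))

/-- The expected free energy of `m` uniform edges on `n` nodes. -/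
def uniformEnergy (νh : Measure Sh) (νJ : Measure SJ) (h : Sh → ℝ → ℝ≥0)
    (J : SJ → (Fin K → ℝ) → ℝ≥0) (n m : ℕ) : ℝ :=
  meanEnergy νh νJ h J fun _ : Fin m => lazyEdge K n 1

/-- Given the bits, the surviving edges are again i.i.d. and uniform, so only their number matters.
-/
theorem SoftModel.integral_mask (S : SoftModel νh νJ h J κ r R Ω) (hn : 0 < n) (b : I → Bool) :
    ∫ p, freeEnergy h J (maskRealization (b, p)) ∂(law νh νJ fun _ : I => lazyEdge K n 1)
      = uniformEnergy νh νJ h J n (Finset.univ.filter fun i => b i = true).card := by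
  have := isProbabilityMeasure_lazyEdge (K := K) hn zero_le_one le_rfl
  set s := Finset.univ.filter fun i => b i = true
  set f : Fin s.card → I := fun j => (s.equivFin.symm j : I)
  have hf : Function.Injective f := Subtype.val_injective.comp s.equivFin.symm.injective
  have hb : ∀ j, b (f j) = true := fun j => (Finset.mem_filter.1 (s.equivFin.symm j).2).2
  have e : ∀ p : (Fin n → Sh) × (I → Mark K n SJ),
      freeEnergy h J (maskRealization (b, p)) = freeEnergy h J (p.1, p.2 ∘ f) := by
    intro p
    rw [freeEnergy_comp_injective hf]
    · congr 2
      funext j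
      simp [maskRealization, maskEdge, hb]
    · intro i hi
      have : ¬ b i = true := fun hbi => hi
        ⟨s.equivFin ⟨i, Finset.mem_filter.2 ⟨Finset.mem_univ i, hbi⟩⟩, by simp [f]⟩
      simp [maskRealization, maskEdge, this]
  have mp := measurePreserving_law_comp (νh := νh) (νJ := νJ) hf (lazyEdge K n 1)
  simp only [e]
  rw [uniformEnergy, meanEnergy, ← mp.map_eq, integral_map mp.aemeasurable
    (by rw [mp.map_eq]; exact (S.integrable_freeEnergy _).1)]

theorem SoftModel.meanEnergy_lazy (S : SoftModel νh νJ h J κ r R Ω) (hn : 0 < n) {p : ℝ}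
    (hp : 0 ≤ p) (hp1 : p ≤ 1) :
    meanEnergy νh νJ h J (fun _ : I => lazyEdge K n p)
      = ∫ b, uniformEnergy νh νJ h J n (Finset.univ.filter fun i => b i = true).card
          ∂(Measure.pi fun _ : I => bit p) := by
  have := isProbabilityMeasure_lazyEdge (K := K) hn zero_le_one le_rfl
  have := isProbabilityMeasure_lazyEdge (K := K) hn hp hp1
  have := isProbabilityMeasure_bit hp hp1
  have mp := measurePreserving_maskRealization (I := I) (νh := νh) (νJ := νJ) (K := K) hn hp hp1
  have hi := mp.integrable_comp_of_integrable (S.integrable_freeEnergy _)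
  rw [meanEnergy, ← mp.map_eq, integral_map mp.aemeasurable
    (by rw [mp.map_eq]; exact (S.integrable_freeEnergy _).1)]
  refine (integral_prod _ hi).trans ?_
  exact integral_congr_ae (Eventually.of_forall fun b => S.integral_mask hn b)

end Mask

/-! ### Dependence of the mean energy on the number of edges -/

section Compare

variable {K : ℕ} {Sh SJ : Type*} [MeasurableSpace Sh] [MeasurableSpace SJ]
  {νh : Measure Sh} [IsProbabilityMeasure νh] {νJ : Measure SJ} [IsProbabilityMeasure νJ]
  {h : Sh → ℝ → ℝ≥0} {J : SJ → (Fin K → ℝ) → ℝ≥0} {κ : ℝ} {r R : ℝ≥0} {Ω : Set ℝ}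
  {n m : ℕ} {I : Type*} [Fintype I] [DecidableEq I]

theorem measurePreserving_edges (μ : Measure (Option (Fin K → Fin n))) [IsProbabilityMeasure μ] :
    MeasurePreserving (fun (p : (Fin n → Sh) × (I → Mark K n SJ)) i => (p.2 i).1)
      (law νh νJ fun _ => μ) (Measure.pi fun _ => μ) :=
  (measurePreserving_pi (fun _ : I => μ.prod νJ) (fun _ => μ) fun _ =>
    measurePreserving_fst).comp measurePreserving_snd

/-- Averages out the edge `i` first; useful when `G` sees the other edges only through cavity
degrees at endpoints of `i`. -/
theorem integral_edges_eq (hn : 0 < n) (G : (I → Option (Fin K → Fin n)) → ℝ) (i : I) :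
    ∫ o, G o ∂(Measure.pi fun _ => lazyEdge K n 1)
      = ∫ o, edgeAverage (fun a => G (Function.update o i (some a)))
          ∂(Measure.pi fun _ => lazyEdge K n 1) := by
  have := isProbabilityMeasure_lazyEdge (K := K) hn zero_le_one le_rfl
  have mp := measurePreserving_update_self (lazyEdge K n 1) i
  conv_lhs => rw [← mp.map_eq]
  rw [integral_map mp.aemeasurable Measurable.of_discrete.aestronglyMeasurable,
    integral_prod _ Integrable.of_finite]
  refine integral_congr_ae (Eventually.of_forall fun o => ?_)
  have := integral_lazyEdge (K := K) (n := n) zero_le_one le_rfl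
    fun o' => G (Function.update o i o')
  simpa using this

theorem ae_lazyEdge_one :
    ∀ᵐ o ∂(lazyEdge K n 1), ∃ a, o = some a := by
  rw [lazyEdge, sub_self, ENNReal.ofReal_zero, zero_smul, zero_add, ae_finsetSum_measure_iff]
  intro a _
  refine Measure.ae_smul_measure ?_ _
  rw [ae_dirac_eq, eventually_pure]
  exact ⟨a, rfl⟩

theorem ae_edges_some (hn : 0 < n) :
    ∀ᵐ p ∂(law νh νJ fun _ : I => lazyEdge K n 1), ∀ i, ∃ a, (p.2 i).1 = some a := by
  have := isProbabilityMeasure_lazyEdge (K := K) hn zero_le_one le_rfl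
  exact (measurePreserving_edges (lazyEdge K n 1)).quasiMeasurePreserving.ae
    (ae_all_iff.2 fun i => (Measure.quasiMeasurePreserving_eval
      (fun _ : I => lazyEdge K n 1) i).ae ae_lazyEdge_one)

/-- The number of edges other than `i` containing `u`. -/
def cavityDegree (o : I → Option (Fin K → Fin n)) (i : I) (u : Fin n) : ℕ :=
  degree (Function.update o i none) u

theorem edgeNodes_update (e : I → Mark K n SJ) (i : I) (m : Mark K n SJ) (j : I) :
    (Function.update e i m j).1 = Function.update (fun j => (e j).1) i m.1 j := by
  by_cases hj : j = i
  · subst hj; simp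
  · simp [hj]

theorem IsSoft.abs_freeEnergy_sub_erase_le (S : SoftModel νh νJ h J κ r R Ω)
    {p : (Fin n → Sh) × (I → Mark K n SJ)} (hp : IsSoft h J κ r R Ω p) (i : I)
    {a : Fin K → Fin n} (ha : (p.2 i).1 = some a) (k : Fin K) (t : SJ) :
    |freeEnergy h J p - freeEnergy h J (p.1, Function.update p.2 i (none, t))|
      ≤ 2 * logRatio r R * (cavityDegree (fun j => (p.2 j).1) i (a k) + 2) := by
  have hp' := hp.update i (m := (none, t)) (softFactor_none S.r_le S.le_R _)
  cases n with
  | zero => exact (a k).elim0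
  | succ n =>
    have := abs_logPartition_sub_erase S.core S.r_pos S.r_le S.le_R hp.1 hp.2 hp'.2 i (a k)
      (by simp [ha, edgeNodes]) (by simp [edgeNodes]) (by simp [markFactor])
      (fun j hj => by simp [hj])
    refine this.trans (le_of_eq ?_)
    simp only [cavityDegree, degree, edgeNodes_update]

/-- Couple the two systems by dropping edge `0`. The cost is governed by the degree, in the
remaining edges, of one endpoint; that endpoint is uniform and independent of them, so the mean
degree `K * (m + 1) / n` bounds the average. -/
theorem SoftModel.abs_uniformEnergy_succ_sub_le (hK : 1 ≤ K) (S : SoftModel νh νJ h J κ r R Ω)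
    (hn : 0 < n) (m : ℕ) :
    |uniformEnergy νh νJ h J n (m + 1) - uniformEnergy νh νJ h J n m|
      ≤ 2 * logRatio r R * (K * (m + 1) / n + 2) := by
  have hP := isProbabilityMeasure_lazyEdge (K := K) hn zero_le_one le_rfl
  have hC := logRatio_nonneg S.r_le S.le_R
  have hN : (0 : ℝ) < n := by exact_mod_cast hn
  set B : (Fin (m + 1) → Option (Fin K → Fin n)) → ℝ := fun o =>
    (o 0).elim 0 fun a => 2 * logRatio r R * (cavityDegree o 0 (a ⟨0, hK⟩) + 2) with hB
  have mp := measurePreserving_law_comp (νh := νh) (νJ := νJ) (Fin.succ_injective m)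
    (lazyEdge K n 1)
  have mpe := measurePreserving_edges (I := Fin (m + 1)) (νh := νh) (νJ := νJ) (lazyEdge K n 1)
  have i₁ := S.integrable_freeEnergy fun _ : Fin (m + 1) => lazyEdge K n 1
  have i₂ : Integrable (fun p : (Fin n → Sh) × (Fin (m + 1) → Mark K n SJ) =>
      freeEnergy h J (p.1, p.2 ∘ Fin.succ)) (law νh νJ fun _ => lazyEdge K n 1) :=
    mp.integrable_comp_of_integrable (S.integrable_freeEnergy _)
  have i₃ : Integrable (fun p : (Fin n → Sh) × (Fin (m + 1) → Mark K n SJ) =>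
      B fun i => (p.2 i).1) (law νh νJ fun _ => lazyEdge K n 1) :=
    mpe.integrable_comp_of_integrable (g := B) Integrable.of_finite
  have hbound : ∀ᵐ p ∂(law νh νJ fun _ : Fin (m + 1) => lazyEdge K n 1),
      ‖freeEnergy h J p - freeEnergy h J (p.1, p.2 ∘ Fin.succ)‖ ≤ B fun i => (p.2 i).1 := by
    filter_upwards [S.ae_isSoft _, ae_edges_some hn] with p hp hs
    obtain ⟨a, ha⟩ := hs 0
    have h1 := hp.abs_freeEnergy_sub_erase_le S 0 ha ⟨0, hK⟩ (p.2 0).2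
    rw [freeEnergy_comp_injective (h := h) (J := J) (Fin.succ_injective m)
      (p.1, Function.update p.2 0 (none, (p.2 0).2))] at h1
    · have h2 : Function.update p.2 0 (none, (p.2 0).2) ∘ Fin.succ = p.2 ∘ Fin.succ := by
        funext j; simp
      simp only [h2] at h1
      simpa [hB, ha] using h1
    · intro i hi
      have : i = 0 := by
        by_contra h0
        exact hi ⟨i.pred h0, by simp⟩
      subst this
      simp
  have hI : uniformEnergy νh νJ h J n (m + 1) - uniformEnergy νh νJ h J n m
      = ∫ p, (freeEnergy h J p - freeEnergy h J (p.1, p.2 ∘ Fin.succ))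
        ∂(law νh νJ fun _ : Fin (m + 1) => lazyEdge K n 1) := by
    rw [integral_sub i₁ i₂, uniformEnergy, uniformEnergy, meanEnergy, meanEnergy]
    congr 1
    rw [← mp.map_eq, integral_map mp.aemeasurable
      (by rw [mp.map_eq]; exact (S.integrable_freeEnergy _).1)]
  rw [hI]
  refine (norm_integral_le_of_norm_le i₃ hbound).trans ?_
  have hI₃ : ∫ p, B (fun i => (p.2 i).1) ∂(law νh νJ fun _ : Fin (m + 1) => lazyEdge K n 1)
      = ∫ o, B o ∂(Measure.pi fun _ => lazyEdge K n 1) := by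
    rw [← mpe.map_eq, integral_map mpe.aemeasurable Measurable.of_discrete.aestronglyMeasurable]
  rw [hI₃, integral_edges_eq hn B 0]
  have hle : ∀ o, edgeAverage (fun a => B (Function.update o 0 (some a)))
      ≤ 2 * logRatio r R * (K * (m + 1) / n + 2) := by
    intro o
    have h1 : ∀ a, B (Function.update o 0 (some a))
        = (fun u => 2 * logRatio r R * (cavityDegree o 0 u + 2)) (a ⟨0, hK⟩) := by
      intro a; simp [hB, cavityDegree]
    simp only [h1]
    rw [edgeAverage_coord hn (fun u => 2 * logRatio r R * ((cavityDegree o 0 u : ℝ) + 2)),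
      ← Finset.mul_sum, mul_div_assoc]
    refine mul_le_mul_of_nonneg_left ?_ (by positivity)
    rw [Finset.sum_add_distrib, add_div]
    have h2 := sum_degree_le (Function.update o 0 none)
    rw [Fintype.card_fin] at h2
    have h3 : ∑ u, (cavityDegree o 0 u : ℝ) ≤ K * (m + 1) := by exact_mod_cast h2
    have h4 : (∑ _u : Fin n, (2 : ℝ)) / n = 2 := by simp; field_simp
    rw [h4]
    gcongr
  calc _ ≤ ∫ _o : Fin (m + 1) → Option (Fin K → Fin n), 2 * logRatio r R * (K * (m + 1) / n + 2)
        ∂(Measure.pi fun _ => lazyEdge K n 1) :=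
        integral_mono_ae Integrable.of_finite (integrable_const _) (Eventually.of_forall hle)
    _ = _ := by simp

theorem SoftModel.abs_uniformEnergy_sub_le (hK : 1 ≤ K) (S : SoftModel νh νJ h J κ r R Ω)
    (hn : 0 < n) {m m' : ℕ} (hm : m ≤ m') :
    |uniformEnergy νh νJ h J n m' - uniformEnergy νh νJ h J n m|
      ≤ (m' - m) * (2 * logRatio r R * (K * m' / n + 2)) := by
  have hC := logRatio_nonneg S.r_le S.le_R
  induction m', hm using Nat.le_induction with
  | base => simp
  | succ m' hm ih =>
    have h1 := S.abs_uniformEnergy_succ_sub_le hK hn m'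
    have h2 := abs_sub_le (uniformEnergy νh νJ h J n (m' + 1)) (uniformEnergy νh νJ h J n m')
      (uniformEnergy νh νJ h J n m)
    have hmm : (m : ℝ) ≤ m' := by exact_mod_cast hm
    have h3 : ((m' : ℝ) - m) * (2 * logRatio r R * (K * m' / n + 2))
        ≤ (m' - m) * (2 * logRatio r R * (K * (m' + 1) / n + 2)) := by
      refine mul_le_mul_of_nonneg_left ?_ (by linarith)
      gcongr
      linarith
    push_cast
    linarith

/-- The number of present edges is binomial with parameters `numEdges c N` and `n / N`, hence
fluctuates by `O(√n)` around `c * n`, uniformly in `N`. The Lipschitz bound converts this into an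
energy difference. -/
theorem SoftModel.abs_meanEnergy_lazy_sub_le (hK : 1 ≤ K) (S : SoftModel νh νJ h J κ r R Ω)
    {c : ℝ} (hc : 0 < c) :
    ∃ C : ℝ, 0 ≤ C ∧ ∀ n N : ℕ, 0 < n → n ≤ N →
      |meanEnergy νh νJ h J (fun _ : Fin (numEdges c N) => lazyEdge K n ((N : ℝ)⁻¹ * n))
        - uniformEnergy νh νJ h J n (numEdges c n)| ≤ C * √n := by
  set D := 2 * logRatio r R with hD
  have hD0 : 0 ≤ D := mul_nonneg zero_le_two (logRatio_nonneg S.r_le S.le_R)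
  refine ⟨D * (2 + K * c) * (c + 2) + D * K * (c + 1), by positivity, fun n N hn hnN => ?_⟩
  have hn0 : (0 : ℝ) < n := by exact_mod_cast hn
  have hN0 : (0 : ℝ) < N := hn0.trans_le (by exact_mod_cast hnN)
  have hnN' : (n : ℝ) ≤ N := by exact_mod_cast hnN
  set p : ℝ := (N : ℝ)⁻¹ * n with hp
  have hp0 : 0 ≤ p := by positivity
  have hp1 : p ≤ 1 := by rw [hp, inv_mul_le_iff₀ hN0]; linarith
  have := isProbabilityMeasure_bit hp0 hp1
  set M := numEdges c N with hM
  set m₀ := numEdges c n with hm₀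
  have hm₀le : (m₀ : ℝ) ≤ c * n := Nat.floor_le (by positivity)
  have hm₀ge : c * n < m₀ + 1 := Nat.lt_floor_add_one _
  have hMle : (M : ℝ) ≤ c * N := Nat.floor_le (by positivity)
  have hMge : c * N < M + 1 := Nat.lt_floor_add_one _
  have hMp : (M : ℝ) * p ≤ c * n := by
    calc (M : ℝ) * p ≤ c * N * p := by gcongr
      _ = c * n := by rw [hp]; field_simp
  have hMp' : c * n - 1 ≤ M * p := by
    have : c * N * p ≤ (M + 1) * p := by gcongr
    have e : c * N * p = c * n := by rw [hp]; field_simp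
    nlinarith
  set P : Measure (Fin M → Bool) := Measure.pi fun _ => bit p
  set cnt : (Fin M → Bool) → ℕ := fun b => (Finset.univ.filter fun i => b i = true).card
  set U := uniformEnergy νh νJ h J n
  -- The bound is `M * p + (M * p - m₀) ^ 2`; both `M * p` and `m₀` lie between `c * n - 1` and `c *
  -- n`, so the squared bias is at most `1 ≤ n`.
  have hvar : ∫ b, ((cnt b : ℝ) - m₀) ^ 2 ∂P ≤ (c + 1) * n := by
    have h1 := integral_sum_sub_sq_le (ι := Fin M) (bit p)
      (f := fun b => if b = true then (1 : ℝ) else 0)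
      (MemLp.of_discrete) m₀
    rw [integral_bit hp0 hp1, integral_bit hp0 hp1] at h1
    have h2 : ∀ b : Fin M → Bool, ∑ i, (if b i = true then (1 : ℝ) else 0) = cnt b := by
      intro b; simp [cnt]
    simp only [h2, Fintype.card_fin] at h1
    refine h1.trans ?_
    have hn1 : (1 : ℝ) ≤ n := by exact_mod_cast hn
    simp
    nlinarith
  have hs : 1 ≤ √(n : ℝ) := by
    rw [Real.one_le_sqrt]; exact_mod_cast hn
  have hss : √(n : ℝ) * √n = n := Real.mul_self_sqrt hn0.le
  have hpt : ∀ b, |U (cnt b) - U m₀|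
      ≤ D * (2 + K * c) * ((√n + ((cnt b : ℝ) - m₀) ^ 2 / √n) / 2)
        + D * K * (((cnt b : ℝ) - m₀) ^ 2 / n) := by
    intro b
    set δ := |(cnt b : ℝ) - m₀| with hδ
    have hδ2 : ((cnt b : ℝ) - m₀) ^ 2 = δ ^ 2 := (sq_abs _).symm
    have hδ0 : 0 ≤ δ := abs_nonneg _
    have h1 : |U (cnt b) - U m₀| ≤ δ * (D * (K * (m₀ + δ) / n + 2)) := by
      rcases le_total (cnt b) m₀ with hle | hle
      · have h3 := S.abs_uniformEnergy_sub_le hK hn hle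
        have h4 : δ = m₀ - cnt b := by
          rw [hδ, abs_sub_comm, abs_of_nonneg (sub_nonneg.2 (by exact_mod_cast hle))]
        rw [abs_sub_comm, h4]
        refine h3.trans ?_
        rw [← h4]
        gcongr
        linarith
      · have h3 := S.abs_uniformEnergy_sub_le hK hn hle
        have h4 : δ = cnt b - m₀ := by
          rw [hδ, abs_of_nonneg (sub_nonneg.2 (by exact_mod_cast hle))]
        refine h3.trans ?_
        rw [← h4]
        gcongr
        linarith
    -- AM–GM at the scale `√n` reduces the first moment of the deviation to the second.
    have h2 : δ ≤ (√n + δ ^ 2 / √n) / 2 := by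
      have : 0 ≤ (√(n : ℝ) - δ) ^ 2 / √n := by positivity
      have e : (√(n : ℝ) - δ) ^ 2 / √n = √n - 2 * δ + δ ^ 2 / √n := by
        field_simp; ring
      linarith
    have h5 : δ * (D * (K * (m₀ + δ) / n + 2))
        = D * (2 + K * (m₀ / n)) * δ + D * K * (δ ^ 2 / n) := by
      field_simp; ring
    have h6 : (m₀ : ℝ) / n ≤ c := by rw [div_le_iff₀ hn0]; exact hm₀le
    rw [hδ2]
    refine h1.trans (h5.le.trans ?_)
    gcongr
  rw [S.meanEnergy_lazy hn hp0 hp1]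
  have e1 : ∫ b, U (cnt b) ∂P - U m₀ = ∫ b, (U (cnt b) - U m₀) ∂P := by
    rw [integral_sub Integrable.of_finite (integrable_const _)]; simp
  change |∫ b, U (cnt b) ∂P - U m₀| ≤ _
  rw [e1]
  refine (norm_integral_le_of_norm_le (f := fun b => U (cnt b) - U m₀)
    (g := fun b => D * (2 + K * c) *
    ((√n + ((cnt b : ℝ) - m₀) ^ 2 / √n) / 2) + D * K * (((cnt b : ℝ) - m₀) ^ 2 / n))
    Integrable.of_finite (Eventually.of_forall hpt)).trans ?_
  rw [integral_add Integrable.of_finite Integrable.of_finite, integral_const_mul,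
    integral_const_mul, integral_div, integral_div, integral_add (integrable_const _)
      Integrable.of_finite, integral_div]
  simp only [integral_const, probReal_univ, smul_eq_mul, one_mul]
  set V := ∫ b, ((cnt b : ℝ) - m₀) ^ 2 ∂P
  have hV1 : V / √n ≤ (c + 1) * √n := by
    rw [div_le_iff₀ (by positivity), mul_assoc, hss]; exact hvar
  have hV2 : V / n ≤ (c + 1) := by rw [div_le_iff₀ hn0]; exact hvar
  calc D * (2 + K * c) * ((√n + V / √n) / 2) + D * K * (V / n)
      ≤ D * (2 + K * c) * ((√n + (c + 1) * √n) / 2) + D * K * (c + 1) := by gcongr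
    _ ≤ D * (2 + K * c) * ((c + 2) * √n) + D * K * (c + 1) * √n := by
        have : D * K * (c + 1) * 1 ≤ D * K * (c + 1) * √n := by gcongr
        have h7 : (√(n : ℝ) + (c + 1) * √n) / 2 ≤ (c + 2) * √n := by nlinarith
        have h8 := mul_le_mul_of_nonneg_left h7 (show 0 ≤ D * (2 + K * c) by positivity)
        linarith
    _ = _ := by ring

end Compare

/-! ### From mean square differences to deviation probabilities -/

/-- Jensen in `y`, in the form that the variance of `y ↦ f x - f y` is nonnegative. -/
theorem ofReal_sq_sub_integral_le {α : Type*} [MeasurableSpace α] {P : Measure α}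
    [IsProbabilityMeasure P] {f : α → ℝ} (hf : MemLp f 2 P) (x : α) :
    ENNReal.ofReal ((f x - ∫ y, f y ∂P) ^ 2) ≤ ∫⁻ y, ENNReal.ofReal ((f x - f y) ^ 2) ∂P := by
  have hX : MemLp (fun y => f x - f y) 2 P := (memLp_const _).sub hf
  rw [← ofReal_integral_eq_lintegral_ofReal hX.integrable_sq
    (Eventually.of_forall fun y => sq_nonneg _)]
  refine ENNReal.ofReal_le_ofReal ?_
  have h1 := variance_eq_sub hX
  have h2 := variance_nonneg (fun y => f x - f y) P
  have h3 : ∫ y, (f x - f y) ∂P = f x - ∫ y, f y ∂P := by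
    rw [integral_sub (integrable_const _) (hf.integrable one_le_two)]; simp
  rw [h3] at h1
  have h4 : ∫ y, (f x - f y) ^ 2 ∂P = ∫ y, ((fun y => f x - f y) ^ 2 : α → ℝ) y ∂P := rfl
  rw [h4]
  linarith

theorem measure_deviation_le {α : Type*} [MeasurableSpace α] {P : Measure α}
    [IsProbabilityMeasure P] {f : α → ℝ} (hf : MemLp f 2 P) {B t : ℝ} (ht : 0 < t)
    (hB : meanSqDiff P f ≤ ENNReal.ofReal B) :
    P {x | t ≤ |f x - ∫ y, f y ∂P|} ≤ ENNReal.ofReal (B / t ^ 2) := by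
  have h1 : ∫⁻ x, ENNReal.ofReal ((f x - ∫ y, f y ∂P) ^ 2) ∂P ≤ ENNReal.ofReal B :=
    (lintegral_mono fun x => ofReal_sq_sub_integral_le hf x).trans hB
  have h2 := mul_meas_ge_le_lintegral₀ (μ := P)
    (f := fun x => ENNReal.ofReal ((f x - ∫ y, f y ∂P) ^ 2))
    (((hf.1.aemeasurable.sub_const _).pow_const 2).ennreal_ofReal) (ENNReal.ofReal (t ^ 2))
  have h3 : {x | t ≤ |f x - ∫ y, f y ∂P|}
      ⊆ {x | ENNReal.ofReal (t ^ 2) ≤ ENNReal.ofReal ((f x - ∫ y, f y ∂P) ^ 2)} := by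
    intro x hx
    refine ENNReal.ofReal_le_ofReal ?_
    rw [← sq_abs (f x - _)]
    exact pow_le_pow_left₀ ht.le hx 2
  have ht2 : 0 < t ^ 2 := by positivity
  rw [ENNReal.ofReal_div_of_pos ht2, ENNReal.le_div_iff_mul_le
    (Or.inl (ENNReal.ofReal_pos.2 ht2).ne') (Or.inl ENNReal.ofReal_ne_top), mul_comm]
  exact (mul_le_mul_right (measure_mono h3) _).trans (h2.trans h1)

/-! ### The variance of the free energy is linear in the number of nodes -/

section Variance

variable {K : ℕ} {Sh SJ : Type*} [MeasurableSpace Sh] [MeasurableSpace SJ]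
  {νh : Measure Sh} [IsProbabilityMeasure νh] {νJ : Measure SJ} [IsProbabilityMeasure νJ]
  {h : Sh → ℝ → ℝ≥0} {J : SJ → (Fin K → ℝ) → ℝ≥0} {κ : ℝ} {r R : ℝ≥0} {Ω : Set ℝ}
  {n m : ℕ} {I : Type*} [Fintype I] [DecidableEq I]

/-- The sum over the nodes of the second moments of the degrees. -/
def degreeMoment (K n m : ℕ) : ℝ :=
  ∫ o, ∑ u, ((degree o u : ℝ) + 2) ^ 2 ∂(Measure.pi fun _ : Fin m => lazyEdge K n 1)

theorem degreeMoment_le (hn : 0 < n) {c : ℝ} (hc : 0 ≤ c) (hm : (m : ℝ) ≤ c * n) :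
    degreeMoment K n m ≤ n * (K * c + (K * c + 2) ^ 2) := by
  have hP := isProbabilityMeasure_lazyEdge (K := K) hn zero_le_one le_rfl
  have hn0 : (0 : ℝ) < n := by exact_mod_cast hn
  rw [degreeMoment, integral_finsetSum _ fun u _ => Integrable.of_finite]
  have key : ∀ u : Fin n, ∫ o, ((degree o u : ℝ) + 2) ^ 2
      ∂(Measure.pi fun _ : Fin m => lazyEdge K n 1) ≤ K * c + (K * c + 2) ^ 2 := by
    intro u
    -- The degree of `u` is a sum of i.i.d. indicators; centring at `-2` yields the second moment of
    -- `degree + 2`.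
    have h1 := integral_sum_sub_sq_le (ι := Fin m) (lazyEdge K n 1)
      (f := fun o => if u ∈ edgeNodes o then (1 : ℝ) else 0) MemLp.of_discrete (-2)
    have h2 : ∀ o : Fin m → Option (Fin K → Fin n),
        ∑ i, (if u ∈ edgeNodes (o i) then (1 : ℝ) else 0) = degree o u := by
      intro o; simp [degree]
    have h3 : ∀ o : Option (Fin K → Fin n),
        (if u ∈ edgeNodes o then (1 : ℝ) else 0) ^ 2 = if u ∈ edgeNodes o then 1 else 0 := by
      intro o; split_ifs <;> simp
    simp only [h2, h3, Fintype.card_fin, sub_neg_eq_add] at h1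
    set q := ∫ o, (if u ∈ edgeNodes o then (1 : ℝ) else 0) ∂(lazyEdge K n 1) with hq
    have hq0 : 0 ≤ q := integral_nonneg fun o => by dsimp only; split_ifs <;> norm_num
    -- Union bound over the `K` positions of the edge.
    have hqK : q ≤ K / n := by
      rw [hq, integral_lazyEdge zero_le_one le_rfl, sub_self, zero_mul, zero_add, one_mul]
      have h4 : ∀ a : Fin K → Fin n, (if u ∈ edgeNodes (some a) then (1 : ℝ) else 0)
          ≤ ∑ k, if a k = u then 1 else 0 := by
        intro a
        split_ifs with ha
        · obtain ⟨k, _, hk⟩ := Finset.mem_image.1 ha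
          have := Finset.single_le_sum (f := fun k => if a k = u then (1 : ℝ) else 0)
            (fun k _ => by split_ifs <;> norm_num) (Finset.mem_univ k)
          simpa [hk] using this
        · exact Finset.sum_nonneg fun k _ => by split_ifs <;> norm_num
      have h5 : ∀ k : Fin K, (∑ a : Fin K → Fin n, if a k = u then (1 : ℝ) else 0) / (n : ℝ) ^ K
          = 1 / n := by
        intro k
        have := edgeAverage_coord hn (fun v => if v = u then (1 : ℝ) else 0) k
        simpa [edgeAverage] using this
      calc edgeAverage (fun a : Fin K → Fin n => if u ∈ edgeNodes (some a) then (1 : ℝ) else 0)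
          ≤ (∑ a : Fin K → Fin n, ∑ k, if a k = u then (1 : ℝ) else 0) / (n : ℝ) ^ K := by
            rw [edgeAverage]
            gcongr with a
            exact h4 a
        _ = K / n := by
            rw [Finset.sum_comm, Finset.sum_div, Finset.sum_congr rfl fun k _ => h5 k]
            simp; ring
    have hmq : m * q ≤ K * c := by
      calc m * q ≤ c * n * (K / n) := by gcongr
        _ = K * c := by field_simp
    have hmq0 : 0 ≤ m * q := by positivity
    refine h1.trans ?_
    gcongr
  calc _ ≤ ∑ _u : Fin n, ((K : ℝ) * c + (K * c + 2) ^ 2) := Finset.sum_le_sum fun u _ => key u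
    _ = _ := by simp; ring

theorem cavityDegree_le (o : I → Option (Fin K → Fin n)) (i : I) (u : Fin n) :
    cavityDegree o i u ≤ degree o u := by
  refine Finset.card_le_card fun j hj => ?_
  simp only [Finset.mem_filter, Finset.mem_univ, true_and] at hj ⊢
  by_cases hji : j = i
  · subst hji; simp [edgeNodes] at hj
  · simpa [hji] using hj

/-- Old and new realization are both compared with the one where `i` is absent, using `(x - y)² ≤ 2
(x - z)² + 2 (y - z)²`. Cavity degrees do not depend on the edge `i`, so its endpoint averages them
over all nodes: hence `degreeMoment / n`. The function `g` is a measurable version of the free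
energy, as Efron–Stein requires. -/
theorem freeEnergy_resample_edge_le (hK : 1 ≤ K) (S : SoftModel νh νJ h J κ r R Ω) (hn : 0 < n)
    {g : (Fin n → Sh) × (Fin m → Mark K n SJ) → ℝ}
    (hg : g =ᵐ[law νh νJ fun _ => lazyEdge K n 1] freeEnergy h J) (i : Fin m) :
    ∫⁻ q, ENNReal.ofReal ((g (q.1, q.2.1) - g (q.1, Function.update q.2.1 i q.2.2)) ^ 2)
      ∂((Measure.pi fun _ : Fin n => νh).prod
        ((Measure.pi fun _ : Fin m => (lazyEdge K n 1).prod νJ).prod ((lazyEdge K n 1).prod νJ)))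
      ≤ ENNReal.ofReal (4 * (2 * logRatio r R) ^ 2 * (degreeMoment K n m / n)) := by
  have hP := isProbabilityMeasure_lazyEdge (K := K) hn zero_le_one le_rfl
  have hn0 : (0 : ℝ) < n := by exact_mod_cast hn
  set D := 2 * logRatio r R with hD
  have hD0 : 0 ≤ D := mul_nonneg zero_le_two (logRatio_nonneg S.r_le S.le_R)
  set Q := (Measure.pi fun _ : Fin n => νh).prod
    ((Measure.pi fun _ : Fin m => (lazyEdge K n 1).prod νJ).prod ((lazyEdge K n 1).prod νJ)) with hQ
  set H : (Fin m → Option (Fin K → Fin n)) → ℝ := fun o =>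
    (o i).elim 0 fun a => ((cavityDegree o i (a ⟨0, hK⟩) : ℝ) + 2) ^ 2 with hH
  have mp₁ : MeasurePreserving (fun q : (Fin n → Sh) × ((Fin m → Mark K n SJ) × Mark K n SJ) =>
      (q.1, q.2.1)) Q (law νh νJ fun _ => lazyEdge K n 1) :=
    (MeasurePreserving.id _).prod measurePreserving_fst
  have mp₂ : MeasurePreserving (fun q : (Fin n → Sh) × ((Fin m → Mark K n SJ) × Mark K n SJ) =>
      (q.1, Function.update q.2.1 i q.2.2)) Q (law νh νJ fun _ => lazyEdge K n 1) :=
    (MeasurePreserving.id _).prod (measurePreserving_update_self ((lazyEdge K n 1).prod νJ) i)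
  have mpe := measurePreserving_edges (I := Fin m) (νh := νh) (νJ := νJ) (lazyEdge K n 1)
  have m₁ := mpe.comp mp₁
  have m₂ := mpe.comp mp₂
  have i₁ : Integrable (fun q : (Fin n → Sh) × ((Fin m → Mark K n SJ) × Mark K n SJ) =>
      H fun j => (q.2.1 j).1) Q :=
    m₁.integrable_comp_of_integrable (g := H) Integrable.of_finite
  have i₂ : Integrable (fun q : (Fin n → Sh) × ((Fin m → Mark K n SJ) × Mark K n SJ) =>
      H fun j => (Function.update q.2.1 i q.2.2 j).1) Q :=
    m₂.integrable_comp_of_integrable (g := H) Integrable.of_finite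
  have hbound : ∀ᵐ q ∂Q,
      ENNReal.ofReal ((g (q.1, q.2.1) - g (q.1, Function.update q.2.1 i q.2.2)) ^ 2)
      ≤ ENNReal.ofReal (2 * D ^ 2 * (H (fun j => (q.2.1 j).1)
          + H fun j => (Function.update q.2.1 i q.2.2 j).1)) := by
    filter_upwards [mp₁.quasiMeasurePreserving.ae hg, mp₂.quasiMeasurePreserving.ae hg,
      mp₁.quasiMeasurePreserving.ae (S.ae_isSoft _), mp₂.quasiMeasurePreserving.ae (S.ae_isSoft _),
      mp₁.quasiMeasurePreserving.ae (ae_edges_some hn),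
      mp₂.quasiMeasurePreserving.ae (ae_edges_some hn)] with q g₁ g₂ s₁ s₂ o₁ o₂
    obtain ⟨a, ha⟩ := o₁ i
    obtain ⟨a', ha'⟩ := o₂ i
    have e₁ := s₁.abs_freeEnergy_sub_erase_le S i ha ⟨0, hK⟩ (q.2.1 i).2
    have e₂ := s₂.abs_freeEnergy_sub_erase_le S i ha' ⟨0, hK⟩ (q.2.1 i).2
    rw [g₁, g₂]
    simp only [Function.update_idem] at e₂
    simp only [Function.update_self] at ha'
    refine ENNReal.ofReal_le_ofReal ?_
    simp only [hH, Function.update_self, ha, ha', Option.elim]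
    set x := freeEnergy h J (q.1, q.2.1)
    set y := freeEnergy h J (q.1, Function.update q.2.1 i q.2.2)
    set z := freeEnergy h J (q.1, Function.update q.2.1 i (none, (q.2.1 i).2))
    set d₁ : ℝ := (cavityDegree (fun j => (q.2.1 j).1) i (a ⟨0, hK⟩) : ℝ) + 2
    set d₂ : ℝ :=
      (cavityDegree (fun j => (Function.update q.2.1 i q.2.2 j).1) i (a' ⟨0, hK⟩) : ℝ) + 2
    have f₁ : (x - z) ^ 2 ≤ (D * d₁) ^ 2 := by rw [← sq_abs (x - z)]; gcongr
    have f₂ : (y - z) ^ 2 ≤ (D * d₂) ^ 2 := by rw [← sq_abs (y - z)]; gcongr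
    nlinarith [sq_nonneg ((x - z) + (y - z))]
  have hHi : ∫ o, H o ∂(Measure.pi fun _ => lazyEdge K n 1) ≤ degreeMoment K n m / n := by
    rw [integral_edges_eq hn H i, degreeMoment, ← integral_div]
    refine integral_mono_ae Integrable.of_finite Integrable.of_finite
      (Eventually.of_forall fun o => ?_)
    have h1 : ∀ a, H (Function.update o i (some a))
        = (fun u => ((cavityDegree o i u : ℝ) + 2) ^ 2) (a ⟨0, hK⟩) := by
      intro a; simp [hH, cavityDegree]
    simp only [h1]
    rw [edgeAverage_coord hn (fun u => ((cavityDegree o i u : ℝ) + 2) ^ 2)]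
    gcongr with u
    exact_mod_cast cavityDegree_le o i u
  have hH0 : ∀ o, 0 ≤ H o := by
    intro o
    simp only [hH]
    cases o i <;> simp [Option.elim] ; positivity
  refine (lintegral_mono_ae hbound).trans ?_
  have i₃ : Integrable (fun q : (Fin n → Sh) × ((Fin m → Mark K n SJ) × Mark K n SJ) =>
      2 * D ^ 2 * (H (fun j => (q.2.1 j).1) + H fun j => (Function.update q.2.1 i q.2.2 j).1)) Q :=
    (i₁.add i₂).const_mul _
  rw [← ofReal_integral_eq_lintegral_ofReal i₃
    (Eventually.of_forall fun q => mul_nonneg (by positivity) (add_nonneg (hH0 fun j => (q.2.1 j).1)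
      (hH0 fun j => (Function.update q.2.1 i q.2.2 j).1)))]
  refine ENNReal.ofReal_le_ofReal ?_
  have j₁ : ∫ q, H (fun j => (q.2.1 j).1) ∂Q = ∫ o, H o ∂(Measure.pi fun _ => lazyEdge K n 1) := by
    rw [← m₁.map_eq, integral_map m₁.aemeasurable Measurable.of_discrete.aestronglyMeasurable]
    rfl
  have j₂ : ∫ q, H (fun j => (Function.update q.2.1 i q.2.2 j).1) ∂Q
      = ∫ o, H o ∂(Measure.pi fun _ => lazyEdge K n 1) := by
    rw [← m₂.map_eq, integral_map m₂.aemeasurable Measurable.of_discrete.aestronglyMeasurable]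
    rfl
  have j₃ : ∫ q, 2 * D ^ 2 * (H (fun j => (q.2.1 j).1)
        + H fun j => (Function.update q.2.1 i q.2.2 j).1) ∂Q
      = 2 * D ^ 2 * (∫ o, H o ∂(Measure.pi fun _ => lazyEdge K n 1)
        + ∫ o, H o ∂(Measure.pi fun _ => lazyEdge K n 1)) := by
    rw [integral_const_mul, integral_add i₁ i₂, j₁, j₂]
  refine j₃.trans_le ?_
  calc _ ≤ 2 * D ^ 2 * (degreeMoment K n m / n + degreeMoment K n m / n) := by gcongr
    _ = _ := by ring

theorem freeEnergy_resample_node_le (S : SoftModel νh νJ h J κ r R Ω) (hn : 0 < n)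
    {g : (Fin n → Sh) × (Fin m → Mark K n SJ) → ℝ}
    (hg : g =ᵐ[law νh νJ fun _ => lazyEdge K n 1] freeEnergy h J) (v : Fin n) :
    ∫⁻ q, ENNReal.ofReal ((g (q.1.1, q.2) - g (Function.update q.1.1 v q.1.2, q.2)) ^ 2)
      ∂(((Measure.pi fun _ : Fin n => νh).prod νh).prod
        (Measure.pi fun _ : Fin m => (lazyEdge K n 1).prod νJ))
      ≤ ENNReal.ofReal ((2 * logRatio r R) ^ 2 *
        ∫ o, ((degree o v : ℝ) + 2) ^ 2 ∂(Measure.pi fun _ : Fin m => lazyEdge K n 1)) := by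
  have hP := isProbabilityMeasure_lazyEdge (K := K) hn zero_le_one le_rfl
  set D := 2 * logRatio r R with hD
  have hD0 : 0 ≤ D := mul_nonneg zero_le_two (logRatio_nonneg S.r_le S.le_R)
  set Q := ((Measure.pi fun _ : Fin n => νh).prod νh).prod
    (Measure.pi fun _ : Fin m => (lazyEdge K n 1).prod νJ) with hQ
  set H : (Fin m → Option (Fin K → Fin n)) → ℝ := fun o => ((degree o v : ℝ) + 2) ^ 2 with hH
  have mp₁ : MeasurePreserving (fun q : ((Fin n → Sh) × Sh) × (Fin m → Mark K n SJ) =>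
      (q.1.1, q.2)) Q (law νh νJ fun _ => lazyEdge K n 1) :=
    measurePreserving_fst.prod (MeasurePreserving.id _)
  have mp₂ : MeasurePreserving (fun q : ((Fin n → Sh) × Sh) × (Fin m → Mark K n SJ) =>
      (Function.update q.1.1 v q.1.2, q.2)) Q (law νh νJ fun _ => lazyEdge K n 1) :=
    (measurePreserving_update_self νh v).prod (MeasurePreserving.id _)
  have mpe := measurePreserving_edges (I := Fin m) (νh := νh) (νJ := νJ) (lazyEdge K n 1)
  have m₁ := mpe.comp mp₁
  have i₁ : Integrable (fun q : ((Fin n → Sh) × Sh) × (Fin m → Mark K n SJ) =>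
      H fun j => (q.2 j).1) Q :=
    m₁.integrable_comp_of_integrable (g := H) Integrable.of_finite
  have hbound : ∀ᵐ q ∂Q,
      ENNReal.ofReal ((g (q.1.1, q.2) - g (Function.update q.1.1 v q.1.2, q.2)) ^ 2)
      ≤ ENNReal.ofReal (D ^ 2 * H (fun j => (q.2 j).1)) := by
    filter_upwards [mp₁.quasiMeasurePreserving.ae hg, mp₂.quasiMeasurePreserving.ae hg,
      mp₁.quasiMeasurePreserving.ae (S.ae_isSoft _),
      mp₂.quasiMeasurePreserving.ae (S.ae_isSoft _)] with q g₁ g₂ s₁ s₂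
    rw [g₁, g₂]
    refine ENNReal.ofReal_le_ofReal ?_
    have e : |freeEnergy h J (q.1.1, q.2) - freeEnergy h J (Function.update q.1.1 v q.1.2, q.2)|
        ≤ D * ((degree (fun j => (q.2 j).1) v : ℝ) + 1) := by
      cases n with
      | zero => exact v.elim0
      | succ n =>
        exact abs_logPartition_sub_node S.core S.r_pos S.r_le S.le_R s₁.1 s₂.1 s₁.2 v
          fun w hw => by simp [hw]
    -- Weakened to `+ 2` so that the same degree moment bounds nodes and edges.
    have e' : D * ((degree (fun j => (q.2 j).1) v : ℝ) + 1)
        ≤ D * ((degree (fun j => (q.2 j).1) v : ℝ) + 2) := by gcongr; norm_num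
    rw [← sq_abs, hH, ← mul_pow]
    exact pow_le_pow_left₀ (abs_nonneg _) (e.trans e') 2
  refine (lintegral_mono_ae hbound).trans ?_
  rw [← ofReal_integral_eq_lintegral_ofReal (i₁.const_mul _)
    (Eventually.of_forall fun q => mul_nonneg (by positivity) (sq_nonneg _))]
  refine ENNReal.ofReal_le_ofReal ?_
  have j : ∫ q, H (fun j => (q.2 j).1) ∂Q = ∫ o, H o ∂(Measure.pi fun _ => lazyEdge K n 1) := by
    rw [← m₁.map_eq, integral_map m₁.aemeasurable Measurable.of_discrete.aestronglyMeasurable]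
    rfl
  rw [integral_const_mul, j]

/-- Efron–Stein for nodes and edges separately. With `A` the degree moment and `D = 2 * logRatio r
R`, the `m` edges contribute `4 D² A / n` each and the nodes `D² A` altogether. -/
theorem SoftModel.meanSqDiff_le (hK : 1 ≤ K) (S : SoftModel νh νJ h J κ r R Ω) (hn : 0 < n)
    {g : (Fin n → Sh) × (Fin m → Mark K n SJ) → ℝ} (hgm : Measurable g)
    (hg : g =ᵐ[law νh νJ fun _ => lazyEdge K n 1] freeEnergy h J) :
    meanSqDiff (law νh νJ fun _ : Fin m => lazyEdge K n 1) g
      ≤ ENNReal.ofReal ((2 * logRatio r R) ^ 2 * (4 * (m / n) + 1) * degreeMoment K n m) := by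
  have hP := isProbabilityMeasure_lazyEdge (K := K) hn zero_le_one le_rfl
  set D := 2 * logRatio r R with hD
  have hA0 : 0 ≤ degreeMoment K n m := integral_nonneg fun o =>
    Finset.sum_nonneg fun u _ => sq_nonneg _
  have hu₁ : ∀ i : Fin m, Measurable fun q : (Fin n → Sh) × ((Fin m → Mark K n SJ) × Mark K n SJ) =>
      ENNReal.ofReal ((g (q.1, q.2.1) - g (q.1, Function.update q.2.1 i q.2.2)) ^ 2) := by
    intro i
    have : Measurable fun q : (Fin n → Sh) × ((Fin m → Mark K n SJ) × Mark K n SJ) =>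
        Function.update q.2.1 i q.2.2 :=
      (measurePreserving_update_self ((lazyEdge K n 1).prod νJ) i).measurable.comp measurable_snd
    have h2 := hgm.comp (measurable_fst.prodMk this)
    have h3 : Measurable fun q : (Fin n → Sh) × ((Fin m → Mark K n SJ) × Mark K n SJ) =>
      g (q.1, q.2.1) := by fun_prop
    exact ((h3.sub h2).pow_const 2).ennreal_ofReal
  have hu₂ : ∀ v : Fin n, Measurable fun q : ((Fin n → Sh) × Sh) × (Fin m → Mark K n SJ) =>
      ENNReal.ofReal ((g (q.1.1, q.2) - g (Function.update q.1.1 v q.1.2, q.2)) ^ 2) := by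
    intro v
    have : Measurable fun q : ((Fin n → Sh) × Sh) × (Fin m → Mark K n SJ) =>
        Function.update q.1.1 v q.1.2 :=
      (measurePreserving_update_self νh v).measurable.comp measurable_fst
    have h2 := hgm.comp (this.prodMk measurable_snd)
    have h3 : Measurable fun q : ((Fin n → Sh) × Sh) × (Fin m → Mark K n SJ) =>
      g (q.1.1, q.2) := by fun_prop
    exact ((h3.sub h2).pow_const 2).ennreal_ofReal
  have e₁ : ∫⁻ s, meanSqDiff (Measure.pi fun _ : Fin m => (lazyEdge K n 1).prod νJ)
      (fun e => g (s, e)) ∂(Measure.pi fun _ : Fin n => νh)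
      ≤ ∑ _i : Fin m, ENNReal.ofReal (4 * D ^ 2 * (degreeMoment K n m / n)) := by
    calc _ ≤ ∫⁻ s, ∑ i, resampleSq ((lazyEdge K n 1).prod νJ) (fun e => g (s, e)) i
            ∂(Measure.pi fun _ : Fin n => νh) :=
          lintegral_mono fun s => meanSqDiff_pi_le _ (by fun_prop)
      _ = ∑ i, ∫⁻ s, resampleSq ((lazyEdge K n 1).prod νJ) (fun e => g (s, e)) i
            ∂(Measure.pi fun _ : Fin n => νh) :=
          lintegral_finsetSum _ fun i _ => (hu₁ i).lintegral_prod_right'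
      _ ≤ _ := by
          refine Finset.sum_le_sum fun i _ => ?_
          refine le_trans (le_of_eq ?_) (freeEnergy_resample_edge_le hK S hn hg i)
          rw [lintegral_prod _ (hu₁ i).aemeasurable]
          rfl
  have e₂ : ∫⁻ e, meanSqDiff (Measure.pi fun _ : Fin n => νh)
      (fun s => g (s, e)) ∂(Measure.pi fun _ : Fin m => (lazyEdge K n 1).prod νJ)
      ≤ ∑ v : Fin n, ENNReal.ofReal (D ^ 2 *
        ∫ o, ((degree o v : ℝ) + 2) ^ 2 ∂(Measure.pi fun _ : Fin m => lazyEdge K n 1)) := by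
    calc _ ≤ ∫⁻ e, ∑ v, resampleSq νh (fun s => g (s, e)) v
            ∂(Measure.pi fun _ : Fin m => (lazyEdge K n 1).prod νJ) :=
          lintegral_mono fun e => meanSqDiff_pi_le _ (by fun_prop)
      _ = ∑ v, ∫⁻ e, resampleSq νh (fun s => g (s, e)) v
            ∂(Measure.pi fun _ : Fin m => (lazyEdge K n 1).prod νJ) :=
          lintegral_finsetSum _ fun v _ => (hu₂ v).lintegral_prod_left'
      _ ≤ _ := by
          refine Finset.sum_le_sum fun v _ => ?_
          refine le_trans (le_of_eq ?_) (freeEnergy_resample_node_le S hn hg v)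
          rw [lintegral_prod_symm _ (hu₂ v).aemeasurable]
          rfl
  refine (meanSqDiff_prod_le _ _ hgm).trans ((add_le_add e₁ e₂).trans (le_of_eq ?_))
  rw [← ENNReal.ofReal_sum_of_nonneg fun _ _ => by positivity,
    ← ENNReal.ofReal_sum_of_nonneg fun v _ =>
      mul_nonneg (sq_nonneg _) (integral_nonneg fun o => sq_nonneg _),
    ← ENNReal.ofReal_add (Finset.sum_nonneg fun _ _ => by positivity)
      (Finset.sum_nonneg fun v _ =>
      mul_nonneg (sq_nonneg _) (integral_nonneg fun o => sq_nonneg _)),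
    ← Finset.mul_sum (f := fun v => ∫ o, ((degree o v : ℝ) + 2) ^ 2
      ∂(Measure.pi fun _ : Fin m => lazyEdge K n 1)),
    ← integral_finsetSum _ fun v _ => Integrable.of_finite]
  congr 1
  change _ + D ^ 2 * degreeMoment K n m = _
  simp
  ring

theorem SoftModel.exists_deviation_le (hK : 1 ≤ K) (S : SoftModel νh νJ h J κ r R Ω) {c : ℝ}
    (hc : 0 ≤ c) :
    ∃ C : ℝ, ∀ n m : ℕ, 0 < n → (m : ℝ) ≤ c * n → ∀ t : ℝ, 0 < t →
      law νh νJ (fun _ : Fin m => lazyEdge K n 1)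
        {p | t ≤ |freeEnergy h J p - uniformEnergy νh νJ h J n m|}
        ≤ ENNReal.ofReal (C * n / t ^ 2) := by
  refine ⟨(2 * logRatio r R) ^ 2 * (4 * c + 1) * (K * c + (K * c + 2) ^ 2),
    fun n m hn hm t ht => ?_⟩
  have hP := isProbabilityMeasure_lazyEdge (K := K) hn zero_le_one le_rfl
  have hn0 : (0 : ℝ) < n := by exact_mod_cast hn
  set P := law νh νJ (fun _ : Fin m => lazyEdge K n 1) with hPdef
  have hf := S.aemeasurable_freeEnergy fun _ : Fin m => lazyEdge K n 1
  set g := hf.mk _ with hgdef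
  have hg : g =ᵐ[P] freeEnergy h J := hf.ae_eq_mk.symm
  have hgL : MemLp g 2 P := by
    refine MemLp.of_bound hf.measurable_mk.aestronglyMeasurable
      (logRatio r R * (n + Fintype.card (Fin m))) ?_
    filter_upwards [hg, S.ae_isSoft fun _ : Fin m => lazyEdge K n 1] with p h1 h2
    rw [h1]
    exact h2.abs_freeEnergy_le S
  have hU : uniformEnergy νh νJ h J n m = ∫ p, g p ∂P := (integral_congr_ae hg).symm
  have hB : meanSqDiff P g ≤ ENNReal.ofReal
      ((2 * logRatio r R) ^ 2 * (4 * c + 1) * (K * c + (K * c + 2) ^ 2) * n) := by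
    refine (S.meanSqDiff_le hK hn hf.measurable_mk hg).trans (ENNReal.ofReal_le_ofReal ?_)
    have h1 : (m : ℝ) / n ≤ c := by rw [div_le_iff₀ hn0]; exact hm
    have h2 := degreeMoment_le (K := K) hn hc hm
    have hA0 : 0 ≤ degreeMoment K n m := integral_nonneg fun o =>
      Finset.sum_nonneg fun u _ => sq_nonneg _
    calc _ ≤ (2 * logRatio r R) ^ 2 * (4 * c + 1) * (n * (K * c + (K * c + 2) ^ 2)) := by gcongr
      _ = _ := by ring
  have := measure_deviation_le hgL ht hB
  rw [← hU] at this
  refine le_trans (le_of_eq (measure_congr ?_)) this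
  filter_upwards [hg] with p hp
  change (t ≤ |freeEnergy h J p - _|) = (t ≤ |g p - _|)
  rw [hp]

end Variance

/-- A Fekete lemma for sequences that are superadditive up to an error `o(n)` per block. -/
theorem exists_tendsto_div_of_block_superadditive {U : ℕ → ℝ} {B C : ℝ} (hB : 0 ≤ B)
    (hb : ∀ n, 0 < n → |U n| ≤ B * n)
    (hs : ∀ n k r : ℕ, 0 < n → n ≤ r → r < 2 * n →
      k * (U n - C * √n) - B * r ≤ U (k * n + r)) (hC : 0 ≤ C) :
    ∃ z : ℝ, Tendsto (fun N : ℕ => U N / N) atTop (𝓝 z) := by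
  set a : ℕ → ℝ := fun N => U N / N with ha
  have hab : ∀ N, |a N| ≤ B := by
    intro N
    rcases Nat.eq_zero_or_pos N with rfl | hN
    · simpa [ha] using hB
    · have hN0 : (0 : ℝ) < N := by exact_mod_cast hN
      rw [ha, abs_div, Nat.abs_cast, div_le_iff₀ hN0]
      exact hb N hN
  have hbd₁ : IsBoundedUnder (· ≤ ·) atTop a := isBoundedUnder_of ⟨B, fun N => (abs_le.1 (hab N)).2⟩
  have hbd₂ : IsBoundedUnder (· ≥ ·) atTop a :=
    isBoundedUnder_of ⟨-B, fun N => (abs_le.1 (hab N)).1⟩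
  have key : ∀ n, 0 < n → ∀ N, 2 * n ≤ N → a n - C / √n - 4 * B * n / N ≤ a N := by
    intro n hn N hN
    have hn0 : (0 : ℝ) < n := by exact_mod_cast hn
    have hN0 : (0 : ℝ) < N := by exact_mod_cast (show 0 < N by omega)
    -- One full block is moved into the remainder, which is then nonempty, as superadditivity
    -- requires, and shorter than `2 * n`.
    set r := n + N % n with hr
    set k := N / n - 1 with hk
    have h1 := Nat.mod_lt N hn
    have h2 : 2 ≤ N / n := by rw [Nat.le_div_iff_mul_le hn]; exact hN
    have h3 : k * n + r = N := by
      have h4 := Nat.div_add_mod N n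
      have h5 : (k + 1) * n = n * (N / n) := by rw [mul_comm]; congr 1; omega
      rw [add_mul, one_mul] at h5
      omega
    have h4 := hs n k r hn (by omega) (by omega)
    rw [h3] at h4
    have h5 : (k : ℝ) * n = N - r := by rw [eq_sub_iff_add_eq]; exact_mod_cast h3
    have h6 : (r : ℝ) ≤ 2 * n := by exact_mod_cast (show r ≤ 2 * n by omega)
    have h7 : U n = n * a n := by rw [ha]; field_simp
    have h8 : C * √n = n * (C / √n) := by
      rw [mul_div_assoc', eq_div_iff (by positivity), mul_assoc, Real.mul_self_sqrt hn0.le]; ring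
    have h9 : (0 : ℝ) ≤ C / √n := by positivity
    have h10 : (r : ℝ) * a n ≤ r * B := by gcongr; exact (abs_le.1 (hab n)).2
    have h11 : (0 : ℝ) ≤ r * (C / √n) := by positivity
    have h12 : B * r ≤ B * (2 * n) := by gcongr
    change _ ≤ U N / N
    rw [le_div_iff₀ hN0]
    have h13 : (a n - C / √n - 4 * B * n / N) * N = N * (a n - C / √n) - 4 * B * n := by
      field_simp
    rw [h13]
    have h14 : k * (U n - C * √n) = (N - r) * (a n - C / √n) := by
      rw [h7, h8, ← h5]; ring
    rw [h14] at h4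
    linarith
  -- Fix one `n` with `a n` close to the limsup and `C / √n` small, then let `N` grow: the liminf is
  -- almost as large as the limsup.
  refine ⟨limsup a atTop, tendsto_of_le_liminf_of_limsup_le ?_ le_rfl hbd₁ hbd₂⟩
  refine le_of_forall_pos_le_add fun ε hε => ?_
  have f₁ : ∃ᶠ n in atTop, limsup a atTop - ε / 3 < a n :=
    frequently_lt_of_lt_limsup hbd₂.isCoboundedUnder_le (by linarith)
  have f₂ : ∀ᶠ n : ℕ in atTop, C / √n < ε / 3 := by
    have : Tendsto (fun n : ℕ => C / √(n : ℝ)) atTop (𝓝 0) :=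
      tendsto_const_nhds.div_atTop (Real.tendsto_sqrt_atTop.comp tendsto_natCast_atTop_atTop)
    exact this.eventually_lt_const (by linarith)
  obtain ⟨n, hn₁, hn₂, hn⟩ := (f₁.and_eventually (f₂.and (eventually_gt_atTop 0))).exists
  have f₃ : ∀ᶠ N : ℕ in atTop, 4 * B * n / N < ε / 3 := by
    have : Tendsto (fun N : ℕ => 4 * B * n / (N : ℝ)) atTop (𝓝 0) :=
      tendsto_const_nhds.div_atTop tendsto_natCast_atTop_atTop
    exact this.eventually_lt_const (by linarith)
  have : limsup a atTop - ε ≤ liminf a atTop := by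
    refine le_liminf_of_le hbd₁.isCoboundedUnder_ge ?_
    filter_upwards [f₃, eventually_ge_atTop (2 * n)] with N h₁ h₂
    have := key n hn N h₂
    linarith
  linarith

/-! ### Convergence of the mean and of the free energy per node -/

section Limit

variable {K : ℕ} {Sh SJ : Type*} [MeasurableSpace Sh] [MeasurableSpace SJ]
  {νh : Measure Sh} [IsProbabilityMeasure νh] {νJ : Measure SJ} [IsProbabilityMeasure νJ]
  {h : Sh → ℝ → ℝ≥0} {J : SJ → (Fin K → ℝ) → ℝ≥0} {κ : ℝ} {r R : ℝ≥0} {Ω : Set ℝ}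
  {I : Type*} [Fintype I]

theorem SoftModel.abs_meanEnergy_le (S : SoftModel νh νJ h J κ r R Ω) {n : ℕ}
    (μ : I → Measure (Option (Fin K → Fin n))) [∀ i, IsProbabilityMeasure (μ i)] :
    |meanEnergy νh νJ h J μ| ≤ logRatio r R * (n + Fintype.card I) := by
  have := norm_integral_le_of_norm_le_const (μ := law νh νJ μ) (f := freeEnergy h J)
    ((S.ae_isSoft μ).mono fun _ hp => hp.abs_freeEnergy_le S)
  simpa [meanEnergy] using this

theorem SoftModel.meanEnergy_blocks (hK : 1 ≤ K) (S : SoftModel νh νJ h J κ r R Ω) {α : ℝ}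
    (hα0 : 0 < α) (hα : ∀ᵐ t ∂νJ, ∀ x, (J t x : ℝ) ≤ α) (hT : TensorConvex νJ J Ω α)
    {n s : ℕ} (hn : 0 < n) (hs : 0 < s) {l : ℝ} (hl : 0 ≤ l) (k : ℕ)
    (hl1 : l * (k * n + s : ℕ) ≤ 1) :
    k * meanEnergy νh νJ h J (fun _ : I => lazyEdge K n (l * n))
      + meanEnergy νh νJ h J (fun _ : I => lazyEdge K s (l * s))
      ≤ meanEnergy νh νJ h J (fun _ : I => lazyEdge K (k * n + s) (l * (k * n + s : ℕ))) := by
  induction k with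
  | zero =>
    have e : 0 * n + s = s := by omega
    rw [e]
    simp
  | succ k ih =>
    have e : (k + 1) * n + s = n + (k * n + s) := by ring
    have h1 : l * ((n : ℝ) + (k * n + s : ℕ)) ≤ 1 := by rw [e] at hl1; exact_mod_cast hl1
    have h2 := ih (le_trans (by gcongr; omega) hl1)
    have h3 := S.meanEnergy_superadditive (I := I) hK hα0 hα hT hn
      (show 0 < k * n + s by omega) hl h1
    rw [e]
    push_cast at h2 h3 ⊢
    linarith

/-- With rate `l = 1 / N` and `numEdges c N` slots, the full system has all edges present, while a
block of size `n` has presence probability `n / N`. Each block of size `n` costs `C * √n`; for the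
remainder the trivial linear bound suffices. -/
theorem SoftModel.exists_tendsto_uniformEnergy (hK : 1 ≤ K) (S : SoftModel νh νJ h J κ r R Ω)
    {α : ℝ} (hα0 : 0 < α) (hα : ∀ᵐ t ∂νJ, ∀ x, (J t x : ℝ) ≤ α) (hT : TensorConvex νJ J Ω α)
    {c : ℝ} (hc : 0 < c) :
    ∃ z : ℝ, Tendsto (fun N : ℕ => uniformEnergy νh νJ h J N (numEdges c N) / N) atTop (𝓝 z) := by
  obtain ⟨C, hC0, hC⟩ := S.abs_meanEnergy_lazy_sub_le hK hc
  have hL := logRatio_nonneg S.r_le S.le_R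
  have hM : ∀ N : ℕ, (numEdges c N : ℝ) ≤ c * N := fun N => Nat.floor_le (by positivity)
  have hb : ∀ n : ℕ, 0 < n → |uniformEnergy νh νJ h J n (numEdges c n)|
      ≤ logRatio r R * (1 + c) * n := by
    intro n hn
    have := isProbabilityMeasure_lazyEdge (K := K) hn zero_le_one le_rfl
    refine (S.abs_meanEnergy_le _).trans ?_
    rw [Fintype.card_fin, mul_assoc]
    gcongr
    linarith [hM n]
  refine exists_tendsto_div_of_block_superadditive (B := logRatio r R * (1 + c) + C) (C := C)
    (by positivity) (fun n hn => (hb n hn).trans (by gcongr; linarith)) ?_ hC0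
  intro n k s hn hs _
  set N := k * n + s with hN
  have hN0 : (0 : ℝ) < N := by exact_mod_cast (show 0 < N by omega)
  have hlN : (N : ℝ)⁻¹ * N = 1 := inv_mul_cancel₀ hN0.ne'
  have h1 := S.meanEnergy_blocks (I := Fin (numEdges c N)) hK hα0 hα hT hn
    (show 0 < s by omega) (l := (N : ℝ)⁻¹) (by positivity) k hlN.le
  rw [← hN, hlN] at h1
  have h3 := (abs_le.1 (hC s N (by omega) (by omega))).1
  have h4 := (abs_le.1 (hb s (by omega))).1
  have h5 : √(s : ℝ) ≤ s := by
    have : (1 : ℝ) ≤ s := by exact_mod_cast (show 1 ≤ s by omega)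
    rw [Real.sqrt_le_left (by linarith)]
    nlinarith
  have h6 : C * √s ≤ C * s := by gcongr
  rcases Nat.eq_zero_or_pos k with rfl | hk
  · simp only [Nat.cast_zero, zero_mul, zero_add] at h1 ⊢
    change _ ≤ uniformEnergy νh νJ h J N (numEdges c N)
    unfold uniformEnergy at *
    linarith
  · have h2 := (abs_le.1 (hC n N hn (by nlinarith))).1
    change _ ≤ uniformEnergy νh νJ h J N (numEdges c N)
    have h7 : (k : ℝ) * (uniformEnergy νh νJ h J n (numEdges c n) - C * √n)
        ≤ k * meanEnergy νh νJ h J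
          (fun _ : Fin (numEdges c N) => lazyEdge K n ((N : ℝ)⁻¹ * n)) := by
      gcongr; linarith
    unfold uniformEnergy at *
    linarith

/-- The free energy per node converges in probability. -/
theorem SoftModel.exists_tendsto_deviation (hK : 1 ≤ K) (S : SoftModel νh νJ h J κ r R Ω)
    {α : ℝ} (hα0 : 0 < α) (hα : ∀ᵐ t ∂νJ, ∀ x, (J t x : ℝ) ≤ α) (hT : TensorConvex νJ J Ω α)
    {c : ℝ} (hc : 0 < c) :
    ∃ z : ℝ, ∀ ε : ℝ, 0 < ε → Tendsto (fun N : ℕ =>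
      law νh νJ (fun _ : Fin (numEdges c N) => lazyEdge K N 1)
        {p | ε < |(N : ℝ)⁻¹ * freeEnergy h J p - z|}) atTop (𝓝 0) := by
  obtain ⟨z, hz⟩ := S.exists_tendsto_uniformEnergy hK hα0 hα hT hc
  obtain ⟨C, hC⟩ := S.exists_deviation_le hK hc.le
  refine ⟨z, fun ε hε => ?_⟩
  have h0 : Tendsto (fun N : ℕ => ENNReal.ofReal (4 * C / ε ^ 2 / N)) atTop (𝓝 0) := by
    rw [← ENNReal.ofReal_zero]
    exact ENNReal.tendsto_ofReal (tendsto_const_nhds.div_atTop tendsto_natCast_atTop_atTop)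
  refine tendsto_of_tendsto_of_tendsto_of_le_of_le' tendsto_const_nhds h0
    (Eventually.of_forall fun _ => zero_le) ?_
  filter_upwards [eventually_gt_atTop 0, hz.eventually (Metric.ball_mem_nhds z (half_pos hε))]
    with N hN hzN
  have hN0 : (0 : ℝ) < N := by exact_mod_cast hN
  replace hzN : |uniformEnergy νh νJ h J N (numEdges c N) / N - z| < ε / 2 := hzN
  have hM : (numEdges c N : ℝ) ≤ c * N := Nat.floor_le (by positivity)
  -- Half of `ε` is spent on the fluctuation around the mean, half on the distance of the mean from
  -- `z`.
  have ht : 0 < ε / 2 * N := by positivity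
  have hd := hC N (numEdges c N) hN hM (ε / 2 * N) ht
  have e : C * N / (ε / 2 * N) ^ 2 = 4 * C / ε ^ 2 / N := by field_simp; ring
  rw [e] at hd
  refine (measure_mono fun p hp => ?_).trans hd
  have hp : ε < |(N : ℝ)⁻¹ * freeEnergy h J p - z| := hp
  change _ ≤ |freeEnergy h J p - uniformEnergy νh νJ h J N (numEdges c N)|
  set U := uniformEnergy νh νJ h J N (numEdges c N)
  have h1 := abs_add_le ((N : ℝ)⁻¹ * freeEnergy h J p - U / N) (U / N - z)
  rw [sub_add_sub_cancel] at h1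
  have h2 : (N : ℝ)⁻¹ * freeEnergy h J p - U / N = (freeEnergy h J p - U) / N := by
    field_simp
  rw [h2, abs_div, Nat.abs_cast] at h1
  rw [← le_div_iff₀ hN0]
  linarith

end Limit

/-! ### Back to the Erdős–Rényi hypergraph -/

section Transfer

variable {K : ℕ} {Sh SJ : Type*} [MeasurableSpace Sh] [MeasurableSpace SJ]
  {νh : Measure Sh} [IsProbabilityMeasure νh] {νJ : Measure SJ} [IsProbabilityMeasure νJ]
  {h : Sh → ℝ → ℝ≥0} {J : SJ → (Fin K → ℝ) → ℝ≥0} {κ : ℝ} {r R : ℝ≥0} {Ω : Set ℝ}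

theorem measurePreserving_some (K n : ℕ) :
    MeasurePreserving some (uniformOn (Set.univ : Set (Fin K → Fin n))) (lazyEdge K n 1) := by
  have hm : Measurable (some : (Fin K → Fin n) → _) := Measurable.of_discrete
  refine ⟨hm, Measure.ext_of_singleton fun o => ?_⟩
  rw [Measure.map_apply hm (measurableSet_singleton o), uniformOn_univ]
  cases o with
  | none =>
    have : (some ⁻¹' {none} : Set (Fin K → Fin n)) = ∅ := by ext; simp
    simp [this, lazyEdge]
  | some a =>
    have : (some ⁻¹' {some a} : Set (Fin K → Fin n)) = {a} := by ext; simp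
    rw [this, Measure.count_singleton]
    -- The tuple `a` forces `n > 0` unless `K = 0`, and then the power is `1`.
    have hn : 0 < (n : ℝ) ^ K := by
      rcases Nat.eq_zero_or_pos K with rfl | hK
      · simp
      · have : 0 < n := (a ⟨0, hK⟩).pos
        positivity
    simp only [lazyEdge, sub_self, ENNReal.ofReal_zero, zero_smul, zero_add,
      Measure.coe_finsetSum, Finset.sum_apply, Measure.smul_apply, Measure.dirac_apply,
      smul_eq_mul]
    rw [Finset.sum_eq_single a (fun b _ hb => by simp [hb]) (by simp)]
    rw [ENNReal.ofReal_div_of_pos hn]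
    simp [ENNReal.ofReal_pow]

/-- Regard every edge as a present marked edge. -/
def markRealization {n m : ℕ} (G : Realization K n m Sh SJ) :
    (Fin n → Sh) × (Fin m → Mark K n SJ) :=
  (G.2.1, fun j => (some (G.1 j), G.2.2 j))

theorem measurePreserving_markRealization {c : ℝ} {N : ℕ} (hN : 0 < N) :
    MeasurePreserving markRealization (erdosRenyi K c νh νJ N)
      (law νh νJ fun _ : Fin (numEdges c N) => lazyEdge K N 1) := by
  have := isProbabilityMeasure_lazyEdge (K := K) hN zero_le_one le_rfl
  have : Nonempty (Fin N) := ⟨⟨0, hN⟩⟩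
  have : IsProbabilityMeasure (uniformOn (Set.univ : Set (Fin K → Fin N))) :=
    isProbabilityMeasure_uniformOn Set.finite_univ Set.univ_nonempty
  set M := numEdges c N
  set E := Measure.pi fun _ : Fin M => uniformOn (Set.univ : Set (Fin K → Fin N)) with hE
  set H := Measure.pi fun _ : Fin N => νh with hH
  set F := Measure.pi fun _ : Fin M => νJ with hF
  have a1 := (measurePreserving_some K N).prod (MeasurePreserving.id νJ)
  have a2 := measurePreserving_pi
    (fun _ : Fin M => (uniformOn (Set.univ : Set (Fin K → Fin N))).prod νJ) _ fun _ => a1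
  have a3 := (measurePreserving_arrowProdEquivProdArrow (Fin K → Fin N) SJ (Fin M)
    (fun _ => uniformOn (Set.univ : Set (Fin K → Fin N))) (fun _ => νJ)).symm
  have a4 := (MeasurePreserving.id H).prod (a2.comp a3)
  have a5 := measurePreserving_prodAssoc E H F
  have a6 := measurePreserving_prodAssoc H E F
  have a7 : MeasurePreserving Prod.swap (E.prod H) (H.prod E) := Measure.measurePreserving_swap
  exact a4.comp (a6.comp ((a7.prod (MeasurePreserving.id F)).comp a5.symm))

theorem partitionFunction_eq {n m : ℕ} (G : Realization K n m Sh SJ) :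
    partitionFunction G.1 (fun u => h (G.2.1 u)) (fun j => J (G.2.2 j))
      = factorPartition (fun v => h ((markRealization G).1 v))
          (fun j => markFactor J ((markRealization G).2 j)) :=
  rfl

theorem abs_inv_mul_log_sub (x : ℝ≥0∞) (h0 : x ≠ 0) (h1 : x ≠ ⊤) (a z : ℝ) :
    ((a : EReal) * ENNReal.log x - (z : EReal)).abs
      = ENNReal.ofReal |a * Real.log x.toReal - z| := by
  rw [ENNReal.log_pos_real h0 h1, ← EReal.coe_mul, ← EReal.coe_sub, EReal.abs_def]

theorem SoftModel.rightConverging (hK : 1 ≤ K) (S : SoftModel νh νJ h J κ r R Ω)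
    {α : ℝ} (hα0 : 0 < α) (hα : ∀ᵐ t ∂νJ, ∀ x, (J t x : ℝ) ≤ α) (hT : TensorConvex νJ J Ω α)
    {c : ℝ} (hc : 0 < c) : RightConverging c νh νJ h J := by
  obtain ⟨z, hz⟩ := S.exists_tendsto_deviation hK hα0 hα hT hc
  refine ⟨z, fun ε hε => ?_⟩
  refine tendsto_of_tendsto_of_tendsto_of_le_of_le' tendsto_const_nhds (hz ε hε)
    (Eventually.of_forall fun _ => zero_le) ?_
  filter_upwards [eventually_gt_atTop 0] with N hN
  have := isProbabilityMeasure_lazyEdge (K := K) hN zero_le_one le_rfl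
  have mp := measurePreserving_markRealization (K := K) (νh := νh) (νJ := νJ) (c := c) hN
  have hf := S.aemeasurable_freeEnergy fun _ : Fin (numEdges c N) => lazyEdge K N 1
  have hm : NullMeasurableSet {p | ε < |(N : ℝ)⁻¹ * freeEnergy h J p - z|}
      (law νh νJ fun _ : Fin (numEdges c N) => lazyEdge K N 1) := by
    refine nullMeasurableSet_lt aemeasurable_const ?_
    exact ((hf.const_mul _).sub_const _).abs
  rw [← mp.measure_preimage hm]
  -- Off a null set the potentials are admissible, so `Z` is positive and finite and the extended
  -- logarithm is the real one. An inclusion of events suffices, so measurability of the original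
  -- event is not needed.
  refine measure_mono_ae ?_
  filter_upwards [mp.quasiMeasurePreserving.ae (S.ae_isSoft _)] with G hG hω
  have hω : ENNReal.ofReal ε < ((((N : ℝ)⁻¹ : ℝ) : EReal) * ENNReal.log
    (partitionFunction G.1 (fun u => h (G.2.1 u)) (fun j => J (G.2.2 j))) - (z : EReal)).abs := hω
  rw [partitionFunction_eq, abs_inv_mul_log_sub _ (factorPartition_pos S.r_pos hG.1 hG.2)
    (factorPartition_ne_top hG.1 hG.2), ENNReal.ofReal_lt_ofReal_iff_of_nonneg hε.le] at hω
  exact hω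

end Transfer

/-! ### From the soft state assumptions to the normalized model -/

section Assumptions

variable {K : ℕ} {Sh SJ : Type*} [MeasurableSpace Sh] [MeasurableSpace SJ]
  {νh : Measure Sh} {νJ : Measure SJ} [IsProbabilityMeasure νJ]
  {h : Sh → ℝ → ℝ≥0} {J : SJ → (Fin K → ℝ) → ℝ≥0} {κ ρmin ρmax Jmax : ℝ} {Ωh : Set ℝ}

/-- Truncating the constants at `1` arranges `r ≤ 1 ≤ R`, which makes the factor `1` of an absent
edge admissible. -/
theorem SoftStates.softModel [SFinite νh] (hK : 1 ≤ K) (hh : IsRandomNodePotential νh h)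
    (hJ : IsRandomEdgePotential νJ J) (S : SoftStates νh νJ h J κ ρmin ρmax Jmax Ωh) :
    SoftModel νh νJ h J κ (min ρmin 1).toNNReal (max ρmax 1).toNNReal Ωh where
  node_meas := hh
  edge_meas := hJ
  r_pos := by simpa using S.ρmin_pos
  r_le := by simp
  le_R := by simp
  core := Set.Ico_subset_Icc_self.trans S.core_subset
  node := by
    have hm : ∀ᵐ s ∂νh, AEMeasurable (fun x => h s x) volume := by
      filter_upwards [hh.aestronglyMeasurable.prodMk_left] with s hs using hs.aemeasurable
    filter_upwards [hm, S.support, S.le_integral, S.integral_le] with s h1 h2 h3 h4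
    refine ⟨h1, h2, ?_, h4.trans (ENNReal.ofReal_le_ofReal (le_max_left _ _))⟩
    -- The node bound is on the closed interval, softness on the half-open one; they differ by a
    -- null set.
    rw [setLIntegral_congr Ico_ae_eq_Icc]
    exact (ENNReal.ofReal_le_ofReal (min_le_left _ _)).trans h3
  edge := by
    intro n
    have hm : ∀ᵐ t ∂νJ, ∀ a : Fin K → Fin n,
        AEMeasurable (fun x : Fin n → ℝ => J t fun k => x (a k)) volume := by
      refine ae_all_iff.2 fun a => ?_
      filter_upwards [(hJ.joint n a).aestronglyMeasurable.prodMk_left] with t ht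
        using ht.aemeasurable
    have hr1 : (min ρmin 1).toNNReal ≤ 1 := by simp
    have hR1 : 1 ≤ (max ρmax 1).toNNReal := by simp
    filter_upwards [hm, S.le_Jmax, ae_all_iff.2 S.soft] with t h1 h2 h3 o
    have hr : ∀ (i : Fin K) (x : Fin K → ℝ), x i ∈ Set.Ico 0 κ → (∀ k, x k ∈ Ωh) →
        (min ρmin 1).toNNReal ≤ J t x := fun i x hx hΩ =>
      Real.toNNReal_le_iff_le_coe.2 ((min_le_left _ _).trans (h3 i x hx hΩ))
    cases o with
    | none =>
      exact ⟨aemeasurable_const, fun _ => hR1, fun u hu => by simp [edgeNodes] at hu,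
        fun _ _ => hr1, fun _ _ _ _ => rfl⟩
    | some a =>
      refine ⟨h1 a, fun x => ?_, fun u hu x hx hΩ => ?_, fun x hx => ?_, fun u hu x y => ?_⟩
      · exact NNReal.coe_le_coe.1 <| le_trans (b := max ρmax 1)
          ((h2 _).trans (S.Jmax_le.trans (le_max_left _ _))) (Real.le_coe_toNNReal _)
      · obtain ⟨k, _, rfl⟩ := Finset.mem_image.1 hu
        exact hr k _ hx fun k => hΩ _
      · exact hr ⟨0, hK⟩ _ (hx _) fun k => S.core_subset (Set.Ico_subset_Icc_self (hx _))
      · have : ∀ k, a k ≠ u := fun k hk =>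
          hu (Finset.mem_image.2 ⟨k, Finset.mem_univ _, hk⟩)
        simp [markFactor, Function.update_of_ne (this _)]

theorem SoftStates.rightConverging [IsProbabilityMeasure νh] (hK : 1 ≤ K)
    (hh : IsRandomNodePotential νh h) (hJ : IsRandomEdgePotential νJ J)
    (S : SoftStates νh νJ h J κ ρmin ρmax Jmax Ωh) {α : ℝ} (hα : Jmax ≤ α)
    (hT : TensorConvex νJ J Ωh α) {c : ℝ} (hc : 0 < c) : RightConverging c νh νJ h J :=
  (S.softModel hK hh hJ).rightConverging hK (S.Jmax_pos.trans_le hα)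
    (S.le_Jmax.mono fun _ ht x => (ht x).trans hα) hT hc

end Assumptions

/-! ### Discrete spins as step functions -/

section Step

theorem eq_of_mem_Ico {q : ℕ} {i j : Fin q} {x : ℝ} (hi : x ∈ Set.Ico (i : ℝ) (i + 1))
    (hj : x ∈ Set.Ico (j : ℝ) (j + 1)) : i = j := by
  have h1 : (i : ℝ) < (j : ℕ) + 1 := hi.1.trans_lt hj.2
  have h2 : (j : ℝ) < (i : ℕ) + 1 := hj.1.trans_lt hi.2
  have h3 : (i : ℕ) < j + 1 := by exact_mod_cast h1
  have h4 : (j : ℕ) < i + 1 := by exact_mod_cast h2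
  exact Fin.ext (by omega)

theorem stepNode_of_mem {q : ℕ} (h : Fin q → ℝ≥0) {i : Fin q} {x : ℝ}
    (hx : x ∈ Set.Ico (i : ℝ) (i + 1)) : stepNode h x = h i := by
  rw [stepNode, Finset.sum_eq_single i _ (by simp), Set.indicator_of_mem hx]
  exact fun j _ hj => Set.indicator_of_notMem (fun hx' => hj (eq_of_mem_Ico hx' hx)) _

theorem stepNode_eq_zero {q : ℕ} (h : Fin q → ℝ≥0) {x : ℝ}
    (hx : ∀ i : Fin q, x ∉ Set.Ico (i : ℝ) (i + 1)) : stepNode h x = 0 :=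
  Finset.sum_eq_zero fun i _ => Set.indicator_of_notMem (hx i) _

theorem stepEdge_of_mem {q K : ℕ} (J : (Fin K → Fin q) → ℝ≥0) {i : Fin K → Fin q} {x : Fin K → ℝ}
    (hx : ∀ k, x k ∈ Set.Ico (i k : ℝ) (i k + 1)) : stepEdge J x = J i := by
  have hx' : x ∈ Set.univ.pi fun l => Set.Ico (i l : ℝ) ((i l : ℝ) + 1) := fun k _ => hx k
  rw [stepEdge, Finset.sum_eq_single i _ (by simp), Set.indicator_of_mem hx']
  exact fun j _ hj => Set.indicator_of_notMem
    (fun h' : x ∈ Set.univ.pi fun l => Set.Ico (j l : ℝ) ((j l : ℝ) + 1) =>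
      hj (funext fun k => eq_of_mem_Ico (h' k trivial) (hx k))) _

/-- The box of real spins represented by a discrete spin assignment. -/
def spinBox {q N : ℕ} (σ : Fin N → Fin q) : Set (Fin N → ℝ) :=
  Set.univ.pi fun u => Set.Ico (σ u : ℝ) (σ u + 1)

/-- The unit boxes are disjoint and the weight is constant on each. Outside them some spin lies in
no `[i, i + 1)`, and its node potential already kills the weight. -/
theorem weight_step {q K N M : ℕ} (e : Fin M → Fin K → Fin N) (h : Fin N → Fin q → ℝ≥0)
    (J : Fin M → (Fin K → Fin q) → ℝ≥0) (x : Fin N → ℝ) :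
    (weight e (fun u => stepNode (h u)) (fun j => stepEdge (J j)) x : ℝ≥0∞)
      = ∑ σ : Fin N → Fin q, (spinBox σ).indicator (fun _ => (weight e h J σ : ℝ≥0∞)) x := by
  by_cases hx : ∃ σ : Fin N → Fin q, x ∈ spinBox σ
  · obtain ⟨σ, hσ⟩ := hx
    have hσ' : ∀ u, x u ∈ Set.Ico (σ u : ℝ) (σ u + 1) := fun u => hσ u trivial
    rw [Finset.sum_eq_single σ _ (by simp), Set.indicator_of_mem hσ]
    · simp only [weight, fun u => stepNode_of_mem (h u) (hσ' u),
        fun j => stepEdge_of_mem (J j) (i := fun k => σ (e j k)) fun k => hσ' (e j k)]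
    · exact fun τ _ hτ => Set.indicator_of_notMem (fun h' : x ∈ spinBox τ =>
        hτ (funext fun u => eq_of_mem_Ico (h' u trivial) (hσ' u))) _
  · rw [Finset.sum_eq_zero fun σ _ => Set.indicator_of_notMem (fun h' => hx ⟨σ, h'⟩) _]
    have : ∃ u, ∀ i : Fin q, x u ∉ Set.Ico (i : ℝ) (i + 1) := by
      by_contra! hc
      choose σ hσ using hc
      exact hx ⟨σ, fun u _ => hσ u⟩
    obtain ⟨u, hu⟩ := this
    rw [weight, Finset.prod_eq_zero (Finset.mem_univ u) (stepNode_eq_zero (h u) hu)]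
    simp

theorem partitionFunction_step {q K N M : ℕ} (e : Fin M → Fin K → Fin N)
    (h : Fin N → Fin q → ℝ≥0) (J : Fin M → (Fin K → Fin q) → ℝ≥0) :
    partitionFunction e (fun u => stepNode (h u)) (fun j => stepEdge (J j))
      = discretePartitionFunction e h J := by
  have hm : ∀ σ : Fin N → Fin q, MeasurableSet (spinBox σ) := fun σ =>
    MeasurableSet.univ_pi fun u => measurableSet_Ico
  simp only [partitionFunction, weight_step]
  rw [lintegral_finsetSum _ fun σ _ => measurable_const.indicator (hm σ)]
  refine Finset.sum_congr rfl fun σ _ => ?_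
  -- Each box has volume `1`, so the integral is the plain sum of the weights.
  rw [lintegral_indicator_const (hm σ), spinBox, volume_pi_pi]
  simp

variable {q K : ℕ} {Sh SJ : Type*} [MeasurableSpace Sh] [MeasurableSpace SJ]
  {νh : Measure Sh} {νJ : Measure SJ}

theorem isRandomNodePotential_step [SFinite νh] {h : Sh → Fin q → ℝ≥0}
    (hh : ∀ i, AEMeasurable (fun s => h s i) νh) :
    IsRandomNodePotential νh fun s => stepNode (h s) := by
  refine Finset.aemeasurable_fun_sum _ fun i _ => ?_
  have : AEMeasurable (fun p : Sh × ℝ => h p.1 i) (νh.prod volume) :=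
    (hh i).comp_quasiMeasurePreserving Measure.quasiMeasurePreserving_fst
  exact this.indicator (measurable_snd (measurableSet_Ico (a := (i : ℝ)) (b := (i : ℝ) + 1)))

theorem isRandomEdgePotential_step [SFinite νJ] {J : SJ → (Fin K → Fin q) → ℝ≥0}
    (hJ : ∀ i, AEMeasurable (fun s => J s i) νJ) :
    IsRandomEdgePotential νJ fun s => stepEdge (J s) where
  eval x := by
    refine Finset.aemeasurable_fun_sum _ fun i _ => ?_
    by_cases hx : x ∈ Set.univ.pi fun l => Set.Ico (i l : ℝ) ((i l : ℝ) + 1)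
    · simpa only [Set.indicator_of_mem hx] using hJ i
    · simpa only [Set.indicator_of_notMem hx] using aemeasurable_const
  joint N v := by
    refine Finset.aemeasurable_fun_sum _ fun i _ => ?_
    have h1 : AEMeasurable (fun p : SJ × (Fin N → ℝ) => J p.1 i) (νJ.prod volume) :=
      (hJ i).comp_quasiMeasurePreserving Measure.quasiMeasurePreserving_fst
    have h2 : Measurable fun p : SJ × (Fin N → ℝ) => fun k => p.2 (v k) := by fun_prop
    exact h1.indicator (h2 (MeasurableSet.univ_pi fun l =>
      measurableSet_Ico (a := (i l : ℝ)) (b := (i l : ℝ) + 1)))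

theorem discreteRightConverging_of_step {c : ℝ} {h : Sh → Fin q → ℝ≥0}
    {J : SJ → (Fin K → Fin q) → ℝ≥0}
    (H : RightConverging c νh νJ (fun s => stepNode (h s)) fun s => stepEdge (J s)) :
    DiscreteRightConverging c νh νJ h J := by
  simpa only [RightConverging, DiscreteRightConverging, partitionFunction_step] using H

end Step

end

end SpinModel

theorem theorem1 {K : ℕ} (hK : 1 ≤ K) {c : ℝ} (hc : 0 < c)
    {Sh SJ : Type*} [MeasurableSpace Sh] [MeasurableSpace SJ]
    (νh : Measure Sh) [IsProbabilityMeasure νh] (νJ : Measure SJ) [IsProbabilityMeasure νJ] :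
    -- real spins
    (∀ (h : Sh → ℝ → ℝ≥0) (J : SJ → (Fin K → ℝ) → ℝ≥0),
      SpinModel.IsRandomNodePotential νh h → SpinModel.IsRandomEdgePotential νJ J →
      ∀ (κ ρmin ρmax Jmax : ℝ) (Ωh : Set ℝ),
        SpinModel.SoftStates νh νJ h J κ ρmin ρmax Jmax Ωh →
        (∃ α : ℝ, Jmax ≤ α ∧ SpinModel.TensorConvex νJ J Ωh α) →
        SpinModel.RightConverging c νh νJ h J) ∧
    -- discrete spins, through the step function extensions of the potentials
    (∀ (q : ℕ) (h : Sh → Fin q → ℝ≥0) (J : SJ → (Fin K → Fin q) → ℝ≥0),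
      (∀ i, AEMeasurable (fun s => h s i) νh) → (∀ i, AEMeasurable (fun s => J s i) νJ) →
      ∀ (κ ρmin ρmax Jmax : ℝ) (Ωh : Set ℝ),
        SpinModel.SoftStates νh νJ (fun s => SpinModel.stepNode (h s))
          (fun s => SpinModel.stepEdge (J s)) κ ρmin ρmax Jmax Ωh →
        (∃ α : ℝ, Jmax ≤ α ∧
          SpinModel.TensorConvex νJ (fun s => SpinModel.stepEdge (J s)) Ωh α) →
        SpinModel.DiscreteRightConverging c νh νJ h J) := by
  refine ⟨fun h J hh hJ κ ρmin ρmax Jmax Ωh S ⟨α, hα, hT⟩ => ?_,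
    fun q h J hh hJ κ ρmin ρmax Jmax Ωh S ⟨α, hα, hT⟩ => ?_⟩
  · exact S.rightConverging hK hh hJ hα hT hc
  · exact SpinModel.discreteRightConverging_of_step
      (S.rightConverging hK (SpinModel.isRandomNodePotential_step hh)
        (SpinModel.isRandomEdgePotential_step hJ) hα hT hc)
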